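/- Let $(\mathcal A,\mathcal E)$ be an exact category in the sense of Quillen: $\mathcal A$ is additive and $\mathcal E$ is a class of sequences $a'\to a\to a''$ (the admissible short exact sequences; their first and second maps are the admissible monomorphisms and admissible epimorphisms), closed under isomorphism, consisting of kernel–cokernel pairs, containing the split sequences $a'\to a'\oplus a''\to a''$, and such that admissible epimorphisms (monomorphisms) are closed under composition and under base change (cobase change) along arbitrary morphisms, which are required to exist, and a morphism $f$ that has a kernel (cokernel) is an admissible epimorphism (monomorphism) as soon as some composite $f\circ e$ (respectively $e\circ f$) is one. Let $\Pi=\{(i,j)\in\mathbb Z^2 : i\le j\}$ with the componentwise order. A functor $X:\Pi\to\mathcal A$ is admissible if $X_{i,j}\to X_{i,k}\to X_{j,k}$ is in $\mathcal E$ for all $i\le j\le k$. The Beilinson category $\underleftrightarrow{\lim}\,\mathcal A$ is the localization of the category of admissible functors at the morphisms $(X_{\varphi(i),\varphi(j)})\to(X_{\psi(i),\psi(j)})$, where $X$ is admissible and $\varphi\le\psi$ are nondecreasing maps $\mathbb Z\to\mathbb Z$ tending to $\pm\infty$ at $\pm\infty$. Call a sequence in $\mathrm{Ind}(\mathcal C)$,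 where $\mathcal C$ is equipped with a class of admissible sequences, admissible if it is isomorphic to the formal inductive limit, over a small filtered category, of a diagram of admissible sequences of $\mathcal C$; dually for $\mathrm{Pro}(\mathcal C)=\mathrm{Ind}(\mathcal C^{op})^{op}$. This defines the admissible sequences of $\mathrm{Ind}\,\mathrm{Pro}(\mathcal A)$, starting from $\mathcal E$. Then $\underleftrightarrow{\lim}\,\mathcal A$ has a natural structure of an exact category. Precisely: (1) $\mathrm{Ind}\,\mathrm{Pro}(\mathcal A)$ with its admissible sequences is an exact category. (2) $\underleftrightarrow{\lim}\,\mathcal A$ carries an additive structure for which the localization functor is additive, and the functor $X\mapsto \text{“}\varinjlim_j\text{”}\,\text{“}\varprojlim_{i\le j}\text{”}\,X_{i,j}$ from admissible functors to $\mathrm{Ind}\,\mathrm{Pro}(\mathcal A)$ factors, up to isomorphism, through a fully faithful additive functor $\iota:\underleftrightarrow{\lim}\,\mathcal A\to\mathrm{Ind}\,\mathrm{Pro}(\mathcal A)$. (3) The essential image of $\iota$ is closed under extensions: if $\iota X\to Y\to\iota Z$ is an admissible sequence of $\mathrm{Ind}\,\mathrm{Pro}(\mathcal A)$, then $Y$ is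 isomorphic to $\iota Y'$ for some $Y'$. (4) $\underleftrightarrow{\lim}\,\mathcal A$, with the class of all sequences $X\to Y\to Z$ whose image $\iota X\to\iota Y\to\iota Z$ is an admissible sequence of $\mathrm{Ind}\,\mathrm{Pro}(\mathcal A)$, is an exact category. -/

import Mathlib

open CategoryTheory CategoryTheory.Limits Opposite

universe v u

noncomputable section

namespace Beilinson

/-! ### Exact categories -/

/-- A class of sequences `X ⟶ Y ⟶ Z` in a category. -/
abbrev SequenceClass (C : Type u) [Category.{v} C] :=
  ∀ ⦃X Y Z : C⦄, (X ⟶ Y) → (Y ⟶ Z) → Prop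

/-- Isomorphism of the sequences `(f, g)` and `(f', g')`. -/
def SequenceIso {C : Type u} [Category.{v} C] {X Y Z X' Y' Z' : C}
    (f : X ⟶ Y) (g : Y ⟶ Z) (f' : X' ⟶ Y') (g' : Y' ⟶ Z') : Prop :=
  ∃ (a : X ≅ X') (b : Y ≅ Y') (c : Z ≅ Z'),
    f ≫ b.hom = a.hom ≫ f' ∧ g ≫ c.hom = b.hom ≫ g'

namespace SequenceClass

variable {C : Type u} [Category.{v} C] (S : SequenceClass C)

/-- Admissible monomorphisms: the first maps of the sequences of the class. -/
def AdmissibleMono {X Y : C} (f : X ⟶ Y) : Prop :=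
  ∃ (Z : C) (g : Y ⟶ Z), S f g

/-- Admissible epimorphisms: the second maps of the sequences of the class. -/
def AdmissibleEpi {Y Z : C} (g : Y ⟶ Z) : Prop :=
  ∃ (X : C) (f : X ⟶ Y), S f g

/-- The class of the opposite sequences, in the opposite category. -/
def op : SequenceClass Cᵒᵖ :=
  fun _ _ _ f g => S g.unop f.unop

/-- The preimage of a class of sequences under a functor. -/
def preimage {D : Type*} [Category* D] (F : D ⥤ C) : SequenceClass D :=
  fun _ _ _ f g => S (F.map f) (F.map g)

end SequenceClass

/-- `(C, S)` is an exact category in the sense of Quillen: `C` is additive, and `S` is the class of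
admissible short exact sequences. -/
structure IsExactStructure (C : Type u) [Category.{v} C] [Preadditive C]
    (S : SequenceClass C) : Prop where
  hasFiniteBiproducts : HasFiniteBiproducts C
  of_iso : ∀ {X Y Z X' Y' Z' : C} {f : X ⟶ Y} {g : Y ⟶ Z} {f' : X' ⟶ Y'} {g' : Y' ⟶ Z'},
    SequenceIso f g f' g' → S f g → S f' g'
  kernel_cokernel : ∀ {X Y Z : C} {f : X ⟶ Y} {g : Y ⟶ Z}, S f g →
    ∃ w : f ≫ g = 0, Nonempty (IsLimit (KernelFork.ofι f w)) ∧
      Nonempty (IsColimit (CokernelCofork.ofπ g w))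
  split : ∀ {X Z : C} (b : BinaryBicone X Z), b.IsBilimit → S b.inl b.snd
  epi_comp : ∀ {X Y Z : C} {f : X ⟶ Y} {g : Y ⟶ Z},
    S.AdmissibleEpi f → S.AdmissibleEpi g → S.AdmissibleEpi (f ≫ g)
  mono_comp : ∀ {X Y Z : C} {f : X ⟶ Y} {g : Y ⟶ Z},
    S.AdmissibleMono f → S.AdmissibleMono g → S.AdmissibleMono (f ≫ g)
  epi_pullback : ∀ {X Y Z : C} {g : X ⟶ Z}, S.AdmissibleEpi g → ∀ f : Y ⟶ Z,
    ∃ (P : C) (f' : P ⟶ X) (g' : P ⟶ Y), IsPullback f' g' g f ∧ S.AdmissibleEpi g'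
  mono_pushout : ∀ {X Y Z : C} {g : Z ⟶ X}, S.AdmissibleMono g → ∀ f : Z ⟶ Y,
    ∃ (P : C) (f' : X ⟶ P) (g' : Y ⟶ P), IsPushout g f f' g' ∧ S.AdmissibleMono g'
  epi_of_comp : ∀ {X Y Z : C} (e : X ⟶ Y) (f : Y ⟶ Z), HasKernel f →
    S.AdmissibleEpi (e ≫ f) → S.AdmissibleEpi f
  mono_of_comp : ∀ {X Y Z : C} (f : X ⟶ Y) (e : Y ⟶ Z), HasCokernel f →
    S.AdmissibleMono (f ≫ e) → S.AdmissibleMono f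

/-! ### Ind- and pro-objects -/

/-- The category of pro-objects, `Pro(C) = Ind(Cᵒᵖ)ᵒᵖ`. -/
abbrev Pro (C : Type u) [Category.{v} C] : Type (max u (v + 1)) := (Ind Cᵒᵖ)ᵒᵖ

/-- The category `Ind Pro(C)`. -/
abbrev IndPro (C : Type u) [Category.{v} C] : Type (max u (v + 1)) := Ind (Pro C)

/-- The formal projective limit, as a functor of the diagram. -/
def proLim (C : Type u) [Category.{v} C] (J : Type v) [SmallCategory J] [IsCofiltered J] :
    (J ⥤ C) ⥤ Pro C :=
  opOp (J ⥤ C) ⋙ (Functor.opHom J C).op ⋙ (Ind.lim (C := Cᵒᵖ) Jᵒᵖ).op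

/-- The sequences in `Ind(C)` that are isomorphic to the formal inductive limit, over a small
filtered category, of a diagram of sequences of the class `S`. -/
def SequenceClass.ind {C : Type u} [Category.{v} C] (S : SequenceClass C) :
    SequenceClass (Ind C) :=
  fun _ _ _ f g =>
    ∃ (I : Type v) (_ : SmallCategory I) (_ : IsFiltered I) (F G H : I ⥤ C)
      (α : F ⟶ G) (β : G ⟶ H),
      (∀ i, S (α.app i) (β.app i)) ∧
        SequenceIso ((Ind.lim I).map α) ((Ind.lim I).map β) f g

/-- The sequences in `Pro(C)` that are isomorphic to the formal projective limit, over a small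
cofiltered category, of a diagram of sequences of the class `S`. -/
def SequenceClass.pro {C : Type u} [Category.{v} C] (S : SequenceClass C) :
    SequenceClass (Pro C) :=
  S.op.ind.op

/-! ### The Beilinson category -/

/-- The preorder of the pairs of integers `(i, j)` with `i ≤ j`, ordered componentwise. -/
abbrev Pairs : Type := {p : ℤ × ℤ // p.1 ≤ p.2}

/-- The pair `(i, j)`. -/
abbrev pair (i j : ℤ) (h : i ≤ j) : Pairs := ⟨(i, j), h⟩

/-- The structure morphism `X_{i,j} ⟶ X_{i',j'}` of a diagram on `Pairs`. -/
abbrev str {A : Type u} [Category.{v} A] (X : Pairs ⥤ A) {i j i' j' : ℤ} (h : i ≤ j)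
    (h' : i' ≤ j') (hi : i ≤ i') (hj : j ≤ j') : X.obj (pair i j h) ⟶ X.obj (pair i' j' h') :=
  X.map (homOfLE (show pair i j h ≤ pair i' j' h' from ⟨hi, hj⟩))

/-- A diagram `X` is admissible if `X_{i,j} ⟶ X_{i,k} ⟶ X_{j,k}` belongs to the class `E` for all
`i ≤ j ≤ k`. -/
def admissible {A : Type u} [Category.{v} A] (E : SequenceClass A) :
    ObjectProperty (Pairs ⥤ A) :=
  fun X => ∀ (i j k : ℤ) (hij : i ≤ j) (hjk : j ≤ k),
    E (str X hij (hij.trans hjk) le_rfl hjk) (str X (hij.trans hjk) hjk hij le_rfl)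

/-- The category of admissible diagrams. -/
abbrev AdmDiagram {A : Type u} [Category.{v} A] (E : SequenceClass A) :=
  (admissible E).FullSubcategory

/-- A nondecreasing map `ℤ → ℤ` is bicofinal if it tends to `±∞` at `±∞`. -/
def Bicofinal (φ : ℤ →o ℤ) : Prop :=
  Filter.Tendsto φ Filter.atTop Filter.atTop ∧ Filter.Tendsto φ Filter.atBot Filter.atBot

/-- The endofunctor `(i, j) ↦ (φ i, φ j)` of `Pairs`. -/
def tilde (φ : ℤ →o ℤ) : Pairs ⥤ Pairs :=
  Monotone.functor (f := fun p : Pairs => pair (φ p.1.1) (φ p.1.2) (φ.monotone p.2))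
    fun _ _ h => ⟨φ.monotone h.1, φ.monotone h.2⟩

/-- The natural transformation between the endofunctors given by `φ ≤ ψ`. -/
def tildeMap {φ ψ : ℤ →o ℤ} (h : φ ≤ ψ) : tilde φ ⟶ tilde ψ where
  app p := homOfLE (show (tilde φ).obj p ≤ (tilde ψ).obj p from ⟨h p.1.1, h p.1.2⟩)

variable {A : Type u} [Category.{v} A] (E : SequenceClass A)

variable {E} in
/-- The reindexed diagram `X_{φ i, φ j}`. -/
def reindex (X : AdmDiagram E) (φ : ℤ →o ℤ) : AdmDiagram E where
  obj := tilde φ ⋙ X.obj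
  property i j k hij hjk := X.property (φ i) (φ j) (φ k) (φ.monotone hij) (φ.monotone hjk)

variable {E} in
/-- The morphism `X_{φ i, φ j} ⟶ X_{ψ i, ψ j}` for `φ ≤ ψ`. -/
def reindexMap (X : AdmDiagram E) {φ ψ : ℤ →o ℤ} (h : φ ≤ ψ) : reindex X φ ⟶ reindex X ψ :=
  ObjectProperty.homMk (Functor.whiskerRight (tildeMap h) X.obj)

/-- The class of the morphisms `X_{φ i, φ j} ⟶ X_{ψ i, ψ j}` with `φ ≤ ψ` bicofinal. -/
inductive IsReindexMap : ∀ ⦃X Y : AdmDiagram E⦄, (X ⟶ Y) → Prop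
  | mk (X : AdmDiagram E) (φ ψ : ℤ →o ℤ) (hφ : Bicofinal φ) (hψ : Bicofinal ψ) (h : φ ≤ ψ) :
      IsReindexMap (reindexMap X h)

/-- The same class, as a property of morphisms. -/
def reindexMaps : MorphismProperty (AdmDiagram E) := IsReindexMap E

/-- The Beilinson category: the localization of the category of admissible diagrams at the
reindexing morphisms. -/
abbrev BeilinsonCategory := (reindexMaps E).Localization

/-- The localization functor. -/
abbrev toBeilinson : AdmDiagram E ⥤ BeilinsonCategory E := (reindexMaps E).Q

/-! ### The functor to `Ind Pro(A)` -/

/-- The functor `j ↦ (i ↦ (min i j, j))`: in a diagram on `Pairs`, the projective system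
`(X_{i,j})_{i ≤ j}` with `j` fixed is extended by the constant value `X_{j,j}` to all integers `i`,
which does not change its formal projective limit. -/
def extend : ULift.{v} ℤ ⥤ ULift.{v} ℤ ⥤ Pairs where
  obj j := Monotone.functor
    (f := fun i : ULift.{v} ℤ => pair (min i.down j.down) j.down (min_le_right _ _))
    fun _ _ h => ⟨min_le_min_right _ h, le_rfl⟩
  map {j j'} f :=
    have h : j.down ≤ j'.down := (leOfHom f : j ≤ j')
    { app := fun _ => homOfLE ⟨min_le_min_left _ h, h⟩ }

/-- The functor `X ↦ “colim”_j “lim”_i X_{i,j}` from diagrams on `Pairs` to `Ind Pro(A)`. -/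
def indProLim (A : Type u) [Category.{v} A] : (Pairs ⥤ A) ⥤ IndPro A where
  obj X := (Ind.lim (ULift.{v} ℤ)).obj
    (extend.{v} ⋙ (Functor.whiskeringRight _ _ _).obj X ⋙ proLim A (ULift.{v} ℤ))
  map f := (Ind.lim (ULift.{v} ℤ)).map
    (Functor.whiskerLeft extend.{v}
      (Functor.whiskerRight ((Functor.whiskeringRight _ _ _).map f) (proLim A (ULift.{v} ℤ))))
  map_id X := by
    rw [← (Ind.lim (ULift.{v} ℤ)).map_id]
    congr 1
    ext j
    simp
  map_comp f g := by
    rw [← (Ind.lim (ULift.{v} ℤ)).map_comp]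
    congr 1
    ext j
    simp

end Beilinson

end

/-! Ind-objects are studied through their generalized elements, the morphisms from representables.
Representables are compact, so elements and relations between them live at a finite stage of any
presentation. A sequence of `Ind(C)` turns out to be admissible exactly when it is left exact on
elements and its second map lifts elements after an admissible epimorphism of `C` (`ind_iff`). This
criterion mentions no presentation, so composites and pullbacks become short chases. Its hard half
is `exists_ind_lim`: a map that lifts elements locally is a formal limit of admissible epimorphisms,
taken over a filtered category of covers. Pushouts are formed pointwise after straightening the
given map over a comma category. Applying the result to the opposite category and then once more
makes `Ind Pro(A)` exact. The axioms on composites with a given morphism follow from the others.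

For an admissible diagram `X` put `X_j = “lim”_i X_{i,j}`. The sequences `X_i ⟶ X_j ⟶ X_{i,j}` are
admissible in `Pro(A)` (`pro_tr_prj`), so the ind-pro-object of `X` is exhausted by subobjects `X_j`
whose successive quotients lie in `A`. A morphism between two such objects carries each term into
some term, and each term of the target contains the image of some term of the source. After
reindexing the source it therefore preserves the filtrations and induces a morphism of diagrams on
the quotients (`exists_indProLim_map_eq`). Reindexing maps become isomorphisms, and every morphism
of the localization is a fraction `X ⟵ X_φ ⟶ Y` (`isFraction`); hence `ι` is fully faithful.

In an extension `Y` of the object of `Z` by that of `X`, consider the lattices: pro-objects inside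
`Y` that are extensions of some `Z_l` by some `X_k`. Every lattice lies strictly inside a larger one
and strictly contains a smaller one, which gives a chain indexed by the integers. Its quotients are
extensions of objects of `A`, hence belong to `A`; the chain exhausts `Y` and is separated, so its
quotients form an admissible diagram that gives back `Y`. Exactness of the Beilinson category is
then the general fact on full additive subcategories closed under extensions
(`IsExactCore.preimage`). -/

noncomputable section

namespace Beilinson

/-! ### Generalized elements of ind-objects -/

namespace IndObj

variable {C : Type u} [Category.{v} C]

/-- The embedding of `C` into `Ind C`. -/
abbrev y (C : Type u) [Category.{v} C] : C ⥤ Ind C := Ind.yoneda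

/-- The morphisms from a representable ind-object to `X` are the elements of the presheaf `X`. -/
def elemEquiv (c : C) (X : Ind C) :
    ((y C).obj c ⟶ X) ≃ ((Ind.inclusion C).obj X).obj (op c) :=
  Ind.inclusion.fullyFaithful.homEquiv.trans
    ((Iso.homCongr (Ind.yonedaCompInclusion.app c) (Iso.refl _)).trans yonedaEquiv)

lemma elemEquiv_comp {c : C} {X Y : Ind C} (t : (y C).obj c ⟶ X) (f : X ⟶ Y) :
    elemEquiv c Y (t ≫ f) = ((Ind.inclusion C).map f).app (op c) (elemEquiv c X t) := by
  simp [elemEquiv, yonedaEquiv, Functor.FullyFaithful.homEquiv]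

/-- Maps out of a representable ind-object are computed pointwise. -/
def coyonedaIso (c : C) :
    coyoneda.obj (op ((y C).obj c)) ≅ Ind.inclusion C ⋙ (evaluation _ _).obj (op c) :=
  NatIso.ofComponents (fun X => (elemEquiv c X).toIso) (by
    intro X Y f
    ext t
    exact elemEquiv_comp t f)

/-- Representables are compact because filtered colimits of ind-objects are computed pointwise on
presheaves. This yields `exists_fac_inj` and `exists_eq_of_inj_eq`. -/
instance (c : C) (I : Type v) [SmallCategory I] [IsFiltered I] :
    PreservesColimitsOfShape I (coyoneda.obj (op ((y C).obj c))) :=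
  preservesColimitsOfShape_of_natIso (coyonedaIso c).symm

section lim

variable {I : Type v} [SmallCategory I] [IsFiltered I]

/-- The structure maps of a formal inductive limit. -/
def inj (F : I ⥤ C) (i : I) : (y C).obj (F.obj i) ⟶ (Ind.lim I).obj F :=
  colimit.ι (F ⋙ Ind.yoneda) i

@[simp]
lemma map_inj (F : I ⥤ C) {i j : I} (s : i ⟶ j) : (y C).map (F.map s) ≫ inj F j = inj F i :=
  colimit.w (F ⋙ Ind.yoneda) s

@[simp]
lemma inj_map {F G : I ⥤ C} (α : F ⟶ G) (i : I) :
    inj F i ≫ (Ind.lim I).map α = (y C).map (α.app i) ≫ inj G i := by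
  simp [inj, Ind.lim]

@[simp]
lemma map_inj_assoc (F : I ⥤ C) {i j : I} (s : i ⟶ j) {X : Ind C}
    (f : (Ind.lim I).obj F ⟶ X) : (y C).map (F.map s) ≫ inj F j ≫ f = inj F i ≫ f := by
  rw [← Category.assoc, map_inj]

@[simp]
lemma inj_map_assoc {F G : I ⥤ C} (α : F ⟶ G) (i : I) {X : Ind C}
    (f : (Ind.lim I).obj G ⟶ X) :
    inj F i ≫ (Ind.lim I).map α ≫ f = (y C).map (α.app i) ≫ inj G i ≫ f := by
  rw [← Category.assoc, inj_map, Category.assoc]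

/-- The morphism from a formal inductive limit given by a compatible family. -/
def limDesc {F : I ⥤ C} {X : Ind C} (τ : ∀ i, (y C).obj (F.obj i) ⟶ X)
    (h : ∀ {i j : I} (s : i ⟶ j), (y C).map (F.map s) ≫ τ j = τ i) : (Ind.lim I).obj F ⟶ X :=
  colimit.desc (F ⋙ Ind.yoneda) ⟨X, { app := τ, naturality := fun i j s => by simpa using h s }⟩

@[simp]
lemma inj_limDesc {F : I ⥤ C} {X : Ind C} (τ : ∀ i, (y C).obj (F.obj i) ⟶ X)
    (h : ∀ {i j : I} (s : i ⟶ j), (y C).map (F.map s) ≫ τ j = τ i) (i : I) :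
    inj F i ≫ limDesc τ h = τ i :=
  colimit.ι_desc (F := F ⋙ Ind.yoneda) _ i

lemma lim_hom_ext {F : I ⥤ C} {X : Ind C} {f g : (Ind.lim I).obj F ⟶ X}
    (h : ∀ i, inj F i ≫ f = inj F i ≫ g) : f = g :=
  colimit.hom_ext (F := F ⋙ Ind.yoneda) h

lemma exists_fac_inj {F : I ⥤ C} {c : C} (t : (y C).obj c ⟶ (Ind.lim I).obj F) :
    ∃ (i : I) (a : c ⟶ F.obj i), t = (y C).map a ≫ inj F i := by
  obtain ⟨i, s, hs⟩ := Types.jointly_surjective _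
    (isColimitOfPreserves (coyoneda.obj (op ((y C).obj c)))
      (colimit.isColimit (F ⋙ Ind.yoneda))) t
  obtain ⟨a, rfl⟩ := (y C).map_surjective s
  exact ⟨i, a, hs.symm⟩

lemma exists_eq_of_inj_eq {F : I ⥤ C} {c : C} {i : I} {a b : c ⟶ F.obj i}
    (h : (y C).map a ≫ inj F i = (y C).map b ≫ inj F i) :
    ∃ (j : I) (s : i ⟶ j), a ≫ F.map s = b ≫ F.map s := by
  obtain ⟨k, s, t, hst⟩ := (Types.FilteredColimit.isColimit_eq_iff _
    (isColimitOfPreserves (coyoneda.obj (op ((y C).obj c)))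
      (colimit.isColimit (F ⋙ Ind.yoneda))) (i := i) (j := i)
      (xi := (y C).map a) (xj := (y C).map b)).1 h
  have hst' : (y C).map (a ≫ F.map s) = (y C).map (b ≫ F.map t) := by
    simpa using hst
  have hst'' := (y C).map_injective hst'
  -- The colimit only gives two arrows `s`, `t` out of `i`; coequalizing them leaves a single one.
  refine ⟨IsFiltered.coeq s t, s ≫ IsFiltered.coeqHom s t, ?_⟩
  rw [F.map_comp, ← Category.assoc, hst'', Category.assoc, ← F.map_comp,
    ← IsFiltered.coeq_condition, F.map_comp]

end lim

lemma exists_presentation (X : Ind C) :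
    ∃ (I : Type v) (_ : SmallCategory I) (_ : IsFiltered I) (F : I ⥤ C),
      Nonempty ((Ind.lim I).obj F ≅ X) :=
  ⟨X.presentation.I, inferInstance, inferInstance, X.presentation.F,
    ⟨X.colimitPresentationCompYoneda⟩⟩

lemma hom_ext {X Y : Ind C} {f g : X ⟶ Y}
    (h : ∀ (c : C) (t : (y C).obj c ⟶ X), t ≫ f = t ≫ g) : f = g := by
  obtain ⟨I, _, _, F, ⟨e⟩⟩ := exists_presentation X
  rw [← cancel_epi e.hom]
  exact lim_hom_ext fun i => by simpa using h _ (inj F i ≫ e.hom)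

/-- A morphism of ind-objects from a natural family of maps on elements. -/
lemma exists_hom {X Y : Ind C} (τ : ∀ c : C, ((y C).obj c ⟶ X) → ((y C).obj c ⟶ Y))
    (h : ∀ (c d : C) (a : c ⟶ d) (t : (y C).obj d ⟶ X),
      τ c ((y C).map a ≫ t) = (y C).map a ≫ τ d t) :
    ∃ f : X ⟶ Y, ∀ (c : C) (t : (y C).obj c ⟶ X), t ≫ f = τ c t := by
  obtain ⟨I, _, _, F, ⟨e⟩⟩ := exists_presentation X
  refine ⟨e.inv ≫ limDesc (fun i => τ _ (inj F i ≫ e.hom)) ?_, fun c t => ?_⟩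
  · intro i j s
    rw [← h, map_inj_assoc]
  · obtain ⟨i, a, ha⟩ := exists_fac_inj (t ≫ e.inv)
    rw [← Category.assoc, ha, Category.assoc, inj_limDesc, ← h, ← Category.assoc, ← ha]
    simp

/-- Injectivity makes the chosen preimages natural in the test object, so `exists_hom` assembles
them into an inverse. -/
lemma isIso_of_bijective {X Y : Ind C} (f : X ⟶ Y)
    (h₁ : ∀ (c : C) (s t : (y C).obj c ⟶ X), s ≫ f = t ≫ f → s = t)
    (h₂ : ∀ (c : C) (t : (y C).obj c ⟶ Y), ∃ s : (y C).obj c ⟶ X, s ≫ f = t) : IsIso f := by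
  choose τ hτ using h₂
  obtain ⟨g, hg⟩ := exists_hom τ (fun c d a t => h₁ _ _ _ (by simp [hτ]))
  have hgf : g ≫ f = 𝟙 Y := hom_ext fun c t => by rw [← Category.assoc, hg, hτ, Category.comp_id]
  exact ⟨g, hom_ext fun c t => h₁ _ _ _ (by simp [hgf]), hgf⟩

lemma mono_of_injective {X Y : Ind C} (f : X ⟶ Y)
    (h : ∀ (c : C) (s t : (y C).obj c ⟶ X), s ≫ f = t ≫ f → s = t) : Mono f :=
  ⟨fun a b hab => hom_ext fun c t => h _ _ _ (by simp [hab])⟩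

/-- The category of elements of an ind-object is filtered. `exists_common` and `exists_coeq` express
this and allow computing with elements without fixing a presentation. -/
instance (X : Ind C) : IsFiltered (CostructuredArrow (y C) X) :=
  RepresentablyCoflat.filtered X

lemma exists_common {X : Ind C} {c c' : C} (t : (y C).obj c ⟶ X) (t' : (y C).obj c' ⟶ X) :
    ∃ (d : C) (u : (y C).obj d ⟶ X) (a : c ⟶ d) (a' : c' ⟶ d),
      t = (y C).map a ≫ u ∧ t' = (y C).map a' ≫ u := by
  let s := IsFiltered.leftToMax (CostructuredArrow.mk t) (CostructuredArrow.mk t')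
  let s' := IsFiltered.rightToMax (CostructuredArrow.mk t) (CostructuredArrow.mk t')
  exact ⟨_, _, s.left, s'.left, (CostructuredArrow.w s).symm, (CostructuredArrow.w s').symm⟩

lemma exists_coeq {X : Ind C} {c d : C} (u : (y C).obj d ⟶ X) (a b : c ⟶ d)
    (h : (y C).map a ≫ u = (y C).map b ≫ u) :
    ∃ (d' : C) (u' : (y C).obj d' ⟶ X) (e : d ⟶ d'), u = (y C).map e ≫ u' ∧ a ≫ e = b ≫ e := by
  let s : CostructuredArrow.mk ((y C).map a ≫ u) ⟶ CostructuredArrow.mk u :=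
    CostructuredArrow.homMk a rfl
  let s' : CostructuredArrow.mk ((y C).map a ≫ u) ⟶ CostructuredArrow.mk u :=
    CostructuredArrow.homMk b h.symm
  refine ⟨_, _, (IsFiltered.coeqHom s s').left,
    (CostructuredArrow.w (IsFiltered.coeqHom s s')).symm, ?_⟩
  exact congrArg CommaMorphism.left (IsFiltered.coeq_condition s s')

/-! ### The additive structure -/

section Preadditive

variable [Preadditive C]

/-- The sum is formed in a representable through which both elements factor. Two such factorizations
agree after passing to a third one further along, so the result does not depend on the choice. -/
lemma exists_add {X : Ind C} {c : C} (s t : (y C).obj c ⟶ X) :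
    ∃ r : (y C).obj c ⟶ X, ∀ (d : C) (u : (y C).obj d ⟶ X) (a b : c ⟶ d),
      s = (y C).map a ≫ u → t = (y C).map b ≫ u → r = (y C).map (a + b) ≫ u := by
  obtain ⟨d₀, u₀, a₀, b₀, rfl, rfl⟩ := exists_common s t
  refine ⟨(y C).map (a₀ + b₀) ≫ u₀, fun d u a b ha hb => ?_⟩
  obtain ⟨d₁, u₁, e, e₀, rfl, rfl⟩ := exists_common u u₀
  simp only [← Category.assoc, ← Functor.map_comp] at ha hb ⊢
  obtain ⟨d₂, u₂, f, rfl, hf⟩ := exists_coeq _ _ _ ha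
  simp only [← Category.assoc, ← Functor.map_comp] at hb ⊢
  obtain ⟨d₃, u₃, g, rfl, hg⟩ := exists_coeq _ _ _ hb
  simp only [← Category.assoc, ← Functor.map_comp, Preadditive.add_comp] at hf hg ⊢
  simp only [Category.assoc] at hf hg ⊢
  rw [reassoc_of% hf, hg]

lemma exists_neg {X : Ind C} {c : C} (s : (y C).obj c ⟶ X) :
    ∃ r : (y C).obj c ⟶ X, ∀ (d : C) (u : (y C).obj d ⟶ X) (a : c ⟶ d),
      s = (y C).map a ≫ u → r = (y C).map (-a) ≫ u := by
  obtain ⟨d₀, u₀, a₀, _, rfl, -⟩ := exists_common s s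
  refine ⟨(y C).map (-a₀) ≫ u₀, fun d u a ha => ?_⟩
  obtain ⟨d₁, u₁, e, e₀, rfl, rfl⟩ := exists_common u u₀
  simp only [← Category.assoc, ← Functor.map_comp] at ha ⊢
  obtain ⟨d₂, u₂, f, rfl, hf⟩ := exists_coeq _ _ _ ha
  simp only [← Category.assoc, ← Functor.map_comp, Preadditive.neg_comp] at hf ⊢
  rw [hf]

lemma exists_zero (X : Ind C) (c : C) :
    ∃ r : (y C).obj c ⟶ X, ∀ (d : C) (u : (y C).obj d ⟶ X), r = (y C).map 0 ≫ u := by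
  let s : CostructuredArrow (y C) X := IsFiltered.nonempty.some
  refine ⟨(y C).map 0 ≫ s.hom, fun d u => ?_⟩
  obtain ⟨d₁, u₁, e, e₀, h, rfl⟩ := exists_common s.hom u
  rw [h]
  simp only [← Category.assoc, ← Functor.map_comp, zero_comp]

/-- The sum of two elements of an ind-object. -/
def elemAdd {X : Ind C} {c : C} (s t : (y C).obj c ⟶ X) : (y C).obj c ⟶ X :=
  (exists_add s t).choose

lemma elemAdd_eq {X : Ind C} {c d : C} (u : (y C).obj d ⟶ X) (a b : c ⟶ d) :
    elemAdd ((y C).map a ≫ u) ((y C).map b ≫ u) = (y C).map (a + b) ≫ u :=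
  (exists_add _ _).choose_spec _ _ _ _ rfl rfl

/-- The opposite of an element of an ind-object. -/
def elemNeg {X : Ind C} {c : C} (s : (y C).obj c ⟶ X) : (y C).obj c ⟶ X :=
  (exists_neg s).choose

lemma elemNeg_eq {X : Ind C} {c d : C} (u : (y C).obj d ⟶ X) (a : c ⟶ d) :
    elemNeg ((y C).map a ≫ u) = (y C).map (-a) ≫ u :=
  (exists_neg _).choose_spec _ _ _ rfl

/-- The zero element of an ind-object. -/
def elemZero (X : Ind C) (c : C) : (y C).obj c ⟶ X := (exists_zero X c).choose

lemma elemZero_eq {X : Ind C} {c d : C} (u : (y C).obj d ⟶ X) :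
    elemZero X c = (y C).map 0 ≫ u :=
  (exists_zero X c).choose_spec _ _

lemma elemAdd_comp {X Y : Ind C} {c : C} (s t : (y C).obj c ⟶ X) (f : X ⟶ Y) :
    elemAdd s t ≫ f = elemAdd (s ≫ f) (t ≫ f) := by
  obtain ⟨d, u, a, b, rfl, rfl⟩ := exists_common s t
  simp only [elemAdd_eq, Category.assoc]

lemma comp_elemAdd {X : Ind C} {c d : C} (a : c ⟶ d) (s t : (y C).obj d ⟶ X) :
    (y C).map a ≫ elemAdd s t = elemAdd ((y C).map a ≫ s) ((y C).map a ≫ t) := by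
  obtain ⟨d, u, a, b, rfl, rfl⟩ := exists_common s t
  simp only [elemAdd_eq, ← Category.assoc, ← Functor.map_comp, Preadditive.comp_add]

lemma comp_elemNeg {X : Ind C} {c d : C} (a : c ⟶ d) (s : (y C).obj d ⟶ X) :
    (y C).map a ≫ elemNeg s = elemNeg ((y C).map a ≫ s) := by
  obtain ⟨d, u, a, -, rfl, -⟩ := exists_common s s
  simp only [elemNeg_eq, ← Category.assoc, ← Functor.map_comp, Preadditive.comp_neg]

lemma comp_elemZero {X : Ind C} {c d : C} (a : c ⟶ d) :
    (y C).map a ≫ elemZero X d = elemZero X c := by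
  let s : CostructuredArrow (y C) X := IsFiltered.nonempty.some
  rw [elemZero_eq s.hom, elemZero_eq s.hom, ← Category.assoc, ← Functor.map_comp, comp_zero]

lemma exists_homAdd {X Y : Ind C} (f g : X ⟶ Y) :
    ∃ h : X ⟶ Y, ∀ (c : C) (t : (y C).obj c ⟶ X), t ≫ h = elemAdd (t ≫ f) (t ≫ g) :=
  exists_hom _ fun c d a t => by simp only [comp_elemAdd, Category.assoc]

lemma exists_homNeg {X Y : Ind C} (f : X ⟶ Y) :
    ∃ h : X ⟶ Y, ∀ (c : C) (t : (y C).obj c ⟶ X), t ≫ h = elemNeg (t ≫ f) :=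
  exists_hom _ fun c d a t => by simp only [comp_elemNeg, Category.assoc]

lemma exists_homZero (X Y : Ind C) :
    ∃ h : X ⟶ Y, ∀ (c : C) (t : (y C).obj c ⟶ X), t ≫ h = elemZero Y c :=
  exists_hom _ fun c d a t => by simp only [comp_elemZero]

/-- The sum of two morphisms of ind-objects. -/
def homAdd {X Y : Ind C} (f g : X ⟶ Y) : X ⟶ Y := (exists_homAdd f g).choose

lemma comp_homAdd {X Y : Ind C} (f g : X ⟶ Y) {c : C} (t : (y C).obj c ⟶ X) :
    t ≫ homAdd f g = elemAdd (t ≫ f) (t ≫ g) := (exists_homAdd f g).choose_spec c t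

/-- The opposite of a morphism of ind-objects. -/
def homNeg {X Y : Ind C} (f : X ⟶ Y) : X ⟶ Y := (exists_homNeg f).choose

lemma comp_homNeg {X Y : Ind C} (f : X ⟶ Y) {c : C} (t : (y C).obj c ⟶ X) :
    t ≫ homNeg f = elemNeg (t ≫ f) := (exists_homNeg f).choose_spec c t

/-- The zero morphism of ind-objects. -/
def homZero (X Y : Ind C) : X ⟶ Y := (exists_homZero X Y).choose

lemma comp_homZero (X Y : Ind C) {c : C} (t : (y C).obj c ⟶ X) :
    t ≫ homZero X Y = elemZero Y c := (exists_homZero X Y).choose_spec c t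

lemma elemAdd_assoc {X : Ind C} {c : C} (r s t : (y C).obj c ⟶ X) :
    elemAdd (elemAdd r s) t = elemAdd r (elemAdd s t) := by
  obtain ⟨d, u, a, b, rfl, rfl⟩ := exists_common r s
  obtain ⟨d', u', a', b', rfl, rfl⟩ := exists_common u t
  simp only [← Category.assoc, ← Functor.map_comp, elemAdd_eq]
  simp [add_assoc]

lemma elemAdd_comm {X : Ind C} {c : C} (s t : (y C).obj c ⟶ X) :
    elemAdd s t = elemAdd t s := by
  obtain ⟨d, u, a, b, rfl, rfl⟩ := exists_common s t
  simp only [elemAdd_eq, add_comm]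

lemma elemZero_add {X : Ind C} {c : C} (t : (y C).obj c ⟶ X) :
    elemAdd (elemZero X c) t = t := by
  obtain ⟨d, u, a, -, rfl, -⟩ := exists_common t t
  rw [elemZero_eq u, elemAdd_eq, zero_add]

lemma elemNeg_add {X : Ind C} {c : C} (t : (y C).obj c ⟶ X) :
    elemAdd (elemNeg t) t = elemZero X c := by
  obtain ⟨d, u, a, -, rfl, -⟩ := exists_common t t
  rw [elemNeg_eq, elemAdd_eq, elemZero_eq u, neg_add_cancel]

/-- The group of morphisms of ind-objects. -/
@[reducible]
def homGroup (X Y : Ind C) : AddCommGroup (X ⟶ Y) :=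
  letI : Add (X ⟶ Y) := ⟨homAdd⟩
  letI : Neg (X ⟶ Y) := ⟨homNeg⟩
  letI : Zero (X ⟶ Y) := ⟨homZero X Y⟩
  { AddGroup.ofLeftAxioms (G := X ⟶ Y)
      (fun f g h => hom_ext fun c t => by
        change t ≫ homAdd (homAdd f g) h = t ≫ homAdd f (homAdd g h)
        simp only [comp_homAdd, elemAdd_assoc])
      (fun f => hom_ext fun c t => by
        change t ≫ homAdd (homZero X Y) f = t ≫ f
        simp only [comp_homAdd, comp_homZero, elemZero_add])
      (fun f => hom_ext fun c t => by
        change t ≫ homAdd (homNeg f) f = t ≫ homZero X Y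
        simp only [comp_homAdd, comp_homNeg, comp_homZero, elemNeg_add]) with
    add_comm := fun f g => hom_ext fun c t => by
      change t ≫ homAdd f g = t ≫ homAdd g f
      rw [comp_homAdd, comp_homAdd, elemAdd_comm] }

instance preadditive : Preadditive (Ind C) where
  homGroup := homGroup
  add_comp X Y Z f f' g := hom_ext fun c t => by
    change t ≫ homAdd f f' ≫ g = t ≫ homAdd (f ≫ g) (f' ≫ g)
    rw [← Category.assoc, comp_homAdd, elemAdd_comp, comp_homAdd, Category.assoc, Category.assoc]
  comp_add X Y Z f g g' := hom_ext fun c t => by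
    change t ≫ f ≫ homAdd g g' = t ≫ homAdd (f ≫ g) (f ≫ g')
    rw [← Category.assoc, comp_homAdd, comp_homAdd, Category.assoc, Category.assoc]

instance : (y C).Additive where
  map_add {X Y f g} := by
    refine hom_ext fun c t => ?_
    obtain ⟨a, rfl⟩ := (y C).map_surjective t
    have h := comp_homAdd ((y C).map f) ((y C).map g) ((y C).map a)
    refine Eq.trans ?_ h.symm
    rw [← Functor.map_comp, ← Functor.map_comp, ← Functor.map_comp]
    have := elemAdd_eq (𝟙 ((y C).obj Y)) (a ≫ f) (a ≫ g)
    simp only [Category.comp_id] at this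
    rw [this, Preadditive.comp_add]

instance [HasFiniteBiproducts C] : HasFiniteBiproducts (Ind C) :=
  HasFiniteBiproducts.of_hasFiniteCoproducts

end Preadditive

end IndObj

/-! ### Kernels and cokernels -/

section Kernels

variable {C : Type u} [Category.{v} C] [Preadditive C]

/-- `f` is a kernel of `g`. -/
structure IsKer {X Y Z : C} (f : X ⟶ Y) (g : Y ⟶ Z) : Prop where
  w : f ≫ g = 0
  mono : Mono f
  lift : ∀ {T : C} (t : T ⟶ Y), t ≫ g = 0 → ∃ s : T ⟶ X, s ≫ f = t

/-- `g` is a cokernel of `f`. -/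
structure IsCok {X Y Z : C} (f : X ⟶ Y) (g : Y ⟶ Z) : Prop where
  w : f ≫ g = 0
  epi : Epi g
  desc : ∀ {T : C} (t : Y ⟶ T), f ≫ t = 0 → ∃ s : Z ⟶ T, g ≫ s = t

variable {X Y Z : C} {f : X ⟶ Y} {g : Y ⟶ Z}

lemma IsKer.isLimit (h : IsKer f g) : Nonempty (IsLimit (KernelFork.ofι f h.w)) :=
  have := h.mono
  ⟨KernelFork.IsLimit.ofι' f h.w fun t ht => ⟨(h.lift t ht).choose, (h.lift t ht).choose_spec⟩⟩

lemma IsKer.of_isLimit {w : f ≫ g = 0} (h : IsLimit (KernelFork.ofι f w)) : IsKer f g where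
  w := w
  mono := Fork.IsLimit.mono h
  lift t ht := ⟨_, (KernelFork.IsLimit.lift' h t ht).2⟩

lemma IsCok.isColimit (h : IsCok f g) : Nonempty (IsColimit (CokernelCofork.ofπ g h.w)) :=
  have := h.epi
  ⟨CokernelCofork.IsColimit.ofπ' g h.w fun t ht =>
    ⟨(h.desc t ht).choose, (h.desc t ht).choose_spec⟩⟩

lemma IsCok.of_isColimit {w : f ≫ g = 0} (h : IsColimit (CokernelCofork.ofπ g w)) :
    IsCok f g where
  w := w
  epi := Cofork.IsColimit.epi h
  desc t ht := ⟨_, (CokernelCofork.IsColimit.desc' h t ht).2⟩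

lemma IsKer.hasKernel (h : IsKer f g) : HasKernel g :=
  ⟨⟨⟨_, h.isLimit.some⟩⟩⟩

lemma IsCok.hasCokernel (h : IsCok f g) : HasCokernel f :=
  ⟨⟨⟨_, h.isColimit.some⟩⟩⟩

lemma IsKer.op (h : IsKer f g) : IsCok g.op f.op where
  w := by rw [← op_comp, h.w, op_zero]
  epi := have := h.mono; inferInstance
  desc t ht := by
    obtain ⟨s, hs⟩ := h.lift t.unop (Quiver.Hom.op_inj (by simpa using ht))
    exact ⟨s.op, Quiver.Hom.unop_inj (by simpa using hs)⟩

lemma IsCok.op (h : IsCok f g) : IsKer g.op f.op where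
  w := by rw [← op_comp, h.w, op_zero]
  mono := have := h.epi; inferInstance
  lift t ht := by
    obtain ⟨s, hs⟩ := h.desc t.unop (Quiver.Hom.op_inj (by simpa using ht))
    exact ⟨s.op, Quiver.Hom.unop_inj (by simpa using hs)⟩

lemma IsKer.exists_iso {X' : C} {f' : X' ⟶ Y} (h : IsKer f g) (h' : IsKer f' g) :
    ∃ e : X ≅ X', e.hom ≫ f' = f := by
  have := h.mono
  have := h'.mono
  obtain ⟨s, hs⟩ := h'.lift f h.w
  obtain ⟨t, ht⟩ := h.lift f' h'.w
  exact ⟨⟨s, t, by rw [← cancel_mono f]; simp [ht, hs], by rw [← cancel_mono f']; simp [ht, hs]⟩, hs⟩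

lemma IsCok.exists_iso {Z' : C} {g' : Y ⟶ Z'} (h : IsCok f g) (h' : IsCok f g') :
    ∃ e : Z ≅ Z', g ≫ e.hom = g' := by
  have := h.epi
  have := h'.epi
  obtain ⟨s, hs⟩ := h'.desc g h.w
  obtain ⟨t, ht⟩ := h.desc g' h'.w
  refine ⟨⟨t, s, ?_, ?_⟩, ht⟩
  · rw [← cancel_epi g, ← Category.assoc, ht, hs, Category.comp_id]
  · rw [← cancel_epi g', ← Category.assoc, hs, ht, Category.comp_id]

end Kernels

/-! ### Exact categories without the redundant axioms -/

/-- The axioms of an exact category, without the ones on composites with a given morphism. -/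
structure IsExactCore (C : Type u) [Category.{v} C] [Preadditive C]
    (S : SequenceClass C) : Prop where
  hasFiniteBiproducts : HasFiniteBiproducts C
  of_iso : ∀ {X Y Z X' Y' Z' : C} {f : X ⟶ Y} {g : Y ⟶ Z} {f' : X' ⟶ Y'} {g' : Y' ⟶ Z'},
    SequenceIso f g f' g' → S f g → S f' g'
  ker : ∀ {X Y Z : C} {f : X ⟶ Y} {g : Y ⟶ Z}, S f g → IsKer f g
  cok : ∀ {X Y Z : C} {f : X ⟶ Y} {g : Y ⟶ Z}, S f g → IsCok f g
  split : ∀ {X Y Z : C} (i₁ : X ⟶ Y) (p₁ : Y ⟶ X) (i₂ : Z ⟶ Y) (p₂ : Y ⟶ Z),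
    i₁ ≫ p₁ = 𝟙 X → i₂ ≫ p₂ = 𝟙 Z → i₁ ≫ p₂ = 0 → i₂ ≫ p₁ = 0 → p₁ ≫ i₁ + p₂ ≫ i₂ = 𝟙 Y → S i₁ p₂
  epi_comp : ∀ {X Y Z : C} {f : X ⟶ Y} {g : Y ⟶ Z},
    S.AdmissibleEpi f → S.AdmissibleEpi g → S.AdmissibleEpi (f ≫ g)
  mono_comp : ∀ {X Y Z : C} {f : X ⟶ Y} {g : Y ⟶ Z},
    S.AdmissibleMono f → S.AdmissibleMono g → S.AdmissibleMono (f ≫ g)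
  epi_pullback : ∀ {X Y Z : C} {g : X ⟶ Z}, S.AdmissibleEpi g → ∀ f : Y ⟶ Z,
    ∃ (P : C) (f' : P ⟶ X) (g' : P ⟶ Y), IsPullback f' g' g f ∧ S.AdmissibleEpi g'
  mono_pushout : ∀ {X Y Z : C} {g : Z ⟶ X}, S.AdmissibleMono g → ∀ f : Z ⟶ Y,
    ∃ (P : C) (f' : X ⟶ P) (g' : Y ⟶ P), IsPushout g f f' g' ∧ S.AdmissibleMono g'

section Core

variable {C : Type u} [Category.{v} C] {S : SequenceClass C}

lemma op_admissibleEpi_iff {X Y : Cᵒᵖ} (f : X ⟶ Y) :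
    S.op.AdmissibleEpi f ↔ S.AdmissibleMono f.unop :=
  ⟨fun ⟨Z, g, h⟩ => ⟨Z.unop, g.unop, h⟩, fun ⟨Z, g, h⟩ => ⟨.op Z, g.op, h⟩⟩

lemma op_admissibleMono_iff {X Y : Cᵒᵖ} (f : X ⟶ Y) :
    S.op.AdmissibleMono f ↔ S.AdmissibleEpi f.unop :=
  ⟨fun ⟨Z, g, h⟩ => ⟨Z.unop, g.unop, h⟩, fun ⟨Z, g, h⟩ => ⟨.op Z, g.op, h⟩⟩

variable [Preadditive C]

lemma IsExactStructure.core (h : IsExactStructure C S) : IsExactCore C S where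
  hasFiniteBiproducts := h.hasFiniteBiproducts
  of_iso := h.of_iso
  ker hfg := .of_isLimit (h.kernel_cokernel hfg).choose_spec.1.some
  cok hfg := .of_isColimit (h.kernel_cokernel hfg).choose_spec.2.some
  split {X Y Z} i₁ p₁ i₂ p₂ h₁ h₂ h₃ h₄ h₅ := by
    let b : BinaryBicone X Z :=
      { pt := Y, inl := i₁, inr := i₂, fst := p₁, snd := p₂,
        inl_fst := h₁, inl_snd := h₃, inr_fst := h₄, inr_snd := h₂ }
    exact h.split b (isBinaryBilimitOfTotal b h₅)
  epi_comp := h.epi_comp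
  mono_comp := h.mono_comp
  epi_pullback := h.epi_pullback
  mono_pushout := h.mono_pushout

lemma hasFiniteBiproducts_op [HasFiniteBiproducts C] : HasFiniteBiproducts Cᵒᵖ :=
  HasFiniteBiproducts.of_hasFiniteProducts

namespace IsExactCore

variable (h : IsExactCore C S)
include h

lemma op : IsExactCore Cᵒᵖ S.op where
  hasFiniteBiproducts := have := h.hasFiniteBiproducts; hasFiniteBiproducts_op
  of_iso := by
    rintro X Y Z X' Y' Z' f g f' g' ⟨a, b, c, h₁, h₂⟩ hfg
    refine h.of_iso ⟨c.unop.symm, b.unop.symm, a.unop.symm, ?_, ?_⟩ hfg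
    · have := congrArg Quiver.Hom.unop h₂
      simp only [unop_comp] at this
      change g.unop ≫ b.unop.inv = c.unop.inv ≫ g'.unop
      rw [Iso.comp_inv_eq, Category.assoc, Iso.eq_inv_comp]
      exact this
    · have := congrArg Quiver.Hom.unop h₁
      simp only [unop_comp] at this
      change f.unop ≫ a.unop.inv = b.unop.inv ≫ f'.unop
      rw [Iso.comp_inv_eq, Category.assoc, Iso.eq_inv_comp]
      exact this
  ker hfg := (h.cok hfg).op
  cok hfg := (h.ker hfg).op
  split i₁ p₁ i₂ p₂ h₁ h₂ h₃ h₄ h₅ := by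
    refine h.split p₂.unop i₂.unop p₁.unop i₁.unop ?_ ?_ ?_ ?_ ?_
    · rw [← unop_comp, h₂, unop_id]
    · rw [← unop_comp, h₁, unop_id]
    · rw [← unop_comp, h₃, unop_zero]
    · rw [← unop_comp, h₄, unop_zero]
    · rw [← unop_comp, ← unop_comp, ← unop_add, add_comm, h₅, unop_id]
  epi_comp hf hg := by
    rw [op_admissibleEpi_iff] at *
    exact h.mono_comp hg hf
  mono_comp hf hg := by
    rw [op_admissibleMono_iff] at *
    exact h.epi_comp hg hf
  epi_pullback hg f := by
    rw [op_admissibleEpi_iff] at hg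
    obtain ⟨P, f', g', hP, hg'⟩ := h.mono_pushout hg f.unop
    exact ⟨.op P, f'.op, g'.op, hP.flip.op, (op_admissibleEpi_iff _).2 hg'⟩
  mono_pushout hg f := by
    rw [op_admissibleMono_iff] at hg
    obtain ⟨P, f', g', hP, hg'⟩ := h.epi_pullback hg f.unop
    exact ⟨.op P, f'.op, g'.op, hP.flip.op, (op_admissibleMono_iff _).2 hg'⟩

lemma hasBinaryBiproducts : HasBinaryBiproducts C :=
  have := h.hasFiniteBiproducts
  hasBinaryBiproducts_of_finite_biproducts C

lemma of_isKer {X Y Z : C} {f : X ⟶ Y} {g : Y ⟶ Z} (hg : S.AdmissibleEpi g) (hf : IsKer f g) :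
    S f g := by
  obtain ⟨X', f', h'⟩ := hg
  obtain ⟨e, he⟩ := (h.ker h').exists_iso hf
  exact h.of_iso ⟨e, Iso.refl _, Iso.refl _, by simp [he], by simp⟩ h'

lemma of_isCok {X Y Z : C} {f : X ⟶ Y} {g : Y ⟶ Z} (hf : S.AdmissibleMono f) (hg : IsCok f g) :
    S f g := by
  obtain ⟨Z', g', h'⟩ := hf
  obtain ⟨e, he⟩ := (h.cok h').exists_iso hg
  exact h.of_iso ⟨Iso.refl _, Iso.refl _, e, by simp, by simp [he]⟩ h'

lemma admissibleMono_comp_iso {X Y Y' : C} {f : X ⟶ Y} (hf : S.AdmissibleMono f) (e : Y ≅ Y') :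
    S.AdmissibleMono (f ≫ e.hom) := by
  obtain ⟨Z, g, hg⟩ := hf
  exact ⟨Z, e.inv ≫ g, h.of_iso ⟨Iso.refl _, e, Iso.refl _, by simp, by simp⟩ hg⟩

lemma admissibleEpi_iso_comp {Y Y' Z : C} {g : Y ⟶ Z} (hg : S.AdmissibleEpi g) (e : Y' ≅ Y) :
    S.AdmissibleEpi (e.hom ≫ g) := by
  obtain ⟨X, f, hf⟩ := hg
  exact ⟨X, f ≫ e.inv, h.of_iso ⟨Iso.refl _, e.symm, Iso.refl _, by simp, by simp⟩ hf⟩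

lemma admissibleEpi_of_isPullback {P X Y Z : C} {f' : P ⟶ X} {g' : P ⟶ Y} {g : X ⟶ Z}
    {f : Y ⟶ Z} (hP : IsPullback f' g' g f) (hg : S.AdmissibleEpi g) : S.AdmissibleEpi g' := by
  obtain ⟨P₁, f₁, g₁, hP₁, hg₁⟩ := h.epi_pullback hg f
  rw [← hP.isoIsPullback_hom_snd _ _ hP₁]
  exact h.admissibleEpi_iso_comp hg₁ _

lemma admissibleMono_of_isPushout {P X Y Z : C} {f' : X ⟶ P} {g' : Y ⟶ P} {g : Z ⟶ X}
    {f : Z ⟶ Y} (hP : IsPushout g f f' g') (hg : S.AdmissibleMono g) : S.AdmissibleMono g' := by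
  obtain ⟨P₁, f₁, g₁, hP₁, hg₁⟩ := h.mono_pushout hg f
  rw [← hP₁.inr_isoIsPushout_hom _ _ hP]
  exact h.admissibleMono_comp_iso hg₁ _

/-- Keller's argument. The map `(0, f) : X ⟶ Z ⊞ Y` is the composite of the split mono `(1, f)`, of
`(f ≫ e) ⊞ 1`, which is a pushout of `f ≫ e`, and of a shear `θ`; so it is an admissible mono. Its
cokernel is `1 ⊞ cokernel.π f`, whose pullback along the inclusion of `Y` is `cokernel.π f`. The
latter is thus an admissible epi, and `f` is its kernel. -/
lemma mono_of_comp {X Y Z : C} (f : X ⟶ Y) (e : Y ⟶ Z) (hf : HasCokernel f)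
    (hfe : S.AdmissibleMono (f ≫ e)) : S.AdmissibleMono f := by
  have := h.hasBinaryBiproducts
  have h₁ : S.AdmissibleMono (biprod.lift (𝟙 X) f) :=
    ⟨Y, biprod.desc (-f) (𝟙 Y), h.split _ biprod.fst biprod.inr _ (by simp) (by simp) (by simp)
      (by simp) (by ext <;> simp)⟩
  have h₂ : S.AdmissibleMono (biprod.map (f ≫ e) (𝟙 Y)) := by
    refine h.admissibleMono_of_isPushout (f := biprod.inl) (f' := biprod.inl) ?_ hfe
    refine ⟨⟨by simp⟩, ⟨PushoutCocone.IsColimit.mk _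
      (fun s => biprod.desc s.inl (biprod.inr ≫ s.inr)) (fun s => by simp) (fun s => ?_)
      (fun s m hm₁ hm₂ => ?_)⟩⟩
    · ext
      · simpa using s.condition
      · simp
    · ext
      · simp [hm₁]
      · simp [← hm₂]
  let θ : Z ⊞ Y ≅ Z ⊞ Y :=
    { hom := biprod.lift (biprod.fst - biprod.snd ≫ e) biprod.snd
      inv := biprod.lift (biprod.fst + biprod.snd ≫ e) biprod.snd
      hom_inv_id := by ext <;> simp
      inv_hom_id := by ext <;> simp }
  have h₃ : S.AdmissibleMono (biprod.lift (0 : X ⟶ Z) f) := by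
    have := h.admissibleMono_comp_iso (h.mono_comp h₁ h₂) θ
    convert this using 1
    ext <;> simp [θ]
  have hk : IsCok f (cokernel.π f) :=
    .of_isColimit (w := cokernel.condition f) (cokernelIsCokernel f)
  have h₄ : S (biprod.lift (0 : X ⟶ Z) f) (biprod.map (𝟙 Z) (cokernel.π f)) := by
    refine h.of_isCok h₃ ⟨by ext <;> simp, ?_, fun {T} t ht => ?_⟩
    · refine ⟨fun s t hst => ?_⟩
      have e₁ := biprod.inl ≫= hst
      have e₂ := biprod.inr ≫= hst
      simp only [biprod.inl_map_assoc, biprod.inr_map_assoc, cancel_epi, Category.id_comp] at e₁ e₂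
      exact biprod.hom_ext' _ _ e₁ e₂
    · obtain ⟨s, hs⟩ := hk.desc (biprod.inr ≫ t) (by simpa [biprod.lift_eq] using ht)
      exact ⟨biprod.desc (biprod.inl ≫ t) s, by ext <;> simp [hs]⟩
  have h₅ : S.AdmissibleEpi (cokernel.π f) := by
    refine h.admissibleEpi_of_isPullback (f := biprod.inr) (f' := biprod.inr) ?_ ⟨_, _, h₄⟩
    refine ⟨⟨by simp⟩, ⟨PullbackCone.IsLimit.mk _ (fun s => s.fst ≫ biprod.snd) (fun s => ?_)
      (fun s => ?_) (fun s m hm₁ hm₂ => ?_)⟩⟩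
    · have := s.condition =≫ biprod.fst
      ext
      · simpa using this.symm
      · simp
    · simpa using s.condition =≫ biprod.snd
    · simp [← hm₁]
  refine ⟨_, _, h.of_isKer h₅ ⟨cokernel.condition f, ⟨fun s t hst => ?_⟩, fun t ht => ?_⟩⟩
  · have := (h.ker h₄).mono
    rw [← cancel_mono (biprod.lift (0 : X ⟶ Z) f)]
    ext <;> simp [hst]
  · obtain ⟨s, hs⟩ := (h.ker h₄).lift (biprod.lift 0 t) (by ext <;> simp [ht])
    exact ⟨s, by simpa using hs =≫ biprod.snd⟩

lemma epi_of_comp {X Y Z : C} (e : X ⟶ Y) (f : Y ⟶ Z) (hf : HasKernel f)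
    (hef : S.AdmissibleEpi (e ≫ f)) : S.AdmissibleEpi f := by
  have hk : IsKer (kernel.ι f) f :=
    .of_isLimit (w := kernel.condition f) (kernelIsKernel f)
  have := h.op.mono_of_comp f.op e.op hk.op.hasCokernel
    ((op_admissibleMono_iff _).2 (by simpa using hef))
  simpa [op_admissibleMono_iff] using this

lemma exact : IsExactStructure C S where
  hasFiniteBiproducts := h.hasFiniteBiproducts
  of_iso := h.of_iso
  kernel_cokernel hfg := ⟨(h.ker hfg).w, (h.ker hfg).isLimit, (h.cok hfg).isColimit⟩
  split b hb := h.split b.inl b.fst b.inr b.snd (by simp) (by simp) (by simp) (by simp)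
    (IsBilimit.binary_total hb)
  epi_comp := h.epi_comp
  mono_comp := h.mono_comp
  epi_pullback := h.epi_pullback
  mono_pushout := h.mono_pushout
  epi_of_comp := h.epi_of_comp
  mono_of_comp := h.mono_of_comp

/-! ### Diagram chases -/

lemma admissibleEpi_id (X : C) : S.AdmissibleEpi (𝟙 X) := by
  have := h.hasFiniteBiproducts
  have : HasZeroObject C := hasZeroObject_of_hasFiniteBiproducts C
  open ZeroObject in
  exact ⟨0, 0, h.split 0 0 (𝟙 X) (𝟙 X) (by simp) (by simp) (by simp) (by simp) (by simp)⟩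

lemma epi {Y Z : C} {g : Y ⟶ Z} (hg : S.AdmissibleEpi g) : Epi g :=
  (h.cok hg.choose_spec.choose_spec).epi

/-- Factoring through a monomorphism is local for admissible epimorphisms. -/
lemma exists_lift_of_admissibleEpi {T' T X Y : C} {e : T' ⟶ T} (he : S.AdmissibleEpi e)
    {m : X ⟶ Y} [Mono m] (t : T ⟶ Y) (s : T' ⟶ X) (hst : e ≫ t = s ≫ m) :
    ∃ w : T ⟶ X, w ≫ m = t := by
  obtain ⟨K, k, hk⟩ := he
  have := (h.cok hk).epi
  obtain ⟨w, hw⟩ := (h.cok hk).desc s (by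
    rw [← cancel_mono m, Category.assoc, ← hst, ← Category.assoc, (h.cok hk).w, zero_comp,
      zero_comp])
  exact ⟨w, by rw [← cancel_epi e, ← Category.assoc, hw, hst]⟩

/-- In the chases below this replaces the choice of a preimage of an element. -/
lemma exists_cover {X Y T : C} {g : X ⟶ Y} (hg : S.AdmissibleEpi g) (z : T ⟶ Y) :
    ∃ (T' : C) (p : T' ⟶ T) (x : T' ⟶ X), S.AdmissibleEpi p ∧ x ≫ g = p ≫ z := by
  obtain ⟨P, f', g', hP, hg'⟩ := h.epi_pullback hg z
  exact ⟨P, g', f', hg', hP.w⟩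

/-- Reduces admissibility to a kernel computation and one test map `t`. -/
lemma of_isKer_of_comp {X Y Z T : C} {f : X ⟶ Y} {g : Y ⟶ Z} (hf : IsKer f g) (t : T ⟶ Y)
    (ht : S.AdmissibleEpi (t ≫ g)) : S f g :=
  h.of_isKer (h.epi_of_comp t g hf.hasKernel ht) hf

/-- The pushout of an admissible sequence. -/
lemma exists_pushout {X Y Z X' : C} {f : X ⟶ Y} {g : Y ⟶ Z} (hfg : S f g) (a : X ⟶ X') :
    ∃ (P : C) (f' : X' ⟶ P) (b : Y ⟶ P) (q : P ⟶ Z), IsPushout f a b f' ∧ S f' q ∧ b ≫ q = g := by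
  obtain ⟨P, b, f', hP, hf'⟩ := h.mono_pushout ⟨Z, g, hfg⟩ a
  have hg := h.cok hfg
  have := hg.epi
  let q : P ⟶ Z := hP.desc g 0 (by simp [hg.w])
  have hbq : b ≫ q = g := hP.inl_desc _ _ _
  have hfq : f' ≫ q = 0 := hP.inr_desc _ _ _
  refine ⟨P, f', b, q, hP, h.of_isCok hf' ⟨hfq, ?_, fun t ht => ?_⟩, hbq⟩
  · exact ⟨fun s t hst => by rw [← cancel_epi g, ← hbq, Category.assoc, Category.assoc, hst]⟩
  · obtain ⟨s, hs⟩ := hg.desc (b ≫ t) (by rw [← Category.assoc, hP.w, Category.assoc, ht, comp_zero])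
    refine ⟨s, hP.hom_ext ?_ ?_⟩
    · rw [← Category.assoc, hbq, hs]
    · rw [← Category.assoc, hfq, ht, zero_comp]

/-- The kernel is the pullback of `g` along `-f`, and the restriction to the second summand is `g`
itself. -/
lemma admissibleEpi_biprodDesc [HasBinaryBiproducts C] {X Y Z : C} (f : X ⟶ Z) {g : Y ⟶ Z}
    (hg : S.AdmissibleEpi g) : S.AdmissibleEpi (biprod.desc f g) := by
  obtain ⟨P, a, b, hP, -⟩ := h.epi_pullback hg (-f)
  have hk : IsKer (biprod.lift b a) (biprod.desc f g) := by
    refine ⟨by simp [biprod.lift_desc, hP.w], ⟨fun s t hst => hP.hom_ext ?_ ?_⟩, fun t ht => ?_⟩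
    · simpa using hst =≫ biprod.snd
    · simpa using hst =≫ biprod.fst
    · refine ⟨hP.lift (t ≫ biprod.snd) (t ≫ biprod.fst) ?_, ?_⟩
      · rw [biprod.desc_eq, Preadditive.comp_add, ← Category.assoc, ← Category.assoc] at ht
        rw [Preadditive.comp_neg]
        exact eq_neg_of_add_eq_zero_right ht
      · ext <;> simp
  exact ⟨P, _, h.of_isKer_of_comp hk biprod.inr (by simpa using hg)⟩

/-- The admissible sequence of quotients of a composite of admissible monomorphisms. -/
lemma quotients {X Y Z Q W R : C} {f : X ⟶ Y} {p : Y ⟶ Q} {g : Y ⟶ Z} {q : Z ⟶ R} {r : Z ⟶ W}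
    {u : Q ⟶ W} {v : W ⟶ R} (hp : S f p) (hq : S g q) (hr : S (f ≫ g) r) (hu : p ≫ u = g ≫ r)
    (hv : r ≫ v = q) : S u v := by
  have := (h.cok hp).epi
  have := (h.ker hq).mono
  have hmono : Mono u := by
    refine Preadditive.mono_of_cancel_zero _ fun {T} t ht => ?_
    obtain ⟨T', e, t', he, het⟩ := h.exists_cover ⟨_, _, hp⟩ t
    have := h.epi he
    obtain ⟨s, hs⟩ := (h.ker hr).lift (t' ≫ g) (by
      rw [Category.assoc, ← hu, ← Category.assoc, het, Category.assoc, ht, comp_zero])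
    rw [← Category.assoc, cancel_mono] at hs
    rw [← cancel_epi e, ← het, ← hs, Category.assoc, (h.ker hp).w, comp_zero, comp_zero]
  refine h.of_isKer_of_comp (t := r) ⟨?_, hmono, fun {T} t ht => ?_⟩ (hv ▸ ⟨_, _, hq⟩)
  · rw [← cancel_epi p, ← Category.assoc, hu, Category.assoc, hv, (h.ker hq).w, comp_zero]
  · obtain ⟨T', e, t', he, het⟩ := h.exists_cover ⟨_, _, hr⟩ t
    obtain ⟨s, hs⟩ := (h.ker hq).lift t' (by
      rw [← hv, ← Category.assoc, het, Category.assoc, ht, comp_zero])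
    refine h.exists_lift_of_admissibleEpi he t (s ≫ p) ?_
    rw [← het, ← hs, Category.assoc, Category.assoc, hu]

lemma exists_quotients {X Y Z Q W R : C} {f : X ⟶ Y} {p : Y ⟶ Q} {g : Y ⟶ Z} {q : Z ⟶ R}
    {r : Z ⟶ W} (hp : S f p) (hq : S g q) (hr : S (f ≫ g) r) :
    ∃ (u : Q ⟶ W) (v : W ⟶ R), p ≫ u = g ≫ r ∧ r ≫ v = q ∧ S u v := by
  obtain ⟨u, hu⟩ := (h.cok hp).desc (g ≫ r) (by rw [← Category.assoc, (h.cok hr).w])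
  obtain ⟨v, hv⟩ := (h.cok hr).desc q (by rw [Category.assoc, (h.cok hq).w, comp_zero])
  exact ⟨u, v, hu, hv, h.quotients hp hq hr hu hv⟩

lemma exists_kernels {X Y Z K L M : C} {g : X ⟶ Y} {k : K ⟶ X} {g' : Y ⟶ Z} {l : L ⟶ Y}
    {m : M ⟶ X} (hk : S k g) (hl : S l g') (hm : S m (g ≫ g')) :
    ∃ (u : K ⟶ M) (v : M ⟶ L), u ≫ m = k ∧ m ≫ g = v ≫ l ∧ S u v := by
  obtain ⟨u, v, h₁, h₂, h₃⟩ := h.op.exists_quotients (f := g'.op) (g := g.op) (p := l.op)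
    (q := k.op) (r := m.op) hl hk hm
  exact ⟨v.unop, u.unop, congrArg Quiver.Hom.unop h₂, (congrArg Quiver.Hom.unop h₁).symm, h₃⟩

section Middle

variable {X Y Z X' Y' Z' : C} {f : X ⟶ Y} {g : Y ⟶ Z} {f' : X' ⟶ Y'} {g' : Y' ⟶ Z'}
  {a : X ⟶ X'} {b : Y ⟶ Y'} {c : Z ⟶ Z'}

lemma mono_of_mono (hf : S f g) (hf' : S f' g') (h₁ : f ≫ b = a ≫ f') (h₂ : g ≫ c = b ≫ g')
    [Mono a] [Mono c] : Mono b := by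
  have := (h.ker hf').mono
  refine Preadditive.mono_of_cancel_zero _ fun {T} t ht => ?_
  obtain ⟨s, hs⟩ := (h.ker hf).lift t (by
    rw [← cancel_mono c, Category.assoc, h₂, ← Category.assoc, ht, zero_comp, zero_comp])
  have : s = 0 := by
    rw [← cancel_mono a, ← cancel_mono f', Category.assoc, ← h₁, ← Category.assoc, hs, ht,
      zero_comp, zero_comp]
  rw [← hs, this, zero_comp]

/-- The short five lemma. -/
lemma isIso_middle (hf : S f g) (hf' : S f' g') (h₁ : f ≫ b = a ≫ f') (h₂ : g ≫ c = b ≫ g')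
    [IsIso a] [IsIso c] : IsIso b := by
  have := h.mono_of_mono hf hf' h₁ h₂
  obtain ⟨T, e, d, he, hd⟩ := h.exists_cover ⟨_, _, hf⟩ (g' ≫ inv c)
  obtain ⟨x, hx⟩ := (h.ker hf').lift (e - d ≫ b) (by
    rw [Preadditive.sub_comp, Category.assoc, ← h₂, reassoc_of% hd]
    simp)
  -- A section of the monomorphism `b` exists after the cover `e`, hence descends.
  obtain ⟨r, hr⟩ := h.exists_lift_of_admissibleEpi he (𝟙 Y') (m := b) (d + x ≫ inv a ≫ f) (by
    simp [h₁, hx])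
  exact ⟨r, by rw [← cancel_mono b]; simp [hr], hr⟩

/-- In a morphism of admissible sequences whose outer components are admissible monomorphisms,
the middle one is an admissible monomorphism, and the quotients form an admissible sequence. -/
lemma exists_middle_quotient {A C' : C} {p : X' ⟶ A} {q : Z' ⟶ C'} (hf : S f g) (hf' : S f' g')
    (h₁ : f ≫ b = a ≫ f') (h₂ : g ≫ c = b ≫ g') (ha : S a p) (hc : S c q) :
    ∃ (Q : C) (r : Y' ⟶ Q) (u : A ⟶ Q) (w : Q ⟶ C'),
      S b r ∧ S u w ∧ p ≫ u = f' ≫ r ∧ r ≫ w = g' ≫ q := by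
  have := (h.ker ha).mono
  have := (h.ker hc).mono
  have := (h.ker hf).mono
  have := (h.ker hf').mono
  obtain ⟨P, f₁, b₁, q₁, hP, hfq, hbq⟩ := h.exists_pushout hf a
  have := (h.ker hfq).mono
  let s : P ⟶ A := hP.desc 0 p (by simp [(h.ker ha).w])
  have hbs : b₁ ≫ s = 0 := hP.inl_desc _ _ _
  have hfs : f₁ ≫ s = p := hP.inr_desc _ _ _
  have hb₁ : Mono b₁ := h.mono_of_mono (a := a) (c := 𝟙 _) hf hfq hP.w (by simp [hbq])
  have hs : S b₁ s := by
    refine h.of_isKer_of_comp (t := f₁) ⟨hbs, hb₁, fun {T} t ht => ?_⟩ (hfs ▸ ⟨_, _, ha⟩)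
    obtain ⟨T', e, d, he, hd⟩ := h.exists_cover ⟨_, _, hf⟩ (t ≫ q₁)
    obtain ⟨x', hx'⟩ := (h.ker hfq).lift (e ≫ t - d ≫ b₁) (by
      rw [Preadditive.sub_comp, Category.assoc, Category.assoc, hbq, hd, sub_self])
    obtain ⟨x, hx⟩ := (h.ker ha).lift x' (by
      rw [← hfs, ← Category.assoc, hx', Preadditive.sub_comp, Category.assoc, Category.assoc, hbs,
        ht, comp_zero, comp_zero, sub_zero])
    refine h.exists_lift_of_admissibleEpi he t (d + x ≫ f) ?_
    rw [Preadditive.add_comp, Category.assoc, hP.w, ← Category.assoc, hx, hx', add_sub_cancel]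
  let π : P ⟶ Y' := hP.desc b f' h₁
  have hbπ : b₁ ≫ π = b := hP.inl_desc _ _ _
  have hfπ : f₁ ≫ π = f' := hP.inr_desc _ _ _
  have hπ : π ≫ g' = q₁ ≫ c := by
    refine hP.hom_ext ?_ ?_
    · rw [← Category.assoc, hbπ, ← Category.assoc, hbq, h₂]
    · rw [← Category.assoc, hfπ, ← Category.assoc, (h.ker hfq).w, (h.ker hf').w, zero_comp]
  have hmπ : Mono π := h.mono_of_mono (a := 𝟙 _) (c := c) hfq hf' (by simp [hfπ]) hπ.symm
  have hπ' : S π (g' ≫ q) := by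
    refine h.of_isKer (h.epi_comp ⟨_, _, hf'⟩ ⟨_, _, hc⟩) ⟨?_, hmπ, fun {T} t ht => ?_⟩
    · rw [← Category.assoc, hπ, Category.assoc, (h.ker hc).w, comp_zero]
    obtain ⟨z, hz⟩ := (h.ker hc).lift (t ≫ g') (by rw [Category.assoc, ht])
    obtain ⟨T', e, d, he, hd⟩ := h.exists_cover ⟨_, _, hfq⟩ z
    obtain ⟨x', hx'⟩ := (h.ker hf').lift (e ≫ t - d ≫ π) (by
      rw [Preadditive.sub_comp, Category.assoc, Category.assoc, hπ, ← hz, ← Category.assoc,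
        ← Category.assoc, hd, sub_self])
    refine h.exists_lift_of_admissibleEpi he t (d + x' ≫ f₁) ?_
    rw [Preadditive.add_comp, Category.assoc, hfπ, hx', add_sub_cancel]
  obtain ⟨Q, r, hr⟩ := h.mono_comp ⟨_, _, hs⟩ ⟨_, _, hπ'⟩
  obtain ⟨u, w, hu, hw, huw⟩ := h.exists_quotients hs hπ' hr
  exact ⟨Q, r, u, w, hbπ ▸ hr, huw, by rw [← hfs, Category.assoc, hu, ← Category.assoc, hfπ], hw⟩

lemma exists_middle_kernel {K L : C} {k : K ⟶ X} {l : L ⟶ Z} (hf : S f g) (hf' : S f' g')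
    (h₁ : f ≫ b = a ≫ f') (h₂ : g ≫ c = b ≫ g') (ha : S k a) (hc : S l c) :
    ∃ (M : C) (r : M ⟶ Y) (u : K ⟶ M) (w : M ⟶ L),
      S r b ∧ S u w ∧ u ≫ r = k ≫ f ∧ r ≫ g = w ≫ l := by
  obtain ⟨Q, r, u, w, hr, huw, hu, hw⟩ := h.op.exists_middle_quotient (f := g'.op) (g := f'.op)
    (f' := g.op) (g' := f.op) (a := c.op) (b := b.op) (c := a.op) (p := l.op) (q := k.op)
    hf' hf (congrArg Quiver.Hom.op h₂).symm (congrArg Quiver.Hom.op h₁).symm hc ha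
  exact ⟨Q.unop, r.unop, w.unop, u.unop, hr, huw, congrArg Quiver.Hom.unop hw,
    (congrArg Quiver.Hom.unop hu).symm⟩

/-- A morphism of admissible sequences with the same cokernel is a pushout. -/
lemma isPushout_of_admissible (hf : S f g) {g' : Y' ⟶ Z} (hf' : S f' g')
    (h₁ : f ≫ b = a ≫ f') (h₂ : b ≫ g' = g) : IsPushout f a b f' := by
  obtain ⟨P, f₁, b₁, q₁, hP, hfq, hbq⟩ := h.exists_pushout hf a
  let π : P ⟶ Y' := hP.desc b f' h₁
  have hbπ : b₁ ≫ π = b := hP.inl_desc _ _ _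
  have hfπ : f₁ ≫ π = f' := hP.inr_desc _ _ _
  have hπ : π ≫ g' = q₁ := by
    refine hP.hom_ext ?_ ?_
    · rw [← Category.assoc, hbπ, hbq, h₂]
    · rw [← Category.assoc, hfπ, (h.ker hfq).w, (h.ker hf').w]
  have : IsIso π := h.isIso_middle (a := 𝟙 _) (c := 𝟙 _) hfq hf' (by simp [hfπ]) (by simp [hπ])
  exact hP.of_iso (Iso.refl _) (Iso.refl _) (Iso.refl _) (asIso π) (by simp) (by simp)
    (by simp [hbπ]) (by simp [hfπ])

end Middle

end IsExactCore

end Core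

/-! ### The exact structure on ind-objects -/

lemma SequenceIso.trans {C : Type u} [Category.{v} C] {X Y Z X' Y' Z' X'' Y'' Z'' : C}
    {f : X ⟶ Y} {g : Y ⟶ Z} {f' : X' ⟶ Y'} {g' : Y' ⟶ Z'} {f'' : X'' ⟶ Y''} {g'' : Y'' ⟶ Z''}
    (h : SequenceIso f g f' g') (h' : SequenceIso f' g' f'' g'') : SequenceIso f g f'' g'' := by
  obtain ⟨a, b, c, h₁, h₂⟩ := h
  obtain ⟨a', b', c', h₁', h₂'⟩ := h'
  refine ⟨a ≪≫ a', b ≪≫ b', c ≪≫ c', ?_, ?_⟩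
  · simp [← h₁', reassoc_of% h₁]
  · simp [← h₂', reassoc_of% h₂]

lemma SequenceClass.ind_of_iso {C : Type u} [Category.{v} C] {S : SequenceClass C}
    {X Y Z X' Y' Z' : Ind C} {f : X ⟶ Y} {g : Y ⟶ Z} {f' : X' ⟶ Y'} {g' : Y' ⟶ Z'}
    (h : SequenceIso f g f' g') (hfg : S.ind f g) : S.ind f' g' := by
  obtain ⟨I, _, _, F, G, H, α, β, hS, hi⟩ := hfg
  exact ⟨I, _, inferInstance, F, G, H, α, β, hS, hi.trans h⟩

lemma IsCok.of_iso {C : Type u} [Category.{v} C] [Preadditive C] {X Y Z X' Y' Z' : C}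
    {f : X ⟶ Y} {g : Y ⟶ Z} {f' : X' ⟶ Y'} {g' : Y' ⟶ Z'}
    (hi : SequenceIso f g f' g') (h : IsCok f g) : IsCok f' g' := by
  obtain ⟨a, b, c, h₁, h₂⟩ := hi
  have := h.epi
  have hg : g' = b.inv ≫ g ≫ c.hom := by simp [h₂]
  refine ⟨?_, ?_, fun t ht => ?_⟩
  · rw [← cancel_epi a.hom, ← Category.assoc, ← h₁, Category.assoc, ← h₂, ← Category.assoc, h.w,
      zero_comp, comp_zero]
  · rw [hg]; infer_instance
  · obtain ⟨s, hs⟩ := h.desc (b.hom ≫ t) (by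
      rw [← Category.assoc, h₁, Category.assoc, ht, comp_zero])
    exact ⟨c.inv ≫ s, by simp [hg, hs]⟩

namespace IndObj

section

variable {C : Type u} [Category.{v} C] {I : Type v} [SmallCategory I] [IsFiltered I]

lemma isIso_limDesc {F : I ⥤ C} {X : Ind C} (τ : ∀ i, (y C).obj (F.obj i) ⟶ X)
    (h : ∀ {i j : I} (s : i ⟶ j), (y C).map (F.map s) ≫ τ j = τ i)
    (h₁ : ∀ (c : C) (i : I) (a b : c ⟶ F.obj i), (y C).map a ≫ τ i = (y C).map b ≫ τ i →
      ∃ (j : I) (s : i ⟶ j), a ≫ F.map s = b ≫ F.map s)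
    (h₂ : ∀ (c : C) (t : (y C).obj c ⟶ X), ∃ (i : I) (a : c ⟶ F.obj i), t = (y C).map a ≫ τ i) :
    IsIso (limDesc τ h) := by
  refine isIso_of_bijective _ (fun c s t hst => ?_) (fun c t => ?_)
  · obtain ⟨i, a, rfl⟩ := exists_fac_inj s
    obtain ⟨j, b, rfl⟩ := exists_fac_inj t
    let k := IsFiltered.max i j
    simp only [Category.assoc, inj_limDesc] at hst
    obtain ⟨l, s, hs⟩ := h₁ c k (a ≫ F.map (IsFiltered.leftToMax i j))
      (b ≫ F.map (IsFiltered.rightToMax i j)) (by simp [h, hst])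
    rw [← map_inj F (IsFiltered.leftToMax i j), ← map_inj F (IsFiltered.rightToMax i j),
      ← map_inj F s]
    simp only [Category.assoc] at hs
    simp only [← Functor.map_comp_assoc, hs]
  · obtain ⟨i, a, rfl⟩ := h₂ c t
    exact ⟨(y C).map a ≫ inj F i, by simp⟩

/-- Formal inductive limits are invariant under final functors. -/
def finalIso {J : Type v} [SmallCategory J] [IsFiltered J] (p : J ⥤ I) [p.Final] (F : I ⥤ C) :
    (Ind.lim J).obj (p ⋙ F) ≅ (Ind.lim I).obj F :=
  Functor.Final.colimitIso p (F ⋙ Ind.yoneda)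

@[simp]
lemma inj_finalIso_hom {J : Type v} [SmallCategory J] [IsFiltered J] (p : J ⥤ I) [p.Final]
    (F : I ⥤ C) (j : J) : inj (p ⋙ F) j ≫ (finalIso p F).hom = inj F (p.obj j) :=
  Functor.Final.ι_colimitIso_hom p (F ⋙ Ind.yoneda) j

@[simp]
lemma inj_finalIso_inv {J : Type v} [SmallCategory J] [IsFiltered J] (p : J ⥤ I) [p.Final]
    (F : I ⥤ C) (j : J) : inj F (p.obj j) ≫ (finalIso p F).inv = inj (p ⋙ F) j := by
  rw [Iso.comp_inv_eq, inj_finalIso_hom]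

end

variable {C : Type u} [Category.{v} C] [Preadditive C] {S : SequenceClass C}

variable (S) in
/-- `g` lifts elements locally for the admissible epimorphisms. -/
def LocalEpi {Y Z : Ind C} (g : Y ⟶ Z) : Prop :=
  ∀ (c : C) (z : (y C).obj c ⟶ Z), ∃ (d : C) (p : d ⟶ c) (t : (y C).obj d ⟶ Y),
    S.AdmissibleEpi p ∧ t ≫ g = (y C).map p ≫ z

variable (S) in
/-- Exactness in terms of elements. -/
structure ElemExact {X Y Z : Ind C} (f : X ⟶ Y) (g : Y ⟶ Z) : Prop where
  w : f ≫ g = 0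
  injective : ∀ {c : C} (t : (y C).obj c ⟶ X), t ≫ f = 0 → t = 0
  exact : ∀ {c : C} (t : (y C).obj c ⟶ Y), t ≫ g = 0 → ∃ s : (y C).obj c ⟶ X, s ≫ f = t
  localEpi : LocalEpi S g

lemma ElemExact.isKer {X Y Z : Ind C} {f : X ⟶ Y} {g : Y ⟶ Z} (h : ElemExact S f g) :
    IsKer f g := by
  have hf : ∀ (c : C) (s t : (y C).obj c ⟶ X), s ≫ f = t ≫ f → s = t := fun c s t hst =>
    sub_eq_zero.1 (h.injective _ (by rw [Preadditive.sub_comp, hst, sub_self]))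
  refine ⟨h.w, mono_of_injective f hf, fun {T} t ht => ?_⟩
  have (c : C) (x : (y C).obj c ⟶ T) : ∃ s : (y C).obj c ⟶ X, s ≫ f = x ≫ t :=
    h.exact _ (by rw [Category.assoc, ht, comp_zero])
  choose τ hτ using this
  obtain ⟨s, hs⟩ := exists_hom τ fun c d a x => hf _ _ _ (by simp [hτ])
  exact ⟨s, hom_ext fun c x => by rw [← Category.assoc, hs, hτ]⟩

lemma ElemExact.of_iso {X Y Z X' Y' Z' : Ind C} {f : X ⟶ Y} {g : Y ⟶ Z} {f' : X' ⟶ Y'}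
    {g' : Y' ⟶ Z'} (hi : SequenceIso f g f' g') (h : ElemExact S f g) : ElemExact S f' g' := by
  obtain ⟨a, b, c, h₁, h₂⟩ := hi
  have hf : f' = a.inv ≫ f ≫ b.hom := by simp [h₁]
  have hg : g' = b.inv ≫ g ≫ c.hom := by simp [h₂]
  refine ⟨?_, fun t ht => ?_, fun t ht => ?_, fun d z => ?_⟩
  · simp [hf, hg, reassoc_of% h.w]
  · have := h.injective (t ≫ a.inv) (by
      rw [← cancel_mono b.hom]; simpa [hf] using ht)
    simpa using this =≫ a.hom
  · obtain ⟨s, hs⟩ := h.exact (t ≫ b.inv) (by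
      rw [← cancel_mono c.hom]; simpa [hg] using ht)
    exact ⟨s ≫ a.hom, by simp [hf, reassoc_of% hs]⟩
  · obtain ⟨e, p, t, hp, ht⟩ := h.localEpi d (z ≫ c.inv)
    exact ⟨e, p, t ≫ b.hom, hp, by simp [hg, reassoc_of% ht]⟩

lemma exists_comp_eq_zero {X : Ind C} {c d : C} (u : (y C).obj d ⟶ X) (a : c ⟶ d)
    (h : (y C).map a ≫ u = 0) :
    ∃ (d' : C) (u' : (y C).obj d' ⟶ X) (e : d ⟶ d'), u = (y C).map e ≫ u' ∧ a ≫ e = 0 := by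
  obtain ⟨d', u', e, h₁, h₂⟩ := exists_coeq u a 0 (by simpa using h)
  exact ⟨d', u', e, h₁, by simpa using h₂⟩

lemma exists_map_eq_zero {I : Type v} [SmallCategory I] [IsFiltered I] {F : I ⥤ C} {c : C} {i : I}
    {a : c ⟶ F.obj i} (h : (y C).map a ≫ inj F i = 0) :
    ∃ (j : I) (s : i ⟶ j), a ≫ F.map s = 0 := by
  obtain ⟨j, s, hs⟩ := exists_eq_of_inj_eq (a := a) (b := 0) (by simpa using h)
  exact ⟨j, s, by simpa using hs⟩

/-- A map from a representable to an ind-object factors through a representable, and its vanishing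
after precomposition is visible at a later one. Both halves of the cokernel property thus reduce to
`C`. -/
lemma isCok_map {X Y Z : C} {f : X ⟶ Y} {g : Y ⟶ Z} (h : IsCok f g) :
    IsCok ((y C).map f) ((y C).map g) := by
  have := h.epi
  refine ⟨by rw [← Functor.map_comp, h.w, Functor.map_zero], ?_, fun {T} t ht => ?_⟩
  · refine Preadditive.epi_of_cancel_zero _ fun {T} t ht => ?_
    obtain ⟨d, u, a, -, rfl, -⟩ := exists_common t t
    rw [← Category.assoc, ← Functor.map_comp] at ht
    obtain ⟨d', u', e, rfl, he⟩ := exists_comp_eq_zero _ _ ht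
    rw [Category.assoc] at he
    rw [← Category.assoc, ← Functor.map_comp, (cancel_epi g).1 (he.trans comp_zero.symm),
      Functor.map_zero, zero_comp]
  · obtain ⟨d, u, a, -, rfl, -⟩ := exists_common t t
    rw [← Category.assoc, ← Functor.map_comp] at ht
    obtain ⟨d', u', e, rfl, he⟩ := exists_comp_eq_zero _ _ ht
    obtain ⟨s, hs⟩ := h.desc (a ≫ e) (by simpa using he)
    exact ⟨(y C).map s ≫ u', by simp only [← Category.assoc, ← Functor.map_comp, hs]⟩

end IndObj

/-! ### Formal limits of pointwise admissible sequences -/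

namespace IsExactCore

open IndObj

variable {C : Type u} [Category.{v} C] [Preadditive C] {S : SequenceClass C} (h : IsExactCore C S)
include h

/-- Each element, and each relation, is seen at a finite stage, where the sequence is admissible in
`C`. -/
lemma elemExact_lim {I : Type v} [SmallCategory I] [IsFiltered I] {F G H : I ⥤ C} (α : F ⟶ G)
    (β : G ⟶ H) (hS : ∀ i, S (α.app i) (β.app i)) :
    ElemExact S ((Ind.lim I).map α) ((Ind.lim I).map β) := by
  refine ⟨lim_hom_ext fun i => ?_, fun {c} t ht => ?_, fun {c} t ht => ?_, fun c z => ?_⟩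
  · simp [← Functor.map_comp_assoc, (h.ker (hS i)).w]
  · obtain ⟨i, a, rfl⟩ := exists_fac_inj t
    rw [Category.assoc, inj_map, ← Functor.map_comp_assoc] at ht
    obtain ⟨j, s, hs⟩ := exists_map_eq_zero ht
    have := (h.ker (hS j)).mono
    have : a ≫ F.map s = 0 := by rw [← cancel_mono (α.app j)]; simpa using hs
    rw [← map_inj F s, ← Functor.map_comp_assoc, this, Functor.map_zero, zero_comp]
  · obtain ⟨i, a, rfl⟩ := exists_fac_inj t
    rw [Category.assoc, inj_map, ← Functor.map_comp_assoc] at ht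
    obtain ⟨j, s, hs⟩ := exists_map_eq_zero ht
    obtain ⟨r, hr⟩ := (h.ker (hS j)).lift (a ≫ G.map s) (by simpa using hs)
    exact ⟨(y C).map r ≫ inj F j, by
      rw [Category.assoc, inj_map, ← Functor.map_comp_assoc, hr, Functor.map_comp_assoc, map_inj]⟩
  · obtain ⟨i, a, rfl⟩ := exists_fac_inj z
    obtain ⟨d, p, x, hp, hx⟩ := h.exists_cover ⟨_, _, hS i⟩ a
    exact ⟨d, p, (y C).map x ≫ inj G i, hp, by
      rw [Category.assoc, inj_map, ← Functor.map_comp_assoc, hx, Functor.map_comp_assoc]⟩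

lemma elemExact {X Y Z : Ind C} {f : X ⟶ Y} {g : Y ⟶ Z} (hfg : S.ind f g) : ElemExact S f g := by
  obtain ⟨I, _, _, F, G, H, α, β, hS, hi⟩ := hfg
  exact (h.elemExact_lim α β hS).of_iso hi

lemma isCok_lim {I : Type v} [SmallCategory I] [IsFiltered I] {F G H : I ⥤ C} (α : F ⟶ G)
    (β : G ⟶ H) (hS : ∀ i, S (α.app i) (β.app i)) :
    IsCok ((Ind.lim I).map α) ((Ind.lim I).map β) := by
  have hc (i : I) := isCok_map (h.cok (hS i))
  have he (i : I) := (hc i).epi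
  refine ⟨(h.elemExact_lim α β hS).w, ?_, fun {T} t ht => ?_⟩
  · refine Preadditive.epi_of_cancel_zero _ fun {T} t ht => lim_hom_ext fun i => ?_
    rw [← cancel_epi ((y C).map (β.app i)), ← inj_map_assoc, ht]
    simp
  · have (i : I) : ∃ s, (y C).map (β.app i) ≫ s = inj G i ≫ t :=
      (hc i).desc _ (by rw [← inj_map_assoc, ht, comp_zero])
    choose τ hτ using this
    refine ⟨limDesc τ fun {i j} s => ?_, lim_hom_ext fun i => by simp [hτ]⟩
    rw [← cancel_epi ((y C).map (β.app i)), ← Functor.map_comp_assoc, ← β.naturality,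
      Functor.map_comp_assoc, hτ, hτ, map_inj_assoc]

lemma ind_isCok {X Y Z : Ind C} {f : X ⟶ Y} {g : Y ⟶ Z} (hfg : S.ind f g) : IsCok f g := by
  obtain ⟨I, _, _, F, G, H, α, β, hS, hi⟩ := hfg
  exact (h.isCok_lim α β hS).of_iso hi

/-- A pointwise admissible epimorphism of diagrams has a kernel diagram. -/
lemma exists_kernel_diagram {J : Type*} [Category* J] {G H : J ⥤ C} (β : G ⟶ H)
    (hβ : ∀ j, S.AdmissibleEpi (β.app j)) :
    ∃ (F : J ⥤ C) (α : F ⟶ G), ∀ j, S (α.app j) (β.app j) := by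
  choose X f hf using hβ
  have (i j : J) (s : i ⟶ j) : ∃ t, t ≫ f j = f i ≫ G.map s :=
    (h.ker (hf j)).lift _ (by
      rw [Category.assoc, β.naturality, ← Category.assoc, (h.ker (hf i)).w, zero_comp])
  choose m hm using this
  have hmono (j : J) := (h.ker (hf j)).mono
  exact ⟨{  obj := X
            map := fun {i j} s => m i j s
            map_id := fun i => by rw [← cancel_mono (f i)]; simp [hm]
            map_comp := fun {i j k} s t => by
              rw [← cancel_mono (f k)]; simp [hm, reassoc_of% (hm i j s)] },
    { app := f, naturality := fun i j s => hm i j s }, hf⟩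

/-- A pointwise admissible sequence of diagrams has pushouts. -/
lemma exists_pushout_diagram {J : Type*} [Category* J] {F G H F' : J ⥤ C} (α : F ⟶ G)
    (β : G ⟶ H) (hS : ∀ j, S (α.app j) (β.app j)) (η : F ⟶ F') :
    ∃ (P : J ⥤ C) (α' : F' ⟶ P) (b : G ⟶ P) (β' : P ⟶ H),
      (∀ j, S (α'.app j) (β'.app j)) ∧ α ≫ b = η ≫ α' ∧ b ≫ β' = β := by
  choose P f' b q hP hfq hbq using fun j => h.exists_pushout (hS j) (η.app j)
  let m {i j : J} (s : i ⟶ j) : P i ⟶ P j :=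
    (hP i).desc (G.map s ≫ b j) (F'.map s ≫ f' j) (by
      rw [← Category.assoc, ← α.naturality, Category.assoc, (hP j).w, ← Category.assoc,
        η.naturality, Category.assoc])
  have hm₁ {i j : J} (s : i ⟶ j) : b i ≫ m s = G.map s ≫ b j := (hP i).inl_desc _ _ _
  have hm₂ {i j : J} (s : i ⟶ j) : f' i ≫ m s = F'.map s ≫ f' j := (hP i).inr_desc _ _ _
  let Pf : J ⥤ C :=
    { obj := P
      map := fun s => m s
      map_id := fun i => (hP i).hom_ext (by simp [hm₁]) (by simp [hm₂])
      map_comp := fun {i j k} s t => (hP i).hom_ext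
        (by rw [hm₁, ← Category.assoc, hm₁, Category.assoc, hm₁, G.map_comp, Category.assoc])
        (by rw [hm₂, ← Category.assoc, hm₂, Category.assoc, hm₂, F'.map_comp, Category.assoc]) }
  refine ⟨Pf, { app := f', naturality := fun i j s => (hm₂ s).symm },
    { app := b, naturality := fun i j s => (hm₁ s).symm },
    { app := q, naturality := fun i j s => (hP i).hom_ext ?_ ?_ }, hfq, ?_, ?_⟩
  · change b i ≫ m s ≫ q j = b i ≫ q i ≫ H.map s
    rw [← Category.assoc, hm₁, Category.assoc, hbq, ← Category.assoc, hbq, β.naturality]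
  · change f' i ≫ m s ≫ q j = f' i ≫ q i ≫ H.map s
    rw [← Category.assoc, hm₂, Category.assoc, (h.ker (hfq j)).w, ← Category.assoc,
      (h.ker (hfq i)).w, comp_zero, zero_comp]
  · ext j
    exact (hP j).w
  · ext j
    exact hbq j

end IsExactCore

/-! ### Local epimorphisms are admissible -/

namespace IndObj

variable {C : Type u} [Category.{v} C] [Preadditive C] (S : SequenceClass C) {Y Z : Ind C}

/-- An admissible epimorphism of `C` mapping to a given morphism of ind-objects. -/
structure Cover (g : Y ⟶ Z) where
  /-- the source -/
  b : C
  /-- the target -/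
  c : C
  /-- the admissible epimorphism -/
  q : b ⟶ c
  hq : S.AdmissibleEpi q
  /-- the map between the sources -/
  e : (y C).obj b ⟶ Y
  /-- the map between the targets -/
  z : (y C).obj c ⟶ Z
  w : e ≫ g = (y C).map q ≫ z

/-- Morphisms of covers. -/
@[ext]
structure Cover.Hom {g : Y ⟶ Z} (t t' : Cover S g) where
  /-- the map between the sources -/
  β : t.b ⟶ t'.b
  /-- the map between the targets -/
  γ : t.c ⟶ t'.c
  w : β ≫ t'.q = t.q ≫ γ
  we : (y C).map β ≫ t'.e = t.e
  wz : (y C).map γ ≫ t'.z = t.z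

instance (g : Y ⟶ Z) : Category (Cover S g) where
  Hom t t' := Cover.Hom S t t'
  id t := ⟨𝟙 _, 𝟙 _, by simp, by simp, by simp⟩
  comp f f' := ⟨f.β ≫ f'.β, f.γ ≫ f'.γ, by simp [f'.w, reassoc_of% f.w], by simp [f'.we, f.we],
    by simp [f'.wz, f.wz]⟩
  id_comp f := Cover.Hom.ext (Category.id_comp _) (Category.id_comp _)
  comp_id f := Cover.Hom.ext (Category.comp_id _) (Category.comp_id _)
  assoc f f' f'' := Cover.Hom.ext (Category.assoc _ _ _) (Category.assoc _ _ _)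

/-- The source of a cover, as a functor. -/
def Cover.src (g : Y ⟶ Z) : Cover S g ⥤ C where
  obj t := t.b
  map f := Cover.Hom.β f

/-- The target of a cover, as a functor. -/
def Cover.tgt (g : Y ⟶ Z) : Cover S g ⥤ C where
  obj t := t.c
  map f := Cover.Hom.γ f

end IndObj

namespace IndObj

variable {C : Type u} [Category.{v} C] [Preadditive C] [HasBinaryBiproducts C] {X Y : C} {Z : Ind C}

lemma map_inl_elem (s : (y C).obj X ⟶ Z) (t : (y C).obj Y ⟶ Z) :
    (y C).map (biprod.inl : X ⟶ X ⊞ Y) ≫ ((y C).map biprod.fst ≫ s + (y C).map biprod.snd ≫ t) =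
      s := by
  rw [Preadditive.comp_add, ← Functor.map_comp_assoc, ← Functor.map_comp_assoc]
  simp

lemma map_inr_elem (s : (y C).obj X ⟶ Z) (t : (y C).obj Y ⟶ Z) :
    (y C).map (biprod.inr : Y ⟶ X ⊞ Y) ≫ ((y C).map biprod.fst ≫ s + (y C).map biprod.snd ≫ t) =
      t := by
  rw [Preadditive.comp_add, ← Functor.map_comp_assoc, ← Functor.map_comp_assoc]
  simp

end IndObj

namespace IsExactCore

open IndObj

variable {C : Type u} [Category.{v} C] [Preadditive C] {S : SequenceClass C} (h : IsExactCore C S)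
include h

/-- A local epimorphism between formal inductive limits is covered by a filtered diagram of
admissible epimorphisms. -/
lemma exists_ind_lim {I : Type v} [SmallCategory I] [IsFiltered I] {G H : I ⥤ C}
    (φ : G ⟶ H) (hφ : LocalEpi S ((Ind.lim I).map φ)) :
    ∃ (X : Ind C) (f : X ⟶ (Ind.lim I).obj G), S.ind f ((Ind.lim I).map φ) := by
  have := h.hasBinaryBiproducts
  let g := (Ind.lim I).map φ
  choose d p t hp ht using fun i => hφ _ (inj H i)
  -- The component `φ.app i` need not be an admissible epi. Adding the source `d i` of a local lift
  -- of `inj H i` makes it one and leaves the target unchanged.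
  let cov (i : I) : Cover S g :=
    { b := G.obj i ⊞ d i
      c := H.obj i
      q := biprod.desc (φ.app i) (p i)
      hq := h.admissibleEpi_biprodDesc _ (hp i)
      e := (y C).map biprod.fst ≫ inj G i + (y C).map biprod.snd ≫ t i
      z := inj H i
      w := by
        simp only [Preadditive.add_comp, Category.assoc]
        rw [inj_map, ht, biprod.desc_eq, Functor.map_add, Preadditive.add_comp]
        simp }
  have hinl (i : I) : (y C).map biprod.inl ≫ (cov i).e = inj G i := map_inl_elem _ _
  -- every cover maps to one of these, equalizing given pairs of maps
  have dom (T : Cover S g) {c₀ c₁ : C} (β β' : c₀ ⟶ T.b) (γ γ' : c₁ ⟶ T.c)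
      (hβ : (y C).map β ≫ T.e = (y C).map β' ≫ T.e)
      (hγ : (y C).map γ ≫ T.z = (y C).map γ' ≫ T.z) :
      ∃ (i : I) (m : T ⟶ cov i), β ≫ m.β = β' ≫ m.β ∧ γ ≫ m.γ = γ' ≫ m.γ := by
    obtain ⟨i₁, a₁, ha₁⟩ := exists_fac_inj T.e
    obtain ⟨i₂, a₂, ha₂⟩ := exists_fac_inj T.z
    obtain ⟨i, a, b, ha, hb⟩ : ∃ (i : I) (a : T.b ⟶ G.obj i) (b : T.c ⟶ H.obj i),
        T.e = (y C).map a ≫ inj G i ∧ T.z = (y C).map b ≫ inj H i :=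
      ⟨IsFiltered.max i₁ i₂, a₁ ≫ G.map (IsFiltered.leftToMax _ _),
        a₂ ≫ H.map (IsFiltered.rightToMax _ _), by simp [ha₁], by simp [ha₂]⟩
    obtain ⟨j, s, hs⟩ := exists_eq_of_inj_eq (F := G) (a := β ≫ a) (b := β' ≫ a) (by
      simp [← ha, hβ])
    obtain ⟨k, r, hr⟩ := exists_eq_of_inj_eq (F := H) (a := γ ≫ b ≫ H.map s)
      (b := γ' ≫ b ≫ H.map s) (by simp [← hb, hγ])
    -- The square of `T` commutes only in `Ind C`; at the stage `l` it commutes in `C`.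
    obtain ⟨l, n, hn⟩ := exists_eq_of_inj_eq (F := H)
      (a := (a ≫ G.map s ≫ G.map r) ≫ φ.app k) (b := T.q ≫ b ≫ H.map s ≫ H.map r) (by
        have := T.w
        rw [ha, hb, Category.assoc, inj_map] at this
        simpa using this)
    refine ⟨l, ⟨a ≫ G.map s ≫ G.map r ≫ G.map n ≫ biprod.inl, b ≫ H.map s ≫ H.map r ≫ H.map n,
      ?_, ?_, ?_⟩, ?_, ?_⟩
    · simpa [cov] using hn
    · simp only [Functor.map_comp, Category.assoc, hinl, map_inj, ha]
    · simp [cov, hb]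
    · simp only [Category.assoc] at hs
      simp [reassoc_of% hs]
    · simp only [Category.assoc] at hr
      simp [reassoc_of% hr]
  have hfilt : IsFiltered (Cover S g) :=
    { cocone_objs := fun T T' => by
        obtain ⟨i, m, -⟩ := dom T (𝟙 _) (𝟙 _) (𝟙 _) (𝟙 _) rfl rfl
        obtain ⟨i', m', -⟩ := dom T' (𝟙 _) (𝟙 _) (𝟙 _) (𝟙 _) rfl rfl
        let k := IsFiltered.max i i'
        let s : i ⟶ k := IsFiltered.leftToMax i i'
        let s' : i' ⟶ k := IsFiltered.rightToMax i i'
        -- The summand `d k` is there only so that the sum of the maps to `H.obj k` is an admissible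
        -- epi.
        let U : Cover S g :=
          { b := T.b ⊞ (T'.b ⊞ d k)
            c := H.obj k
            q := biprod.desc (T.q ≫ m.γ ≫ H.map s) (biprod.desc (T'.q ≫ m'.γ ≫ H.map s') (p k))
            hq := h.admissibleEpi_biprodDesc _ (h.admissibleEpi_biprodDesc _ (hp k))
            e := (y C).map biprod.fst ≫ T.e + (y C).map biprod.snd ≫
              ((y C).map biprod.fst ≫ T'.e + (y C).map biprod.snd ≫ t k)
            z := inj H k
            w := by
              have e₁ : (y C).map m.γ ≫ inj H i = T.z := m.wz
              have e₂ : (y C).map m'.γ ≫ inj H i' = T'.z := m'.wz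
              simp only [Preadditive.add_comp, Category.assoc, Preadditive.comp_add, ht, T.w, T'.w,
                biprod.desc_eq, Functor.map_add, Functor.map_comp, map_inj, e₁, e₂, g] }
        refine ⟨U, ⟨biprod.inl, m.γ ≫ H.map s, by simp [U], ?_, ?_⟩,
          ⟨biprod.inl ≫ biprod.inr, m'.γ ≫ H.map s', by simp [U], ?_, ?_⟩, trivial⟩
        · simp only [U, map_inl_elem]
        · have e₁ : (y C).map m.γ ≫ inj H i = T.z := m.wz
          simp [U, e₁]
        · simp only [U, Functor.map_comp, Category.assoc, map_inr_elem, map_inl_elem]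
        · have e₂ : (y C).map m'.γ ≫ inj H i' = T'.z := m'.wz
          simp [U, e₂]
      cocone_maps := fun T T' f f' => by
        obtain ⟨i, m, h₁, h₂⟩ := dom T' f.β f'.β f.γ f'.γ (f.we.trans f'.we.symm)
          (f.wz.trans f'.wz.symm)
        exact ⟨cov i, m, Cover.Hom.ext h₁ h₂⟩
      nonempty := ⟨cov IsFiltered.nonempty.some⟩ }
  -- The category of all covers may be too large to index a formal limit. The covers `cov i` form a
  -- small full subcategory, cofinal by `dom`.
  let J : Type v := InducedCategory (Cover S g) cov
  let p : J ⥤ Cover S g := inducedFunctor cov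
  have : IsFiltered J := IsFiltered.of_exists_of_isFiltered_of_fullyFaithful p fun T => by
    obtain ⟨i, m, -⟩ := dom T (𝟙 _) (𝟙 _) (𝟙 _) (𝟙 _) rfl rfl
    exact ⟨i, ⟨m⟩⟩
  let q : p ⋙ Cover.src S g ⟶ p ⋙ Cover.tgt S g :=
    { app := fun j => (cov j).q
      naturality := fun i j s => (p.map s).w }
  obtain ⟨K, k, hk⟩ := h.exists_kernel_diagram q fun j => (cov j).hq
  let eY : (Ind.lim J).obj (p ⋙ Cover.src S g) ⟶ (Ind.lim I).obj G :=
    limDesc (fun j => (cov j).e) fun s => (p.map s).we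
  let eZ : (Ind.lim J).obj (p ⋙ Cover.tgt S g) ⟶ (Ind.lim I).obj H :=
    limDesc (fun j => (cov j).z) fun s => (p.map s).wz
  have : IsIso eY := by
    refine isIso_limDesc _ _ (fun c i a b hab => ?_) (fun c x => ?_)
    · obtain ⟨i', m, hm, -⟩ := dom (cov i) a b (𝟙 _) (𝟙 _) hab rfl
      exact ⟨i', p.preimage (X := i) (Y := i') m, by
        have hm' : p.map (p.preimage (X := i) (Y := i') m) = m := p.map_preimage m
        simpa [Cover.src, Cover.tgt, hm'] using hm⟩
    · obtain ⟨i, a, rfl⟩ := exists_fac_inj x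
      have key : (y C).map a ≫ inj G i = (y C).map (a ≫ biprod.inl) ≫ (cov i).e := by
        rw [Functor.map_comp, Category.assoc, hinl]
      exact ⟨i, a ≫ biprod.inl, key⟩
  have : IsIso eZ := by
    refine isIso_limDesc _ _ (fun c i a b hab => ?_) (fun c x => ?_)
    · obtain ⟨i', m, -, hm⟩ := dom (cov i) (𝟙 _) (𝟙 _) a b rfl hab
      exact ⟨i', p.preimage (X := i) (Y := i') m, by
        have hm' : p.map (p.preimage (X := i) (Y := i') m) = m := p.map_preimage m
        simpa [Cover.src, Cover.tgt, hm'] using hm⟩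
    · obtain ⟨i, a, rfl⟩ := exists_fac_inj x
      exact ⟨i, a, rfl⟩
  refine ⟨_, (Ind.lim J).map k ≫ eY, J, _, inferInstance, _, _, _, k, q, hk, Iso.refl _, asIso eY,
    asIso eZ, by simp, lim_hom_ext fun j => ?_⟩
  rw [asIso_hom, asIso_hom, inj_map_assoc]
  have e₁ : inj (p ⋙ Cover.tgt S g) j ≫ eZ = (cov j).z := inj_limDesc _ _ j
  have e₂ : inj (p ⋙ Cover.src S g) j ≫ eY = (cov j).e := inj_limDesc _ _ j
  rw [e₁, ← Category.assoc, e₂]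
  exact (cov j).w.symm

lemma exists_ind_of_localEpi {Y Z : Ind C} {g : Y ⟶ Z} (hg : LocalEpi S g) :
    ∃ (X : Ind C) (f : X ⟶ Y), S.ind f g := by
  obtain ⟨I, _, _, G, H, φ, ⟨e⟩⟩ := Ind.exists_nonempty_arrow_mk_iso_ind_lim (f := g)
  let eY : Y ≅ (Ind.lim I).obj G := Arrow.leftFunc.mapIso e
  let eZ : Z ≅ (Ind.lim I).obj H := Arrow.rightFunc.mapIso e
  have he : eY.hom ≫ (Ind.lim I).map φ = g ≫ eZ.hom := Arrow.w_mk_right e.hom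
  obtain ⟨X, f, hf⟩ := h.exists_ind_lim φ fun c z => by
    obtain ⟨d, p, t, hp, ht⟩ := hg c (z ≫ eZ.inv)
    exact ⟨d, p, t ≫ eY.hom, hp, by simp [he, reassoc_of% ht]⟩
  exact ⟨X, f ≫ eY.inv, SequenceClass.ind_of_iso
    ⟨Iso.refl _, eY.symm, eZ.symm, by simp, by simp [Iso.eq_inv_comp, reassoc_of% he]⟩ hf⟩

lemma ind_admissibleEpi_iff {Y Z : Ind C} {g : Y ⟶ Z} :
    S.ind.AdmissibleEpi g ↔ LocalEpi S g :=
  ⟨fun ⟨_, _, hf⟩ => (h.elemExact hf).localEpi, h.exists_ind_of_localEpi⟩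

/-- Admissible sequences of ind-objects are the exact ones in terms of elements. -/
lemma ind_iff {X Y Z : Ind C} {f : X ⟶ Y} {g : Y ⟶ Z} : S.ind f g ↔ ElemExact S f g := by
  refine ⟨h.elemExact, fun hfg => ?_⟩
  obtain ⟨X', f', hf'⟩ := h.exists_ind_of_localEpi hfg.localEpi
  obtain ⟨e, he⟩ := (h.elemExact hf').isKer.exists_iso hfg.isKer
  exact SequenceClass.ind_of_iso ⟨e, Iso.refl _, Iso.refl _, by simp [he], by simp⟩ hf'

end IsExactCore

/-! ### Pushouts of ind-objects and exactness of the ind-category -/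

namespace IsExactCore

open IndObj

variable {C : Type u} [Category.{v} C] [Preadditive C] {S : SequenceClass C} (h : IsExactCore C S)
include h

/-- The map `a` need not come from a map of diagrams on one index category. Over a suitable comma
category it does, and the pushout is then taken pointwise. -/
lemma exists_ind_pushout_lim {I : Type v} [SmallCategory I] [IsFiltered I] {F G H : I ⥤ C}
    (α : F ⟶ G) (β : G ⟶ H) (hS : ∀ i, S (α.app i) (β.app i)) {X' : Ind C}
    (a : (Ind.lim I).obj F ⟶ X') :
    ∃ (Y' : Ind C) (f' : X' ⟶ Y') (b : (Ind.lim I).obj G ⟶ Y') (g' : Y' ⟶ (Ind.lim I).obj H),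
      S.ind f' g' ∧ (Ind.lim I).map α ≫ b = a ≫ f' ∧ b ≫ g' = (Ind.lim I).map β := by
  obtain ⟨K, _, _, F', ⟨e'⟩⟩ := exists_presentation X'
  let L : I ⥤ CostructuredArrow (y C) X' :=
    { obj := fun i => CostructuredArrow.mk (inj F i ≫ a)
      map := fun s => CostructuredArrow.homMk (F.map s) (by simp) }
  let R : K ⥤ CostructuredArrow (y C) X' :=
    { obj := fun k => CostructuredArrow.mk (inj F' k ≫ e'.hom)
      map := fun s => CostructuredArrow.homMk (F'.map s) (by simp) }
  have hR : R.Final := by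
    refine Functor.final_of_exists_of_isFiltered R (fun t => ?_) (fun {t k} s s' => ?_)
    · obtain ⟨k, r, hr⟩ := exists_fac_inj (t.hom ≫ e'.inv)
      exact ⟨k, ⟨CostructuredArrow.homMk r (by simp [R, ← reassoc_of% hr])⟩⟩
    · have e₁ : (y C).map s.left ≫ inj F' k ≫ e'.hom = t.hom := CostructuredArrow.w s
      have e₂ : (y C).map s'.left ≫ inj F' k ≫ e'.hom = t.hom := CostructuredArrow.w s'
      obtain ⟨k', r, hr⟩ := exists_eq_of_inj_eq (F := F') (a := s.left) (b := s'.left) (by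
        rw [← cancel_mono e'.hom, Category.assoc, Category.assoc, e₁, e₂])
      exact ⟨k', r, CostructuredArrow.hom_ext _ _ hr⟩
  -- An object of `J` is a pair of indices with a map `F i ⟶ F' k` representing `a` on `F i`. Since
  -- `R` is final, `J` is filtered and both projections are final, so no formal limit changes.
  let J := Comma L R
  let p : J ⥤ I := Comma.fst L R
  let r : J ⥤ K := Comma.snd L R
  let η : p ⋙ F ⟶ r ⋙ F' :=
    { app := fun j => j.hom.left
      naturality := fun i j s => congrArg CommaMorphism.left s.w }
  have hη (j : J) : (y C).map (η.app j) ≫ inj F' (r.obj j) ≫ e'.hom = inj F (p.obj j) ≫ a :=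
    CostructuredArrow.w j.hom
  obtain ⟨P, α', b, β', hP, h₁, h₂⟩ := h.exists_pushout_diagram (Functor.whiskerLeft p α)
    (Functor.whiskerLeft p β) (fun j => hS _) η
  refine ⟨(Ind.lim J).obj P, e'.inv ≫ (finalIso r F').inv ≫ (Ind.lim J).map α',
    (finalIso p G).inv ≫ (Ind.lim J).map b, (Ind.lim J).map β' ≫ (finalIso p H).hom, ?_, ?_, ?_⟩
  · exact ⟨J, _, inferInstance, _, _, _, α', β', hP, finalIso r F' ≪≫ e', Iso.refl _, finalIso p H,
      by simp, by simp⟩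
  · rw [← cancel_epi (finalIso p F).hom]
    refine lim_hom_ext fun j => ?_
    have := congrArg (fun t => (Ind.lim J).map t) h₁
    simp only [Functor.map_comp] at this
    have h₃ := inj (p ⋙ F) j ≫= this
    rw [inj_map_assoc, inj_map_assoc] at h₃
    have e₁ := inj_finalIso_hom p F j
    have e₂ := inj_finalIso_inv p G j
    have e₃ : inj F (p.obj j) ≫ a ≫ e'.inv ≫ (finalIso r F').inv =
        (y C).map (η.app j) ≫ inj (r ⋙ F') j := by
      rw [← Category.assoc, ← hη, Category.assoc, Category.assoc, Iso.hom_inv_id_assoc,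
        inj_finalIso_inv]
    rw [← Category.assoc, ← Category.assoc (inj (p ⋙ F) j), e₁, inj_map_assoc,
      ← Category.assoc (inj G _), e₂]
    simp only [← Category.assoc] at e₃ ⊢
    rw [e₃]
    simpa using h₃
  · rw [← cancel_epi (finalIso p G).hom]
    refine lim_hom_ext fun j => ?_
    have := inj (p ⋙ G) j ≫= congrArg (fun t => (Ind.lim J).map t) h₂
    simp only [Functor.map_comp, inj_map_assoc, inj_map] at this
    have e₁ := inj_finalIso_hom p G j
    rw [Category.assoc, Iso.hom_inv_id_assoc, inj_map_assoc, inj_map_assoc, reassoc_of% this,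
      inj_finalIso_hom, ← Category.assoc (inj (p ⋙ G) j), e₁, inj_map]
    rfl

lemma exists_ind_pushout {X Y Z X' : Ind C} {f : X ⟶ Y} {g : Y ⟶ Z} (hfg : S.ind f g)
    (a : X ⟶ X') :
    ∃ (Y' : Ind C) (f' : X' ⟶ Y') (b : Y ⟶ Y') (g' : Y' ⟶ Z),
      S.ind f' g' ∧ f ≫ b = a ≫ f' ∧ b ≫ g' = g := by
  obtain ⟨I, _, _, F, G, H, α, β, hS, eX, eY, eZ, h₁, h₂⟩ := hfg
  obtain ⟨Y', f', b, g', h₃, h₄, h₅⟩ := h.exists_ind_pushout_lim α β hS (eX.hom ≫ a)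
  refine ⟨Y', f', eY.inv ≫ b, g' ≫ eZ.hom, ?_, ?_, ?_⟩
  · exact SequenceClass.ind_of_iso ⟨Iso.refl _, Iso.refl _, eZ, by simp, by simp⟩ h₃
  · rw [← cancel_epi eX.hom, ← reassoc_of% h₁, Iso.hom_inv_id_assoc, h₄, Category.assoc]
  · rw [← cancel_epi eY.hom, ← h₂, Category.assoc, Iso.hom_inv_id_assoc, ← h₅, Category.assoc]

/-- In a morphism of admissible sequences with the same quotient, the first square gives an
admissible sequence. -/
lemma ind_of_pushout [HasBinaryBiproducts (Ind C)] {X Y Z X' Y' : Ind C} {f : X ⟶ Y} {g : Y ⟶ Z}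
    {f' : X' ⟶ Y'} {g' : Y' ⟶ Z} {a : X ⟶ X'} {b : Y ⟶ Y'} (hfg : S.ind f g) (hfg' : S.ind f' g')
    (h₁ : f ≫ b = a ≫ f') (h₂ : b ≫ g' = g) :
    S.ind (biprod.lift f (-a)) (biprod.desc b f') := by
  have hE := h.elemExact hfg
  have hE' := h.elemExact hfg'
  refine h.ind_iff.2 ⟨by simp [biprod.lift_desc, h₁], fun t ht => ?_, fun t ht => ?_, fun c z => ?_⟩
  · exact hE.injective t (by simpa using ht =≫ biprod.fst)
  · rw [biprod.desc_eq, Preadditive.comp_add] at ht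
    obtain ⟨s, hs⟩ := hE.exact (t ≫ biprod.fst) (by
      have := ht =≫ g'
      simpa [h₂, hE'.w] using this)
    refine ⟨s, biprod.hom_ext _ _ (by simpa using hs) ?_⟩
    have : s ≫ a + t ≫ biprod.snd = 0 := hE'.injective _ (by
      rw [← ht, Preadditive.add_comp, Category.assoc, ← h₁, reassoc_of% hs, Category.assoc])
    simpa using (eq_neg_of_add_eq_zero_right this).symm
  · obtain ⟨d, p, t, hp, ht⟩ := hE.localEpi c (z ≫ g')
    obtain ⟨s, hs⟩ := hE'.exact ((y C).map p ≫ z - t ≫ b) (by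
      rw [Preadditive.sub_comp, Category.assoc, Category.assoc, h₂, ht, sub_self])
    exact ⟨d, p, biprod.lift t s, hp, by simp [biprod.lift_desc, hs]⟩

/-- The universal property of the pushout is the cokernel property of the sequence from
`ind_of_pushout`. -/
lemma exists_ind_isPushout [HasBinaryBiproducts (Ind C)] {X Y Z X' : Ind C} {f : X ⟶ Y}
    {g : Y ⟶ Z} (hfg : S.ind f g) (a : X ⟶ X') :
    ∃ (Y' : Ind C) (f' : X' ⟶ Y') (b : Y ⟶ Y') (g' : Y' ⟶ Z),
      S.ind f' g' ∧ b ≫ g' = g ∧ S.ind (biprod.lift f (-a)) (biprod.desc b f') ∧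
      IsPushout f a b f' := by
  obtain ⟨Y', f', b, g', h₁, h₂, h₃⟩ := h.exists_ind_pushout hfg a
  have h₄ := h.ind_of_pushout hfg h₁ h₂ h₃
  refine ⟨Y', f', b, g', h₁, h₃, h₄, ⟨h₂⟩, ⟨?_⟩⟩
  have hc := h.ind_isCok h₄
  have := hc.epi
  have (s : PushoutCocone f a) : ∃ t, biprod.desc b f' ≫ t = biprod.desc s.inl s.inr :=
    hc.desc _ (by simp [biprod.lift_desc, s.condition])
  choose d hd using this
  refine PushoutCocone.IsColimit.mk _ d (fun s => ?_) (fun s => ?_) (fun s m hm₁ hm₂ => ?_)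
  · simpa using biprod.inl ≫= hd s
  · simpa using biprod.inr ≫= hd s
  · rw [← cancel_epi (biprod.desc b f'), hd]
    ext <;> simp [hm₁, hm₂]

/-- The ind-objects of an exact category form an exact category. -/
theorem ind : IsExactCore (Ind C) S.ind where
  hasFiniteBiproducts := have := h.hasFiniteBiproducts; inferInstance
  of_iso := SequenceClass.ind_of_iso
  ker hfg := (h.elemExact hfg).isKer
  cok hfg := h.ind_isCok hfg
  split i₁ p₁ i₂ p₂ h₁ h₂ h₃ h₄ h₅ := h.ind_iff.2 ⟨h₃,
    fun t ht => by simpa [h₁] using ht =≫ p₁,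
    fun t ht => ⟨t ≫ p₁, by simpa [reassoc_of% ht] using t ≫= h₅⟩,
    fun c z => ⟨c, 𝟙 c, z ≫ i₂, h.admissibleEpi_id c, by simp [h₂]⟩⟩
  epi_comp {X Y Z f g} hf hg := by
    rw [h.ind_admissibleEpi_iff] at *
    intro c z
    obtain ⟨d, p, t, hp, ht⟩ := hg c z
    obtain ⟨d', p', t', hp', ht'⟩ := hf d t
    exact ⟨d', p' ≫ p, t', h.epi_comp hp' hp, by simp [reassoc_of% ht', ht]⟩
  mono_comp {X Y Z f g} hf hg := by
    have := h.hasFiniteBiproducts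
    have : HasBinaryBiproducts (Ind C) := hasBinaryBiproducts_of_finite_biproducts _
    obtain ⟨Q, p, hp⟩ := hf
    obtain ⟨R, q, hq⟩ := hg
    -- The cokernel of `f ≫ g` is the map from the target of `g` to the pushout of `g` along the
    -- cokernel `p` of `f`.
    obtain ⟨Y', f', b, g', h₁, -, h₂, -⟩ := h.exists_ind_isPushout hq p
    have w : g ≫ b = p ≫ f' := by
      have := (h.elemExact h₂).w
      simpa [biprod.lift_desc, add_neg_eq_zero] using this
    have hE := h.elemExact hp
    have hE' := h.elemExact hq
    have hE₂ := h.elemExact h₂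
    refine ⟨Y', b, h.ind_iff.2 ⟨?_, fun t ht => ?_, fun t ht => ?_, fun c z => ?_⟩⟩
    · rw [Category.assoc, w, ← Category.assoc, hE.w, zero_comp]
    · exact hE.injective _ (hE'.injective _ (by simpa using ht))
    · obtain ⟨s, hs⟩ := hE₂.exact (biprod.lift t 0) (by simp [biprod.lift_desc, ht])
      have e₁ : s ≫ g = t := by simpa using hs =≫ biprod.fst
      have e₂ : s ≫ p = 0 := by simpa using hs =≫ biprod.snd
      obtain ⟨r, hr⟩ := hE.exact s e₂
      exact ⟨r, by rw [← Category.assoc, hr, e₁]⟩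
    · obtain ⟨d, e, t, he, ht⟩ := hE₂.localEpi c z
      obtain ⟨d', e', s, he', hs⟩ := hE.localEpi d (t ≫ biprod.snd)
      refine ⟨d', e' ≫ e, (y C).map e' ≫ t ≫ biprod.fst + s ≫ g, h.epi_comp he' he, ?_⟩
      rw [Functor.map_comp, Category.assoc, ← ht, Preadditive.add_comp, Category.assoc s, w,
        reassoc_of% hs, biprod.desc_eq]
      simp
  epi_pullback {X Y Z g} hg f := by
    have := h.hasFiniteBiproducts
    have : HasBinaryBiproducts (Ind C) := hasBinaryBiproducts_of_finite_biproducts _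
    rw [h.ind_admissibleEpi_iff] at hg
    -- The pullback is the kernel of the difference map on the biproduct, which lifts elements
    -- locally because `g` does.
    obtain ⟨P, k, hk⟩ := h.exists_ind_of_localEpi (g := biprod.desc g (-f)) fun c z => by
      obtain ⟨d, p, t, hp, ht⟩ := hg c z
      exact ⟨d, p, t ≫ biprod.inl, hp, by simp [ht]⟩
    have hk' := (h.elemExact hk).isKer
    have := hk'.mono
    have w : (k ≫ biprod.fst) ≫ g = (k ≫ biprod.snd) ≫ f := by
      have := hk'.w
      rw [biprod.desc_eq, Preadditive.comp_add] at this
      simpa [add_neg_eq_zero] using this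
    have hlift (s : PullbackCone g f) : ∃ t, t ≫ k = biprod.lift s.fst s.snd :=
      hk'.lift _ (by simp [biprod.lift_desc, s.condition])
    choose d hd using hlift
    refine ⟨P, k ≫ biprod.fst, k ≫ biprod.snd, ⟨⟨w⟩, ⟨PullbackCone.IsLimit.mk _ d (fun s => ?_)
      (fun s => ?_) (fun s m hm₁ hm₂ => ?_)⟩⟩, ?_⟩
    · simp [reassoc_of% hd s]
    · simp [reassoc_of% hd s]
    · rw [← cancel_mono k, hd]
      ext <;> simp [hm₁, hm₂]
    · rw [h.ind_admissibleEpi_iff]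
      intro c z
      obtain ⟨d, p, t, hp, ht⟩ := hg c (z ≫ f)
      obtain ⟨s, hs⟩ := hk'.lift (biprod.lift t ((y C).map p ≫ z)) (by simp [biprod.lift_desc, ht])
      exact ⟨d, p, s, hp, by simp [reassoc_of% hs]⟩
  mono_pushout {X Y Z g} hg f := by
    have := h.hasFiniteBiproducts
    have : HasBinaryBiproducts (Ind C) := hasBinaryBiproducts_of_finite_biproducts _
    obtain ⟨Q, q, hq⟩ := hg
    obtain ⟨Y', f', b, g', h₁, -, -, h₂⟩ := h.exists_ind_isPushout hq f
    exact ⟨Y', b, f', h₂, _, _, h₁⟩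

/-- The embedding into ind-objects reflects admissible sequences. -/
lemma of_ind {X Y Z : C} {f : X ⟶ Y} {g : Y ⟶ Z} (hfg : S.ind ((y C).map f) ((y C).map g)) :
    S f g := by
  have hE := h.elemExact hfg
  -- Lifting the identity element of `Z` yields a map whose composite with `g` is an admissible epi.
  obtain ⟨d, p, t, hp, ht⟩ := hE.localEpi Z (𝟙 _)
  obtain ⟨t, rfl⟩ := (y C).map_surjective t
  have ht' : t ≫ g = p := (y C).map_injective (by simpa using ht)
  refine h.of_isKer_of_comp (t := t) ⟨(y C).map_injective (by simpa using hE.w), ?_,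
    fun {T} s hs => ?_⟩ (ht' ▸ hp)
  · have := hE.isKer.mono
    exact (y C).mono_of_mono_map this
  · obtain ⟨r, hr⟩ := hE.exact ((y C).map s) (by rw [← Functor.map_comp, hs, Functor.map_zero])
    obtain ⟨r, rfl⟩ := (y C).map_surjective r
    exact ⟨r, (y C).map_injective (by simpa using hr)⟩

/-- The embedding into ind-objects preserves admissible sequences. -/
lemma ind_map {X Y Z : C} {f : X ⟶ Y} {g : Y ⟶ Z} (hfg : S f g) :
    S.ind ((y C).map f) ((y C).map g) := by
  refine h.ind_iff.2 ⟨by rw [← Functor.map_comp, (h.ker hfg).w, Functor.map_zero], fun t ht => ?_,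
    fun t ht => ?_, fun c z => ?_⟩
  · have := (h.ker hfg).mono
    obtain ⟨t, rfl⟩ := (y C).map_surjective t
    rw [← Functor.map_comp, Functor.map_eq_zero_iff] at ht
    rw [(cancel_mono f).1 (ht.trans zero_comp.symm), Functor.map_zero]
  · obtain ⟨t, rfl⟩ := (y C).map_surjective t
    rw [← Functor.map_comp, Functor.map_eq_zero_iff] at ht
    obtain ⟨s, rfl⟩ := (h.ker hfg).lift t ht
    exact ⟨(y C).map s, by simp⟩
  · obtain ⟨z, rfl⟩ := (y C).map_surjective z
    obtain ⟨d, p, x, hp, hx⟩ := h.exists_cover ⟨_, _, hfg⟩ z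
    exact ⟨d, p, (y C).map x, hp, by rw [← Functor.map_comp, hx, Functor.map_comp]⟩

/-- The pro-objects of an exact category form an exact category. -/
theorem pro : IsExactCore (Pro C) S.pro := h.op.ind.op

end IsExactCore

/-! ### Full subcategories closed under extensions -/

/-- The pullback of an admissible sequence. -/
lemma IsExactCore.exists_pullback {C : Type u} [Category.{v} C] [Preadditive C]
    {S : SequenceClass C} (h : IsExactCore C S) {X Y Z Z' : C} {f : X ⟶ Y} {g : Y ⟶ Z}
    (hfg : S f g) (c : Z' ⟶ Z) :
    ∃ (P : C) (f' : X ⟶ P) (b : P ⟶ Y) (g' : P ⟶ Z'), IsPullback b g' g c ∧ S f' g' ∧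
      f' ≫ b = f := by
  obtain ⟨P, f', b, q, h₁, h₂, h₃⟩ := h.op.exists_pushout (f := g.op) (g := f.op) hfg c.op
  exact ⟨P.unop, q.unop, b.unop, f'.unop, h₁.flip.unop, h₂, congrArg Quiver.Hom.unop h₃⟩

section Subcategory

universe v' u'

variable {B : Type u'} [Category.{v'} B] {D : Type u} [Category.{v} D] [Preadditive D]
  {S : SequenceClass D} (ι : B ⥤ D) [ι.Full]

/-- The kernel of a composite is an extension of the kernel of `g` by the kernel of `f`, hence stays
in the essential image. -/
lemma preimage_epi_comp (h : IsExactCore D S)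
    (hext : ∀ (X Z : B) (Y : D) (f : ι.obj X ⟶ Y) (g : Y ⟶ ι.obj Z), S f g → ι.essImage Y)
    {X Y Z : B} {f : X ⟶ Y} {g : Y ⟶ Z} (hf : (S.preimage ι).AdmissibleEpi f)
    (hg : (S.preimage ι).AdmissibleEpi g) : (S.preimage ι).AdmissibleEpi (f ≫ g) := by
  obtain ⟨K, k, hk⟩ := hf
  obtain ⟨L, l, hl⟩ := hg
  obtain ⟨M, m, hm⟩ := h.epi_comp ⟨_, _, hk⟩ ⟨_, _, hl⟩
  obtain ⟨u, v, -, -, huv⟩ := h.exists_kernels hk hl hm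
  obtain ⟨M', ⟨e⟩⟩ := hext _ _ _ _ _ huv
  obtain ⟨m', hm'⟩ := ι.map_surjective (e.hom ≫ m)
  exact ⟨M', m', h.of_iso ⟨e.symm, Iso.refl _, Iso.refl _, by simp [hm'], by simp⟩ hm⟩

variable [ι.Faithful]

/-- The pullback is an extension of `Y` by the kernel of `g`, hence stays in the essential image. -/
lemma preimage_epi_pullback (h : IsExactCore D S)
    (hext : ∀ (X Z : B) (Y : D) (f : ι.obj X ⟶ Y) (g : Y ⟶ ι.obj Z), S f g → ι.essImage Y)
    {X Y Z : B} {g : X ⟶ Z} (hg : (S.preimage ι).AdmissibleEpi g) (f : Y ⟶ Z) :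
    ∃ (P : B) (f' : P ⟶ X) (g' : P ⟶ Y), IsPullback f' g' g f ∧
      (S.preimage ι).AdmissibleEpi g' := by
  obtain ⟨K, k, hk⟩ := hg
  obtain ⟨P, k', b, g', hP, hg', -⟩ := h.exists_pullback hk (ι.map f)
  obtain ⟨P', ⟨e⟩⟩ := hext _ _ _ _ _ hg'
  obtain ⟨b', hb'⟩ := ι.map_surjective (e.hom ≫ b)
  obtain ⟨g'', hg''⟩ := ι.map_surjective (e.hom ≫ g')
  obtain ⟨k'', hk''⟩ := ι.map_surjective (k' ≫ e.inv)
  refine ⟨P', b', g'', ?_, K, k'', ?_⟩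
  · refine IsPullback.of_map ι (ι.map_injective ?_) ?_
    · simp [hb', hg'', hP.w]
    · exact hP.of_iso e.symm (Iso.refl _) (Iso.refl _) (Iso.refl _) (by simp [hb']) (by simp [hg''])
        (by simp) (by simp)
  · exact h.of_iso ⟨Iso.refl _, e.symm, Iso.refl _, by simp [hk''], by simp [hg'']⟩ hg'

variable [Preadditive B] [ι.Additive]

lemma IsKer.of_map {X Y Z : B} {f : X ⟶ Y} {g : Y ⟶ Z} (h : IsKer (ι.map f) (ι.map g)) :
    IsKer f g where
  w := ι.map_injective (by simpa using h.w)
  mono := ι.mono_of_mono_map h.mono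
  lift t ht := by
    obtain ⟨s, hs⟩ := h.lift (ι.map t) (by rw [← ι.map_comp, ht, ι.map_zero])
    obtain ⟨s, rfl⟩ := ι.map_surjective s
    exact ⟨s, ι.map_injective (by simpa using hs)⟩

lemma IsCok.of_map {X Y Z : B} {f : X ⟶ Y} {g : Y ⟶ Z} (h : IsCok (ι.map f) (ι.map g)) :
    IsCok f g where
  w := ι.map_injective (by simpa using h.w)
  epi := ι.epi_of_epi_map h.epi
  desc t ht := by
    obtain ⟨s, hs⟩ := h.desc (ι.map t) (by rw [← ι.map_comp, ht, ι.map_zero])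
    obtain ⟨s, rfl⟩ := ι.map_surjective s
    exact ⟨s, ι.map_injective (by simpa using hs)⟩

/-- A full additive subcategory closed under extensions of an exact category is an exact
category. -/
theorem IsExactCore.preimage [HasZeroObject B] (h : IsExactCore D S)
    (hext : ∀ (X Z : B) (Y : D) (f : ι.obj X ⟶ Y) (g : Y ⟶ ι.obj Z), S f g → ι.essImage Y) :
    IsExactCore B (S.preimage ι) := by
  have hext' (X Z : Bᵒᵖ) (Y : Dᵒᵖ) (f : ι.op.obj X ⟶ Y) (g : Y ⟶ ι.op.obj Z)
      (hfg : S.op f g) : ι.op.essImage Y := by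
    obtain ⟨W, ⟨e⟩⟩ := hext _ _ _ _ _ hfg
    exact ⟨.op W, ⟨e.symm.op⟩⟩
  exact
  { hasFiniteBiproducts := by
      have := h.hasBinaryBiproducts
      have : HasBinaryBiproducts B := ⟨fun X Z => by
        -- A direct sum is a split extension, so it lies in the essential image.
        have hS : S (biprod.inl : ι.obj X ⟶ ι.obj X ⊞ ι.obj Z) biprod.snd :=
          h.split _ biprod.fst biprod.inr _ (by simp) (by simp) (by simp) (by simp) (by simp)
        obtain ⟨Y, ⟨e⟩⟩ := hext _ _ _ _ _ hS
        let b : BinaryBicone X Z :=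
          { pt := Y
            inl := ι.preimage (biprod.inl ≫ e.inv)
            inr := ι.preimage (biprod.inr ≫ e.inv)
            fst := ι.preimage (e.hom ≫ biprod.fst)
            snd := ι.preimage (e.hom ≫ biprod.snd)
            inl_fst := ι.map_injective (by simp)
            inl_snd := ι.map_injective (by simp)
            inr_fst := ι.map_injective (by simp)
            inr_snd := ι.map_injective (by simp) }
        refine hasBinaryBiproduct_of_total b (ι.map_injective ?_)
        simp only [b, Functor.map_add, Functor.map_comp, Functor.map_preimage, Category.assoc,
          ← Preadditive.comp_add]
        rw [← Category.assoc biprod.fst, ← Category.assoc biprod.snd, ← Preadditive.add_comp,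
          biprod.total]
        simp⟩
      have : HasFiniteProducts B := hasFiniteProducts_of_has_binary_and_terminal
      exact .of_hasFiniteProducts
    of_iso := by
      rintro X Y Z X' Y' Z' f g f' g' ⟨a, b, c, h₁, h₂⟩ hfg
      exact h.of_iso ⟨ι.mapIso a, ι.mapIso b, ι.mapIso c, by simp [← Functor.map_comp, h₁],
        by simp [← Functor.map_comp, h₂]⟩ hfg
    ker := fun hfg => .of_map ι (h.ker hfg)
    cok := fun hfg => .of_map ι (h.cok hfg)
    split := fun i₁ p₁ i₂ p₂ h₁ h₂ h₃ h₄ h₅ => h.split _ (ι.map p₁) (ι.map i₂) _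
      (by rw [← ι.map_comp, h₁, ι.map_id]) (by rw [← ι.map_comp, h₂, ι.map_id])
      (by rw [← ι.map_comp, h₃, ι.map_zero]) (by rw [← ι.map_comp, h₄, ι.map_zero])
      (by rw [← ι.map_comp, ← ι.map_comp, ← ι.map_add, h₅, ι.map_id])
    epi_comp := preimage_epi_comp ι h hext
    epi_pullback := preimage_epi_pullback ι h hext
    mono_comp := fun {X Y Z f g} hf hg => by
      have := preimage_epi_comp ι.op h.op hext' (f := g.op) (g := f.op)
        ((op_admissibleEpi_iff (S := S.preimage ι) _).2 hg)
        ((op_admissibleEpi_iff (S := S.preimage ι) _).2 hf)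
      exact (op_admissibleEpi_iff (S := S.preimage ι) (g.op ≫ f.op)).1 this
    mono_pushout := fun {X Y Z g} hg f => by
      obtain ⟨P, f', g', h₁, h₂⟩ := preimage_epi_pullback ι.op h.op hext' (g := g.op)
        ((op_admissibleEpi_iff (S := S.preimage ι) _).2 hg) f.op
      exact ⟨P.unop, f'.unop, g'.unop, h₁.flip.unop,
        (op_admissibleEpi_iff (S := S.preimage ι) g').1 h₂⟩ }

end Subcategory

open IndObj

/-! ### Pro-objects -/

section Pro

variable (A : Type u) [Category.{v} A]

/-- The embedding of `A` into `Pro(A)`. -/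
def cst : A ⥤ Pro A where
  obj a := op ((y Aᵒᵖ).obj (op a))
  map f := ((y Aᵒᵖ).map f.op).op
  map_id a := by rw [op_id, CategoryTheory.Functor.map_id, op_id]
  map_comp f g := by rw [op_comp, Functor.map_comp, op_comp]

instance : (cst A).Full where
  map_surjective f := by
    obtain ⟨g, hg⟩ := (y Aᵒᵖ).map_surjective f.unop
    exact ⟨g.unop, Quiver.Hom.unop_inj hg⟩

instance : (cst A).Faithful where
  map_injective h := Quiver.Hom.op_inj ((y Aᵒᵖ).map_injective (Quiver.Hom.op_inj h))

variable {A}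

lemma pro_isIso {P Q : Pro A} (f : P ⟶ Q)
    (h₁ : ∀ (a : A) (s t : Q ⟶ (cst A).obj a), f ≫ s = f ≫ t → s = t)
    (h₂ : ∀ (a : A) (t : P ⟶ (cst A).obj a), ∃ s : Q ⟶ (cst A).obj a, f ≫ s = t) : IsIso f := by
  have : IsIso f.unop := isIso_of_bijective f.unop
    (fun c s t hst => Quiver.Hom.op_inj (h₁ c.unop s.op t.op (Quiver.Hom.unop_inj hst)))
    (fun c t => by
      obtain ⟨s, hs⟩ := h₂ c.unop t.op
      exact ⟨s.unop, Quiver.Hom.op_inj hs⟩)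
  rw [← Quiver.Hom.op_unop f]
  infer_instance

variable [Preadditive A] {E : SequenceClass A}

instance : (cst A).Additive where
  map_add {a b f g} := by
    change ((y Aᵒᵖ).map (f + g).op).op = ((y Aᵒᵖ).map f.op).op + ((y Aᵒᵖ).map g.op).op
    rw [op_add, Functor.map_add, op_add]

variable (h : IsExactCore A E)
include h

/-- The dual of `ElemExact`: pro-objects are tested by their maps to objects of `A`, and covers are
replaced by admissible monomorphisms of `A`. -/
lemma IsExactCore.pro_of_elements {P Q R : Pro A} {f : P ⟶ Q} {g : Q ⟶ R} (w : f ≫ g = 0)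
    (h₁ : ∀ (a : A) (t : R ⟶ (cst A).obj a), g ≫ t = 0 → t = 0)
    (h₂ : ∀ (a : A) (t : Q ⟶ (cst A).obj a), f ≫ t = 0 → ∃ s, g ≫ s = t)
    (h₃ : ∀ (a : A) (t : P ⟶ (cst A).obj a), ∃ (b : A) (m : a ⟶ b) (s : Q ⟶ (cst A).obj b),
      E.AdmissibleMono m ∧ f ≫ s = t ≫ (cst A).map m) : E.pro f g := by
  refine (h.op.ind_iff (f := g.unop) (g := f.unop)).2 ⟨Quiver.Hom.op_inj w, fun {c} t ht => ?_,
    fun {c} t ht => ?_, fun c z => ?_⟩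
  · exact Quiver.Hom.op_inj (h₁ c.unop t.op (Quiver.Hom.unop_inj ht))
  · obtain ⟨s, hs⟩ := h₂ c.unop t.op (Quiver.Hom.unop_inj ht)
    exact ⟨s.unop, Quiver.Hom.op_inj hs⟩
  · obtain ⟨b, m, s, hm, hs⟩ := h₃ c.unop z.op
    exact ⟨Opposite.op b, m.op, s.unop, (op_admissibleEpi_iff (S := E) m.op).2 hm, Quiver.Hom.op_inj hs⟩

lemma IsExactCore.of_pro {X Y Z : A} {f : X ⟶ Y} {g : Y ⟶ Z}
    (hfg : E.pro ((cst A).map f) ((cst A).map g)) : E f g :=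
  h.op.of_ind (f := g.op) (g := f.op) hfg

lemma IsExactCore.pro_map {X Y Z : A} {f : X ⟶ Y} {g : Y ⟶ Z} (hfg : E f g) :
    E.pro ((cst A).map f) ((cst A).map g) :=
  h.op.ind_map (f := g.op) (g := f.op) hfg

end Pro

/-! ### The pro-objects attached to a diagram -/

section Levels

variable {A : Type u} [Category.{v} A]

/-- The inductive system of the pro-objects `“lim”_i X_{i,j}`. -/
def lev (X : Pairs ⥤ A) : ULift.{v} ℤ ⥤ Pro A :=
  extend.{v} ⋙ (Functor.whiskeringRight _ _ _).obj X ⋙ proLim A (ULift.{v} ℤ)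

/-- The functoriality of `lev`. -/
def levMap {X Y : Pairs ⥤ A} (f : X ⟶ Y) : lev X ⟶ lev Y :=
  Functor.whiskerLeft extend.{v}
    (Functor.whiskerRight ((Functor.whiskeringRight _ _ _).map f) (proLim A (ULift.{v} ℤ)))

/-- The `j`-th pro-object. -/
abbrev levObj (X : Pairs ⥤ A) (j : ℤ) : Pro A := (lev X).obj ⟨j⟩

/-- The transition maps. -/
def tr (X : Pairs ⥤ A) {i j : ℤ} (hij : i ≤ j) : levObj X i ⟶ levObj X j :=
  (lev X).map (homOfLE hij)

lemma tr_comp (X : Pairs ⥤ A) {i j k : ℤ} (hij : i ≤ j) (hjk : j ≤ k) :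
    tr X hij ≫ tr X hjk = tr X (hij.trans hjk) := ((lev X).map_comp _ _).symm

/-- The structure maps of the limit, indexed by all integers. -/
def proj (X : Pairs ⥤ A) (i j : ℤ) :
    levObj X j ⟶ (cst A).obj (X.obj (pair (min i j) j (min_le_right i j))) :=
  (inj (((extend.{v}.obj ⟨j⟩ : ULift.{v} ℤ ⥤ Pairs) ⋙ X).op) (op ⟨i⟩)).op

/-- The structure maps of the limit. -/
def prj (X : Pairs ⥤ A) {i j : ℤ} (hij : i ≤ j) :
    levObj X j ⟶ (cst A).obj (X.obj (pair i j hij)) :=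
  proj X i j ≫ (cst A).map (str X (min_le_right i j) hij (min_le_left i j) le_rfl)

lemma str_str (X : Pairs ⥤ A) {i j i' j' i'' j'' : ℤ} (h : i ≤ j) (h' : i' ≤ j') (h'' : i'' ≤ j'')
    (hi : i ≤ i') (hj : j ≤ j') (hi' : i' ≤ i'') (hj' : j' ≤ j'') :
    str X h h' hi hj ≫ str X h' h'' hi' hj' = str X h h'' (hi.trans hi') (hj.trans hj') :=
  (X.map_comp _ _).symm

lemma str_self (X : Pairs ⥤ A) {i j : ℤ} (h : i ≤ j) : str X h h le_rfl le_rfl = 𝟙 _ := X.map_id _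

lemma proj_str (X : Pairs ⥤ A) {i i' : ℤ} (j : ℤ) (h : i ≤ i') :
    proj X i j ≫ (cst A).map (str X (min_le_right i j) (min_le_right i' j) (min_le_min_right _ h)
      le_rfl) = proj X i' j := by
  refine Quiver.Hom.unop_inj ?_
  exact map_inj ((((extend.{v}.obj ⟨j⟩ : ULift.{v} ℤ ⥤ Pairs) ⋙ X).op))
    (i := op ⟨i'⟩) (j := op ⟨i⟩) (Quiver.Hom.op (homOfLE h))

lemma proj_eq (X : Pairs ⥤ A) {i j : ℤ} (h : i ≤ j) :
    proj X i j = prj X h ≫ (cst A).map (str X h (min_le_right i j) (by simp [h]) le_rfl) := by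
  rw [prj, Category.assoc, ← Functor.map_comp, str_str, str_self,
    CategoryTheory.Functor.map_id, Category.comp_id]

lemma prj_str (X : Pairs ⥤ A) {i i' j : ℤ} (h : i ≤ j) (h' : i' ≤ j) (hi : i ≤ i') :
    prj X h ≫ (cst A).map (str X h h' hi le_rfl) = prj X h' := by
  rw [prj, prj, ← proj_str X j hi]
  simp only [Category.assoc, ← Functor.map_comp]
  rfl

lemma levMap_proj {X Y : Pairs ⥤ A} (f : X ⟶ Y) (i j : ℤ) :
    (levMap f).app ⟨j⟩ ≫ proj Y i j =
      proj X i j ≫ (cst A).map (f.app (pair (min i j) j (min_le_right i j))) := by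
  refine Quiver.Hom.unop_inj ?_
  exact inj_map (NatTrans.op (Functor.whiskerLeft (extend.{v}.obj ⟨j⟩ : ULift.{v} ℤ ⥤ Pairs) f))
    (op ⟨i⟩)

lemma levMap_prj {X Y : Pairs ⥤ A} (f : X ⟶ Y) {i j : ℤ} (h : i ≤ j) :
    (levMap f).app ⟨j⟩ ≫ prj Y h = prj X h ≫ (cst A).map (f.app (pair i j h)) := by
  rw [prj, ← Category.assoc, levMap_proj, prj, Category.assoc, Category.assoc,
    ← Functor.map_comp, ← Functor.map_comp, ← f.naturality]

lemma tr_proj (X : Pairs ⥤ A) {j j' : ℤ} (h : j ≤ j') (i : ℤ) :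
    tr X h ≫ proj X i j' = proj X i j ≫ (cst A).map (str X (min_le_right i j) (min_le_right i j')
      (min_le_min_left _ h) h) := by
  refine Quiver.Hom.unop_inj ?_
  exact inj_map (NatTrans.op (Functor.whiskerRight
    ((extend.{v}.map (homOfLE h : (⟨j⟩ : ULift.{v} ℤ) ⟶ ⟨j'⟩))) X)) (op ⟨i⟩)

lemma tr_prj (X : Pairs ⥤ A) {i j i' j' : ℤ} (h : i ≤ j) (h' : i' ≤ j') (hi : i ≤ i')
    (hj : j ≤ j') :
    tr X hj ≫ prj X h' = prj X h ≫ (cst A).map (str X h h' hi hj) := by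
  rw [← prj_str X (h.trans hj) h' hi, ← Category.assoc, prj, ← Category.assoc, tr_proj, proj_eq X h]
  simp only [Category.assoc, ← Functor.map_comp]
  rfl

lemma exists_fac_prj {X : Pairs ⥤ A} {j : ℤ} {a : A} (t : levObj X j ⟶ (cst A).obj a) :
    ∃ (i : ℤ) (h : i ≤ j) (s : X.obj (pair i j h) ⟶ a), t = prj X h ≫ (cst A).map s := by
  obtain ⟨i, s, hs⟩ := exists_fac_inj
    (F := (((extend.{v}.obj ⟨j⟩ : ULift.{v} ℤ ⥤ Pairs) ⋙ X).op)) t.unop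
  have ht : t = proj X i.unop.down j ≫ (cst A).map s.unop := Quiver.Hom.unop_inj hs
  refine ⟨min i.unop.down j, min_le_right _ _, s.unop, ?_⟩
  rw [ht, prj, ← proj_str X j (min_le_left i.unop.down j)]

/-- Enlarging the index of a factorization. -/
lemma exists_fac_prj_le {X : Pairs ⥤ A} {j : ℤ} {a : A} (t : levObj X j ⟶ (cst A).obj a) (m : ℤ) :
    ∃ (i : ℤ) (_ : i ≤ m) (h : i ≤ j) (s : X.obj (pair i j h) ⟶ a),
      t = prj X h ≫ (cst A).map s := by
  obtain ⟨i, h, s, rfl⟩ := exists_fac_prj t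
  refine ⟨min i m, min_le_right _ _, (min_le_left _ _).trans h,
    str X _ h (min_le_left _ _) le_rfl ≫ s, ?_⟩
  rw [Functor.map_comp, ← Category.assoc, prj_str]

lemma lev_hom_ext {X : Pairs ⥤ A} {j : ℤ} {P : Pro A} {f g : P ⟶ levObj X j}
    (hfg : ∀ (i : ℤ) (h : i ≤ j), f ≫ prj X h = g ≫ prj X h) : f = g := by
  refine Quiver.Hom.unop_inj (lim_hom_ext
    (F := (((extend.{v}.obj ⟨j⟩ : ULift.{v} ℤ ⥤ Pairs) ⋙ X).op)) fun i => Quiver.Hom.op_inj ?_)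
  change f ≫ proj X i.unop.down j = g ≫ proj X i.unop.down j
  rw [← proj_str X j (min_le_left i.unop.down j), proj_eq X (min_le_right i.unop.down j)]
  simp only [← Category.assoc, hfg]

lemma exists_lev_lift {X : Pairs ⥤ A} {j : ℤ} {P : Pro A}
    (τ : ∀ (i : ℤ) (h : i ≤ j), P ⟶ (cst A).obj (X.obj (pair i j h)))
    (hτ : ∀ (i i' : ℤ) (h : i ≤ j) (h' : i' ≤ j) (hi : i ≤ i'),
      τ i h ≫ (cst A).map (str X h h' hi le_rfl) = τ i' h') :
    ∃ f : P ⟶ levObj X j, ∀ (i : ℤ) (h : i ≤ j), f ≫ prj X h = τ i h := by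
  let F := (((extend.{v}.obj ⟨j⟩ : ULift.{v} ℤ ⥤ Pairs) ⋙ X).op)
  let τ' (i : (ULift.{v} ℤ)ᵒᵖ) : (y Aᵒᵖ).obj (F.obj i) ⟶ P.unop :=
    (τ (min i.unop.down j) (min_le_right _ _)).unop
  have hτ' {i i' : (ULift.{v} ℤ)ᵒᵖ} (s : i ⟶ i') : (y Aᵒᵖ).map (F.map s) ≫ τ' i' = τ' i :=
    Quiver.Hom.op_inj (hτ _ _ (min_le_right _ _) (min_le_right _ _)
      (min_le_min_right _ (leOfHom s.unop : i'.unop ≤ i.unop)))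
  obtain ⟨f, hf⟩ : ∃ f : P ⟶ levObj X j, ∀ i, f ≫ proj X i j = τ (min i j) (min_le_right _ _) :=
    ⟨(limDesc τ' hτ').op, fun i => Quiver.Hom.unop_inj (inj_limDesc τ' hτ' (op ⟨i⟩))⟩
  refine ⟨f, fun i hi => ?_⟩
  rw [prj, ← Category.assoc, hf, hτ]

end Levels

/-! ### The filtration of the ind-pro-object attached to an admissible diagram -/

section Admissible

variable {A : Type u} [Category.{v} A] [Preadditive A] {E : SequenceClass A}
  (h : IsExactCore A E) {X : Pairs ⥤ A} (hX : admissible E X)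
include h hX

/-- The vanishing is already visible on some `X_{m,j}` with `m ≤ i`, and `X_{m,j} ⟶ X_{i,j}` is an
epimorphism. This serves as surjectivity of `prj` before `pro_tr_prj` is available. -/
lemma IsExactCore.eq_zero_of_prj {i j : ℤ} (hij : i ≤ j) {a : A} (s : X.obj (pair i j hij) ⟶ a)
    (hs : prj X hij ≫ (cst A).map s = 0) : s = 0 := by
  have hs' : proj X i j ≫
      (cst A).map (str X (min_le_right i j) hij (min_le_left i j) le_rfl ≫ s) = 0 := by
    rw [Functor.map_comp, ← Category.assoc]
    exact hs
  obtain ⟨m, r, hr⟩ := exists_map_eq_zero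
    (F := (((extend.{v}.obj ⟨j⟩ : ULift.{v} ℤ ⥤ Pairs) ⋙ X).op)) (i := Opposite.op ⟨i⟩)
    (a := (str X (min_le_right i j) hij (min_le_left i j) le_rfl ≫ s).op)
    (Quiver.Hom.op_inj hs')
  have hr' : str X (min_le_right m.unop.down j) (min_le_right i j)
      (min_le_min_right _ (leOfHom r.unop : m.unop ≤ ⟨i⟩)) le_rfl ≫
        str X (min_le_right i j) hij (min_le_left i j) le_rfl ≫ s = 0 := Quiver.Hom.op_inj hr
  have hle : min m.unop.down j ≤ i :=
    (min_le_left _ _).trans (leOfHom r.unop : m.unop ≤ ⟨i⟩)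
  rw [← Category.assoc, str_str] at hr'
  have := (h.cok (hX (min m.unop.down j) i j hle hij)).epi
  exact zero_of_epi_comp _ hr'

/-- For `i = j = k` both maps of the admissible sequence are the identity, and their composite is
zero. -/
lemma IsExactCore.isZero_diag (i : ℤ) : IsZero (X.obj (pair i i le_rfl)) := by
  have := (h.ker (hX i i i le_rfl le_rfl)).w
  rw [str_self] at this
  rw [IsZero.iff_id_eq_zero]
  simpa using this

/-- The sequences `X_i ⟶ X_j ⟶ X_{i,j}` are admissible. -/
lemma IsExactCore.pro_tr_prj {i j : ℤ} (hij : i ≤ j) : E.pro (tr X hij) (prj X hij) := by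
  refine h.pro_of_elements ?_ (fun a t ht => ?_) (fun a t ht => ?_) (fun a t => ?_)
  · have : str X (le_refl i) hij le_rfl hij = 0 := (h.isZero_diag hX i).eq_of_src _ _
    rw [tr_prj X (le_refl i) hij le_rfl hij, this, Functor.map_zero, comp_zero]
  · obtain ⟨s, rfl⟩ := (cst A).map_surjective t
    rw [h.eq_zero_of_prj hX hij s ht, Functor.map_zero]
  -- With `m ≤ i`, the map `s` vanishes on `X_{m,i}` and so factors through `X_{i,j}`.
  · obtain ⟨m, hm, hmj, s, rfl⟩ := exists_fac_prj_le t i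
    rw [← Category.assoc, tr_prj X hm hmj le_rfl hij, Category.assoc, ← Functor.map_comp] at ht
    obtain ⟨r, hr⟩ := (h.cok (hX m i j hm hij)).desc s (h.eq_zero_of_prj hX hm _ ht)
    exact ⟨(cst A).map r, by rw [← hr, Functor.map_comp, ← Category.assoc, prj_str]⟩
  · obtain ⟨m, hm, s, rfl⟩ := exists_fac_prj t
    -- A map from `X_i` is seen on some `X_{m,i}`; pushing out along `X_{m,i} ⟶ X_{m,j}` extends it
    -- to `X_j`.
    obtain ⟨b, s', m', hP, hm'⟩ := h.mono_pushout ⟨_, _, hX m i j hm hij⟩ s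
    refine ⟨b, m', prj X (hm.trans hij) ≫ (cst A).map s', hm', ?_⟩
    rw [← Category.assoc, tr_prj X hm (hm.trans hij) le_rfl hij, Category.assoc, Category.assoc,
      ← Functor.map_comp, ← Functor.map_comp, hP.w]

lemma IsExactCore.mono_tr {i j : ℤ} (hij : i ≤ j) : Mono (tr X hij) :=
  (h.pro.ker (h.pro_tr_prj hX hij)).mono

lemma IsExactCore.epi_prj {i j : ℤ} (hij : i ≤ j) : Epi (prj X hij) :=
  (h.pro.cok (h.pro_tr_prj hX hij)).epi

end Admissible

section Filtration

variable {A : Type u} [Category.{v} A]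

/-- The maps from the terms of the filtration. -/
def fil (X : Pairs ⥤ A) (j : ℤ) : (y (Pro A)).obj (levObj X j) ⟶ (indProLim A).obj X :=
  inj (lev X) ⟨j⟩

@[simp]
lemma map_tr_fil (X : Pairs ⥤ A) {i j : ℤ} (hij : i ≤ j) :
    (y (Pro A)).map (tr X hij) ≫ fil X j = fil X i := map_inj (lev X) _

@[simp]
lemma fil_map {X Y : Pairs ⥤ A} (f : X ⟶ Y) (j : ℤ) :
    fil X j ≫ (indProLim A).map f = (y (Pro A)).map ((levMap f).app ⟨j⟩) ≫ fil Y j :=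
  inj_map (levMap f) _

lemma exists_fac_fil {X : Pairs ⥤ A} {P : Pro A}
    (t : (y (Pro A)).obj P ⟶ (indProLim A).obj X) :
    ∃ (j : ℤ) (s : P ⟶ levObj X j), t = (y (Pro A)).map s ≫ fil X j := by
  obtain ⟨j, s, hs⟩ := exists_fac_inj (F := lev X) t
  exact ⟨j.down, s, hs⟩

lemma indProLim_hom_ext {X : Pairs ⥤ A} {Y : IndPro A} {f g : (indProLim A).obj X ⟶ Y}
    (hfg : ∀ j, fil X j ≫ f = fil X j ≫ g) : f = g :=
  lim_hom_ext (F := lev X) fun j => hfg j.down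

lemma IsExactCore.mono_fil [Preadditive A] {E : SequenceClass A} (h : IsExactCore A E)
    {X : Pairs ⥤ A} (hX : admissible E X) (j : ℤ) : Mono (fil X j) := by
  refine mono_of_injective _ fun P s t hst => ?_
  obtain ⟨s, rfl⟩ := (y (Pro A)).map_surjective s
  obtain ⟨t, rfl⟩ := (y (Pro A)).map_surjective t
  obtain ⟨k, r, hr⟩ := exists_eq_of_inj_eq (F := lev X) hst
  have : Mono ((lev X).map r) := h.mono_tr hX (leOfHom r : (⟨j⟩ : ULift.{v} ℤ) ≤ k)
  rw [(cancel_mono _).1 hr]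

instance [Preadditive A] : (indProLim A).Additive where
  map_add {X Y f g} := by
    refine indProLim_hom_ext fun j => ?_
    rw [Preadditive.comp_add, fil_map, fil_map, fil_map, ← Preadditive.add_comp,
      ← Functor.map_add]
    congr 2
    refine lev_hom_ext fun i hi => ?_
    rw [Preadditive.add_comp, levMap_prj, levMap_prj, levMap_prj, ← Preadditive.comp_add,
      ← Functor.map_add]
    rfl

end Filtration

/-! ### Reindexing -/

/-- A bicofinal map below the identity satisfying a relation. -/
lemma exists_bicofinal (R : ℤ → ℤ → Prop)
    (hR : ∀ {a a' j j' : ℤ}, a' ≤ a → j ≤ j' → R a j → R a' j')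
    (h₁ : ∀ a, ∃ j, R a j) (h₂ : ∀ j, ∃ a, R a j) :
    ∃ φ : ℤ →o ℤ, Bicofinal φ ∧ φ ≤ OrderHom.id ∧ ∀ j, R (φ j) j := by
  -- The value at `j` is the greatest `b ≤ j` with `R b j`. The bound `b ≤ j` makes this maximum
  -- exist and forces the limit at `-∞`; `h₁` gives the limit at `+∞`.
  have key (j : ℤ) : ∃ b, (b ≤ j ∧ R b j) ∧ ∀ z, z ≤ j ∧ R z j → z ≤ b := by
    refine Int.exists_greatest_of_bdd ⟨j, fun z hz => hz.1⟩ ?_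
    obtain ⟨a, ha⟩ := h₂ j
    exact ⟨min a j, min_le_right _ _, hR (min_le_left _ _) le_rfl ha⟩
  choose φ hφ hmax using key
  refine ⟨⟨φ, fun i j hij => hmax j _ ⟨(hφ i).1.trans hij, hR le_rfl hij (hφ i).2⟩⟩, ⟨?_, ?_⟩,
    fun j => (hφ j).1, fun j => (hφ j).2⟩
  · rw [Filter.tendsto_atTop]
    intro a
    obtain ⟨j₀, hj₀⟩ := h₁ a
    filter_upwards [Filter.eventually_ge_atTop (max a j₀)] with j hj
    exact hmax j a ⟨(le_max_left _ _).trans hj, hR le_rfl ((le_max_right _ _).trans hj) hj₀⟩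
  · exact Filter.tendsto_atBot_mono (fun j => (hφ j).1) Filter.tendsto_id

/-- `Y` is the diagram `X_{χ i, χ j}`, with its map `s` to `X`. -/
structure Reindexing {A : Type u} [Category.{v} A] {X Y : Pairs ⥤ A} (χ : ℤ →o ℤ) (s : Y ⟶ X) where
  le : ∀ i, χ i ≤ i
  /-- the identification of the components -/
  θ : ∀ {i j : ℤ} (h : i ≤ j), X.obj (pair (χ i) (χ j) (χ.monotone h)) ≅ Y.obj (pair i j h)
  nat : ∀ {i j i' j' : ℤ} (h : i ≤ j) (h' : i' ≤ j') (hi : i ≤ i') (hj : j ≤ j'),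
    (θ h).hom ≫ str Y h h' hi hj =
      str X (χ.monotone h) (χ.monotone h') (χ.monotone hi) (χ.monotone hj) ≫ (θ h').hom
  w : ∀ {i j : ℤ} (h : i ≤ j), (θ h).hom ≫ s.app (pair i j h) =
    str X (χ.monotone h) h (le i) (le j)

section Reindex

variable {A : Type u} [Category.{v} A]

/-- The reindexing of `X_φ` by `χ`. -/
def reindexing {E : SequenceClass A} (X : AdmDiagram E) {φ ψ χ : ℤ →o ℤ} (hle : χ ≤ OrderHom.id)
    (hψ : ψ = φ.comp χ) (h : ψ ≤ φ) : Reindexing χ (reindexMap X h).hom where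
  le i := hle i
  θ _ := eqToIso (by subst hψ; rfl)
  nat _ _ _ _ := by
    subst hψ
    exact (Category.id_comp _).trans (Category.comp_id _).symm
  w _ := by
    subst hψ
    exact Category.id_comp _

variable [Preadditive A] {E : SequenceClass A} (h : IsExactCore A E)
include h

/-- The comparison of the filtrations of a diagram and of its reindexing. -/
lemma IsExactCore.exists_reindex_lev {X Y : Pairs ⥤ A} (hX : admissible E X) {χ : ℤ →o ℤ}
    (hχ : Bicofinal χ) {s : Y ⟶ X} (r : Reindexing χ s) (j : ℤ) :
    ∃ u : levObj X (χ j) ⟶ levObj Y j, IsIso u ∧ u ≫ (levMap s).app ⟨j⟩ = tr X (r.le j) ∧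
      ∀ (i : ℤ) (hi : i ≤ j), u ≫ prj Y hi = prj X (χ.monotone hi) ≫ (cst A).map (r.θ hi).hom := by
  obtain ⟨u, hu⟩ := exists_lev_lift (X := Y) (j := j)
    (fun i hi => prj X (χ.monotone hi) ≫ (cst A).map (r.θ hi).hom) (fun i i' hi hi' hii' => by
      rw [Category.assoc, ← Functor.map_comp, r.nat, Functor.map_comp, ← Category.assoc, prj_str])
  refine ⟨u, pro_isIso u (fun a s t hst => ?_) (fun a t => ?_), ?_, hu⟩
  · rw [← sub_eq_zero, ← Preadditive.comp_sub] at hst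
    rw [← sub_eq_zero]
    obtain ⟨i, hi, q, hq⟩ := exists_fac_prj (s - t)
    rw [hq, ← Category.assoc, hu, Category.assoc, ← Functor.map_comp] at hst
    rw [hq, zero_of_epi_comp _ (h.eq_zero_of_prj hX _ _ hst), Functor.map_zero, comp_zero]
  · obtain ⟨m, hm, s, rfl⟩ := exists_fac_prj t
    -- The map is seen on `X_{m, χ j}`, and some `χ i` lies below `m` because `χ` tends to `-∞`.
    obtain ⟨i, hi⟩ := ((Filter.tendsto_atBot.1 hχ.2 m).and (Filter.eventually_le_atBot j)).exists
    refine ⟨prj Y hi.2 ≫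
      (cst A).map ((r.θ hi.2).inv ≫ str X (χ.monotone hi.2) hm hi.1 le_rfl ≫ s), ?_⟩
    rw [← Category.assoc, hu, Category.assoc, ← Functor.map_comp, Iso.hom_inv_id_assoc,
      Functor.map_comp, ← Category.assoc, prj_str]
  · refine lev_hom_ext fun i hi => ?_
    rw [Category.assoc, levMap_prj, ← Category.assoc, hu, Category.assoc, ← Functor.map_comp, r.w,
      tr_prj X (χ.monotone hi) hi (r.le i) (r.le j)]

/-- The terms of the filtration for `Y` are the terms of index `χ j` for `X`, and these are cofinal
because `χ` tends to `+∞`. -/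
lemma IsExactCore.isIso_map_of_reindexing {X Y : Pairs ⥤ A} (hX : admissible E X) {χ : ℤ →o ℤ}
    (hχ : Bicofinal χ) {s : Y ⟶ X} (r : Reindexing χ s) : IsIso ((indProLim A).map s) := by
  choose u hu hu' _ using h.exists_reindex_lev hX hχ r
  have hm (j : ℤ) : Mono ((levMap s).app ⟨j⟩) := by
    have h₁ : (levMap s).app ⟨j⟩ = inv (u j) ≫ tr X (r.le j) := by
      rw [← hu', IsIso.inv_hom_id_assoc]
    have := h.mono_tr hX (r.le j)
    rw [h₁]
    infer_instance
  refine isIso_of_bijective _ (fun P a b hab => ?_) (fun P t => ?_)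
  · rw [← sub_eq_zero, ← Preadditive.sub_comp] at hab
    rw [← sub_eq_zero]
    obtain ⟨j, c, hc⟩ := exists_fac_fil (a - b)
    have := h.mono_fil hX j
    rw [hc, Category.assoc, fil_map, ← Functor.map_comp_assoc] at hab
    have h₁ := zero_of_comp_mono _ hab
    rw [Functor.map_eq_zero_iff] at h₁
    rw [hc, zero_of_comp_mono _ h₁, Functor.map_zero, zero_comp]
  · obtain ⟨j, a, rfl⟩ := exists_fac_fil t
    obtain ⟨k, hk⟩ := (Filter.tendsto_atTop.1 hχ.1 j).exists
    refine ⟨(y (Pro A)).map (a ≫ tr X hk ≫ u k) ≫ fil Y k, ?_⟩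
    rw [Category.assoc, fil_map, ← Functor.map_comp_assoc, Category.assoc, Category.assoc, hu',
      tr_comp X hk (r.le k), Functor.map_comp_assoc, map_tr_fil]

/-- Two out of six. Choose `χ ≤ id` with `ψ ∘ χ ≤ φ`; in `X_{φχ} ⟶ X_{ψχ} ⟶ X_φ ⟶ X_ψ` the
composites of adjacent maps are reindexings by `χ`, hence become isomorphisms, and so does each map.
-/
lemma IsExactCore.isIso_map_reindexMap (X : AdmDiagram E) {φ ψ : ℤ →o ℤ} (hφ : Bicofinal φ)
    (hψ : Bicofinal ψ) (hle : φ ≤ ψ) : IsIso ((indProLim A).map (reindexMap X hle).hom) := by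
  obtain ⟨χ, hχ, hχ', hR⟩ := exists_bicofinal (fun a j => ψ a ≤ φ j)
    (fun ha hj hR => (ψ.monotone ha).trans (hR.trans (φ.monotone hj)))
    (fun a => (Filter.tendsto_atTop.1 hφ.1 (ψ a)).exists)
    (fun j => (Filter.tendsto_atBot.1 hψ.2 (φ j)).exists)
  have h₁ : φ.comp χ ≤ ψ.comp χ := fun i => hle (χ i)
  have h₂ : ψ.comp χ ≤ φ := hR
  let m₁ := reindexMap X h₁
  let m₂ := reindexMap X h₂
  let m₃ := reindexMap X hle
  have h₁₂ : IsIso ((indProLim A).map m₁.hom ≫ (indProLim A).map m₂.hom) := by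
    have e : m₁.hom ≫ m₂.hom = (reindexMap X (h₁.trans h₂)).hom := by
      ext p
      exact (X.obj.map_comp _ _).symm
    rw [← Functor.map_comp, e]
    exact h.isIso_map_of_reindexing (reindex X φ).property hχ (reindexing X hχ' rfl _)
  have h₂₃ : IsIso ((indProLim A).map m₂.hom ≫ (indProLim A).map m₃.hom) := by
    have e : m₂.hom ≫ m₃.hom = (reindexMap X (h₂.trans hle)).hom := by
      ext p
      exact (X.obj.map_comp _ _).symm
    rw [← Functor.map_comp, e]
    exact h.isIso_map_of_reindexing (reindex X ψ).property hχ (reindexing X hχ' rfl _)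
  have : IsIso ((indProLim A).map m₂.hom) := by
    have := IsSplitMono.mk' (SplitMono.mk (f := (indProLim A).map m₂.hom)
      ((indProLim A).map m₃.hom ≫ inv ((indProLim A).map m₂.hom ≫ (indProLim A).map m₃.hom))
      (by rw [← Category.assoc, IsIso.hom_inv_id]))
    have : Epi ((indProLim A).map m₂.hom) :=
      epi_of_epi ((indProLim A).map m₁.hom) _
    exact isIso_of_epi_of_isSplitMono _
  exact IsIso.of_isIso_comp_left ((indProLim A).map m₂.hom) _

lemma IsExactCore.inverts_reindexMaps :
    (reindexMaps E).IsInvertedBy ((admissible E).ι ⋙ indProLim A) := by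
  rintro _ _ _ ⟨X, φ, ψ, hφ, hψ, hle⟩
  exact h.isIso_map_reindexMap X hφ hψ hle

end Reindex

/-! ### The morphisms between the ind-pro-objects attached to admissible diagrams -/

section Morphisms

variable {A : Type u} [Category.{v} A] [Preadditive A] {E : SequenceClass A}
  (h : IsExactCore A E)
include h

/-- A morphism of diagrams is recovered from its limit because the terms of the target are
subobjects and the projections from the terms of the source are epimorphisms. -/
lemma IsExactCore.indProLim_map_injective {X Y : Pairs ⥤ A} (hX : admissible E X)
    (hY : admissible E Y) {f g : X ⟶ Y} (hfg : (indProLim A).map f = (indProLim A).map g) :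
    f = g := by
  ext ⟨⟨i, j⟩, hij⟩
  have h₁ : (levMap f).app ⟨j⟩ = (levMap g).app ⟨j⟩ := by
    have := h.mono_fil hY j
    refine (y (Pro A)).map_injective ?_
    rw [← cancel_mono (fil Y j), ← fil_map, ← fil_map, hfg]
  have := h.epi_prj hX hij
  refine (cst A).map_injective ?_
  rw [← cancel_epi (prj X hij)]
  exact (levMap_prj f hij).symm.trans ((congrArg (· ≫ prj Y hij) h₁).trans (levMap_prj g hij))

/-- Up to reindexing the source, every morphism comes from a morphism of diagrams. -/
lemma IsExactCore.exists_indProLim_map_eq {X Y : Pairs ⥤ A} (hX : admissible E X)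
    (hY : admissible E Y) (a : (indProLim A).obj X ⟶ (indProLim A).obj Y) :
    ∃ φ : ℤ →o ℤ, Bicofinal φ ∧ φ ≤ OrderHom.id ∧
      ∀ {W : Pairs ⥤ A} (s : W ⟶ X) (_ : Reindexing φ s), ∃ f : W ⟶ Y,
        (indProLim A).map s ≫ a = (indProLim A).map f := by
  -- The relation says that `a` carries `X_i` into `Y_j`.
  obtain ⟨φ, hφ, hle, hR⟩ := exists_bicofinal
    (fun i j => ∃ t : levObj X i ⟶ levObj Y j, (y (Pro A)).map t ≫ fil Y j = fil X i ≫ a)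
    (fun {i i' j j'} hi hj ⟨t, ht⟩ => ⟨tr X hi ≫ t ≫ tr Y hj, by
      rw [Functor.map_comp, Functor.map_comp, Category.assoc, Category.assoc, map_tr_fil, ht,
        ← Category.assoc, map_tr_fil]⟩)
    (fun i => by
      obtain ⟨j, t, ht⟩ := exists_fac_fil (fil X i ≫ a)
      exact ⟨j, t, ht.symm⟩)
    -- The image of `X_0` lies in some `Y_k`. Its map to the quotient of `Y_{max k j}` by `Y_j`, an
    -- object of `A`, vanishes on some `X_i`, whose image therefore lies in `Y_j`.
    (fun j => by
      obtain ⟨k, t, ht⟩ := exists_fac_fil (fil X 0 ≫ a)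
      obtain ⟨i, hi, s, hs⟩ := exists_fac_prj (t ≫ tr Y (le_max_left k j) ≫ prj Y (le_max_right k j))
      obtain ⟨r, hr⟩ := (h.pro.ker (h.pro_tr_prj hY (le_max_right k j))).lift
        (tr X hi ≫ t ≫ tr Y (le_max_left k j)) (by
          rw [Category.assoc, Category.assoc, hs, ← Category.assoc,
            (h.pro.ker (h.pro_tr_prj hX hi)).w, zero_comp])
      refine ⟨i, r, ?_⟩
      rw [← map_tr_fil Y (le_max_right k j), ← Functor.map_comp_assoc, hr, Functor.map_comp,
        Functor.map_comp, Category.assoc, Category.assoc, map_tr_fil, ← ht, ← Category.assoc,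
        map_tr_fil])
  choose t ht using hR
  have ht_tr {i j : ℤ} (hij : i ≤ j) : tr X (φ.monotone hij) ≫ t j = t i ≫ tr Y hij := by
    have := h.mono_fil hY j
    refine (y (Pro A)).map_injective ?_
    rw [← cancel_mono (fil Y j), Functor.map_comp, Functor.map_comp, Category.assoc, Category.assoc,
      ht, map_tr_fil, ht, ← Category.assoc, map_tr_fil]
  -- The maps between terms of the filtrations induce maps between their quotients, which are the
  -- entries of the diagrams.
  have hf {i j : ℤ} (hij : i ≤ j) : ∃ f : X.obj (pair (φ i) (φ j) (φ.monotone hij)) ⟶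
      Y.obj (pair i j hij), prj X (φ.monotone hij) ≫ (cst A).map f = t j ≫ prj Y hij := by
    obtain ⟨f, hf⟩ := (h.pro.cok (h.pro_tr_prj hX (φ.monotone hij))).desc (t j ≫ prj Y hij) (by
      rw [← Category.assoc, ht_tr hij, Category.assoc, (h.pro.ker (h.pro_tr_prj hY hij)).w,
        comp_zero])
    obtain ⟨f, rfl⟩ := (cst A).map_surjective f
    exact ⟨f, hf⟩
  choose f hf using @hf
  have hf_str {i j i' j' : ℤ} (hij : i ≤ j) (hij' : i' ≤ j') (hi : i ≤ i') (hj : j ≤ j') :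
      f hij ≫ str Y hij hij' hi hj = str X (φ.monotone hij) (φ.monotone hij') (φ.monotone hi)
        (φ.monotone hj) ≫ f hij' := by
    have := h.epi_prj hX (φ.monotone hij)
    refine (cst A).map_injective ?_
    rw [← cancel_epi (prj X (φ.monotone hij)), Functor.map_comp, Functor.map_comp,
      ← Category.assoc, hf, Category.assoc, ← tr_prj, ← Category.assoc, ← ht_tr, Category.assoc,
      ← hf, ← Category.assoc, tr_prj X (φ.monotone hij) _ (φ.monotone hi), Category.assoc]
  refine ⟨φ, hφ, hle, fun {W} s r => ?_⟩
  let f' : W ⟶ Y :=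
    { app := fun p => (r.θ p.2).inv ≫ f p.2
      naturality := fun p q u => by
        have hu : p ≤ q := leOfHom u
        have h₁ := r.nat p.2 q.2 hu.1 hu.2
        have h₂ := hf_str p.2 q.2 hu.1 hu.2
        rw [← Iso.eq_inv_comp] at h₁
        calc W.map u ≫ (r.θ q.2).inv ≫ f q.2
            = str W p.2 q.2 hu.1 hu.2 ≫ (r.θ q.2).inv ≫ f q.2 := rfl
          _ = (r.θ p.2).inv ≫ f p.2 ≫ str Y p.2 q.2 hu.1 hu.2 := by simp [h₁, h₂]
          _ = ((r.θ p.2).inv ≫ f p.2) ≫ Y.map u := (Category.assoc _ _ _).symm }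
  refine ⟨f', indProLim_hom_ext fun j => ?_⟩
  obtain ⟨e, he, hes, hep⟩ := h.exists_reindex_lev hX hφ r j
  have hef : e ≫ (levMap f').app ⟨j⟩ = t j := by
    refine lev_hom_ext fun i hi => ?_
    rw [Category.assoc, levMap_prj, ← Category.assoc, hep, Category.assoc, ← Functor.map_comp,
      ← hf hi]
    congr 2
    exact Iso.hom_inv_id_assoc (r.θ hi) _
  rw [← cancel_epi ((y (Pro A)).map e), fil_map, ← Functor.map_comp_assoc, hef, ht,
    ← Category.assoc (fil W j), fil_map, Category.assoc, ← Functor.map_comp_assoc, hes,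
    ← Category.assoc, map_tr_fil]

end Morphisms

/-! ### Calculus of fractions -/

section Fractions

variable {A : Type u} [Category.{v} A] {E : SequenceClass A}

lemma Bicofinal.comp {φ ψ : ℤ →o ℤ} (hφ : Bicofinal φ) (hψ : Bicofinal ψ) :
    Bicofinal (φ.comp ψ) := ⟨hφ.1.comp hψ.1, hφ.2.comp hψ.2⟩

lemma bicofinal_id : Bicofinal OrderHom.id := ⟨Filter.tendsto_id, Filter.tendsto_id⟩

lemma Bicofinal.inf {φ ψ : ℤ →o ℤ} (hφ : Bicofinal φ) (hψ : Bicofinal ψ) :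
    Bicofinal (φ ⊓ ψ) := by
  refine ⟨Filter.tendsto_atTop.2 fun a => ?_,
    Filter.tendsto_atBot_mono (fun i => inf_le_left) hφ.2⟩
  filter_upwards [Filter.tendsto_atTop.1 hφ.1 a, Filter.tendsto_atTop.1 hψ.1 a] with i h₁ h₂
  exact le_inf h₁ h₂

/-- The map `X_φ ⟶ X`. -/
def den (X : AdmDiagram E) {φ : ℤ →o ℤ} (hle : φ ≤ OrderHom.id) : reindex X φ ⟶ X :=
  reindexMap X hle

lemma isIso_den {φ : ℤ →o ℤ} (hφ : Bicofinal φ) (X : AdmDiagram E) (hle : φ ≤ OrderHom.id) :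
    IsIso ((toBeilinson E).map (den X hle)) :=
  (reindexMaps E).Q_inverts _ (IsReindexMap.mk X φ OrderHom.id hφ bicofinal_id hle)

/-- The reindexing of a morphism `X_φ ⟶ Y`. -/
def reindexHom {X Y : AdmDiagram E} {φ : ℤ →o ℤ} (f : reindex X φ ⟶ Y) (ψ : ℤ →o ℤ) :
    reindex X (φ.comp ψ) ⟶ reindex Y ψ :=
  ObjectProperty.homMk (Functor.whiskerLeft (tilde ψ) f.hom)

/-- The Ore square used to compose fractions; it is the naturality of `f`. -/
lemma reindexMap_comp_eq {X Y : AdmDiagram E} {φ ψ : ℤ →o ℤ} (f : reindex X φ ⟶ Y)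
    (hψ : ψ ≤ OrderHom.id) (hle : φ.comp ψ ≤ φ) :
    reindexMap X hle ≫ f = reindexHom f ψ ≫ den Y hψ := by
  ext p
  exact f.hom.naturality ((tildeMap hψ).app p)

lemma reindexMap_den (X : AdmDiagram E) {φ ψ : ℤ →o ℤ} (h₁ : φ ≤ ψ) (h₂ : ψ ≤ OrderHom.id) :
    reindexMap X h₁ ≫ den X h₂ = den X (h₁.trans h₂) := by
  ext p
  exact (X.obj.map_comp _ _).symm

lemma reindexMap_comp (X : AdmDiagram E) {φ ψ χ : ℤ →o ℤ} (h₁ : φ ≤ ψ) (h₂ : ψ ≤ χ) :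
    reindexMap X h₁ ≫ reindexMap X h₂ = reindexMap X (h₁.trans h₂) := by
  ext p
  exact (X.obj.map_comp _ _).symm

/-- A morphism of the Beilinson category is a fraction if it is of the form
`X ⟵ X_φ ⟶ Y`. -/
def IsFraction {X Y : AdmDiagram E} (a : (toBeilinson E).obj X ⟶ (toBeilinson E).obj Y) : Prop :=
  ∃ (φ : ℤ →o ℤ) (_ : Bicofinal φ) (hle : φ ≤ OrderHom.id) (f : reindex X φ ⟶ Y),
    (toBeilinson E).map (den X hle) ≫ a = (toBeilinson E).map f

lemma IsFraction.comp {X Y Z : AdmDiagram E} {a : (toBeilinson E).obj X ⟶ (toBeilinson E).obj Y}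
    {b : (toBeilinson E).obj Y ⟶ (toBeilinson E).obj Z} (ha : IsFraction a) (hb : IsFraction b) :
    IsFraction (a ≫ b) := by
  obtain ⟨φ, hφ, hφ', f, hf⟩ := ha
  obtain ⟨ψ, hψ, hψ', g, hg⟩ := hb
  have hle : φ.comp ψ ≤ φ := fun i => φ.monotone (hψ' i)
  refine ⟨φ.comp ψ, hφ.comp hψ, hle.trans hφ', reindexHom f ψ ≫ g, ?_⟩
  rw [Functor.map_comp, ← hg, ← Functor.map_comp_assoc, ← reindexMap_comp_eq f hψ' hle,
    Functor.map_comp_assoc, ← hf, ← reindexMap_den X hle hφ', Functor.map_comp_assoc,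
    Category.assoc]

lemma isFraction_map {X Y : AdmDiagram E} (f : X ⟶ Y) : IsFraction ((toBeilinson E).map f) :=
  ⟨OrderHom.id, bicofinal_id, le_rfl, den X le_rfl ≫ f, (Functor.map_comp _ _ _).symm⟩

/-- With `ψ ∘ χ ≤ φ`, the map `X_{ψχ} ⟶ X_φ` followed by `X_φ ⟶ X_ψ` is the denominator of `X_ψ`
given by `χ`, so the former is a numerator for the inverse of the latter. -/
lemma isFraction_wInv {X Y : AdmDiagram E} (w : X ⟶ Y) (hw : reindexMaps E w) :
    IsFraction (Localization.Construction.wInv w hw) := by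
  have hw' := hw
  obtain ⟨X, φ, ψ, hφ, hψ, hle⟩ := hw'
  obtain ⟨χ, hχ, hχ', hR⟩ := exists_bicofinal (fun a j => ψ a ≤ φ j)
    (fun ha hj hR => (ψ.monotone ha).trans (hR.trans (φ.monotone hj)))
    (fun a => (Filter.tendsto_atTop.1 hφ.1 (ψ a)).exists)
    (fun j => (Filter.tendsto_atBot.1 hψ.2 (φ j)).exists)
  have h₂ : ψ.comp χ ≤ φ := hR
  refine ⟨χ, hχ, hχ', reindexMap X h₂, ?_⟩
  have e : (toBeilinson E).map (reindexMap X h₂) ≫ (toBeilinson E).map (reindexMap X hle) =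
      (toBeilinson E).map (reindexMap X (h₂.trans hle)) := by
    rw [← Functor.map_comp, reindexMap_comp]
  have e' := congrArg (· ≫ Localization.Construction.wInv _ hw) e
  refine e'.symm.trans ((Category.assoc _ _ _).trans ?_)
  exact (congrArg _ (Localization.Construction.wIso _ hw).hom_inv_id).trans (Category.comp_id _)

lemma isFraction {X Y : AdmDiagram E} (a : (toBeilinson E).obj X ⟶ (toBeilinson E).obj Y) :
    IsFraction a := by
  let P : MorphismProperty (BeilinsonCategory E) := fun U V a =>
    IsFraction (X := (Localization.Construction.objEquiv _).symm U)
      (Y := (Localization.Construction.objEquiv _).symm V) a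
  have : P.IsStableUnderComposition := ⟨fun _ _ ha hb => IsFraction.comp ha hb⟩
  have hP : P = ⊤ := Localization.Construction.morphismProperty_eq_top P
    (fun _ _ f => isFraction_map f) (fun _ _ w hw => isFraction_wInv w hw)
  have : P a := by rw [hP]; trivial
  exact this

variable [Preadditive A] (h : IsExactCore A E) (ι : BeilinsonCategory E ⥤ IndPro A)
  (e : toBeilinson E ⋙ ι ≅ (admissible E).ι ⋙ indProLim A)

omit [Preadditive A] in
include e in
lemma map_toBeilinson_eq_iff {X Y : AdmDiagram E} (f : X ⟶ Y)
    (b : ι.obj ((toBeilinson E).obj X) ⟶ ι.obj ((toBeilinson E).obj Y)) :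
    ι.map ((toBeilinson E).map f) = b ↔
      (indProLim A).map f.hom = e.inv.app X ≫ b ≫ e.hom.app Y := by
  have := NatIso.naturality_1 e f
  dsimp only [Functor.comp_obj, Functor.comp_map, ObjectProperty.ι_obj, ObjectProperty.ι_map] at this
  rw [← this]
  exact ⟨fun hb => by rw [hb], fun hb =>
    (cancel_mono (e.hom.app Y)).1 ((cancel_epi (e.inv.app X)).1 hb)⟩

include h e

/-- Two fractions are brought to the common denominator `φ ⊓ ψ`. Their numerators then have the same
image in `Ind Pro(A)`, hence coincide as morphisms of diagrams. -/
lemma IsExactCore.faithful_of_iso : ι.Faithful where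
  map_injective {U V a b} hab := by
    suffices H : ∀ {X Y : AdmDiagram E} (a b : (toBeilinson E).obj X ⟶ (toBeilinson E).obj Y),
        ι.map a = ι.map b → a = b from
      H (X := (Localization.Construction.objEquiv _).symm U)
        (Y := (Localization.Construction.objEquiv _).symm V) a b hab
    clear hab a b U V
    intro X Y a b hab
    obtain ⟨φ, hφ, hφ', f, hf⟩ := isFraction a
    obtain ⟨ψ, hψ, hψ', g, hg⟩ := isFraction b
    have hle : φ ⊓ ψ ≤ OrderHom.id := inf_le_left.trans hφ'
    have hf' : (toBeilinson E).map (den X hle) ≫ a =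
        (toBeilinson E).map (reindexMap X (inf_le_left : φ ⊓ ψ ≤ φ) ≫ f) := by
      rw [Functor.map_comp, ← hf, ← Functor.map_comp_assoc, reindexMap_den]
    have hg' : (toBeilinson E).map (den X hle) ≫ b =
        (toBeilinson E).map (reindexMap X (inf_le_right : φ ⊓ ψ ≤ ψ) ≫ g) := by
      rw [Functor.map_comp, ← hg, ← Functor.map_comp_assoc, reindexMap_den]
    have := isIso_den (hφ.inf hψ) X hle
    rw [← cancel_epi ((toBeilinson E).map (den X hle)), hf', hg']
    congr 1
    refine ObjectProperty.hom_ext _ (h.indProLim_map_injective (reindex X _).property Y.property ?_)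
    rw [(map_toBeilinson_eq_iff ι e _ _).1 rfl, (map_toBeilinson_eq_iff ι e _ _).1 rfl, ← hf', ← hg',
      Functor.map_comp, Functor.map_comp, hab]

lemma IsExactCore.full_of_iso : ι.Full where
  map_surjective {U V} b := by
    suffices H : ∀ {X Y : AdmDiagram E}
        (b : ι.obj ((toBeilinson E).obj X) ⟶ ι.obj ((toBeilinson E).obj Y)),
        ∃ a : (toBeilinson E).obj X ⟶ (toBeilinson E).obj Y, ι.map a = b from
      H (X := (Localization.Construction.objEquiv _).symm U)
        (Y := (Localization.Construction.objEquiv _).symm V) b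
    clear b U V
    intro X Y b
    obtain ⟨φ, hφ, hle, hf⟩ := h.exists_indProLim_map_eq X.property Y.property
      (e.inv.app X ≫ b ≫ e.hom.app Y)
    obtain ⟨f, hf⟩ := hf (den X hle).hom (reindexing X (φ := OrderHom.id) hle rfl hle)
    have := isIso_den hφ X hle
    refine ⟨inv ((toBeilinson E).map (den X hle)) ≫
      (toBeilinson E).map (ObjectProperty.homMk f : reindex X φ ⟶ Y), ?_⟩
    rw [Functor.map_comp, ← cancel_epi (ι.map ((toBeilinson E).map (den X hle))),
      ← Functor.map_comp_assoc, IsIso.hom_inv_id, CategoryTheory.Functor.map_id, Category.id_comp,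
      map_toBeilinson_eq_iff ι e]
    refine hf.symm.trans ?_
    rw [(map_toBeilinson_eq_iff ι e (den X hle) _).1 rfl]
    simp

omit h in
lemma additive_toBeilinson [Preadditive (BeilinsonCategory E)] [ι.Additive] [ι.Faithful] :
    (toBeilinson E).Additive where
  map_add {X Y f g} := by
    refine ι.map_injective ?_
    rw [map_toBeilinson_eq_iff ι e, Functor.map_add, Preadditive.add_comp, Preadditive.comp_add,
      ← (map_toBeilinson_eq_iff ι e f _).1 rfl, ← (map_toBeilinson_eq_iff ι e g _).1 rfl,
      ← Functor.map_add]
    rfl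

open scoped ZeroObject in
omit ι e in
lemma IsExactCore.hasZeroObject_admDiagram : HasZeroObject (AdmDiagram E) := by
  have := h.hasFiniteBiproducts
  have : HasZeroObject A := hasZeroObject_of_hasFiniteBiproducts A
  let Z : AdmDiagram E := ⟨(Functor.const Pairs).obj 0, fun i j k hij hjk =>
    h.split _ 0 0 _ ((isZero_zero A).eq_of_src _ _) ((isZero_zero A).eq_of_src _ _)
      ((isZero_zero A).eq_of_src _ _) ((isZero_zero A).eq_of_src _ _)
      ((isZero_zero A).eq_of_src _ _)⟩
  exact ⟨Z, ⟨fun Y => ⟨⟨⟨0⟩, fun f => by ext p; exact (isZero_zero A).eq_of_src _ _⟩⟩,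
    fun Y => ⟨⟨⟨0⟩, fun f => by ext p; exact (isZero_zero A).eq_of_tgt _ _⟩⟩⟩⟩

omit ι e in
lemma IsExactCore.hasZeroObject_beilinson [Preadditive (BeilinsonCategory E)]
    [(toBeilinson E).Additive] : HasZeroObject (BeilinsonCategory E) := by
  have := h.hasZeroObject_admDiagram
  exact ⟨_, (toBeilinson E).map_isZero (isZero_zero (AdmDiagram E))⟩

end Fractions

/-! ### Extensions of ind-objects -/

section Extensions

variable {C : Type u} [Category.{v} C] [Preadditive C] {S : SequenceClass C}

namespace IsExactCore

variable (h : IsExactCore C S)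
include h

/-- In an admissible sequence `X ⟶ Y ⟶ Z` of ind-objects, an element `ζ` of `Z` lifts to an
extension of its domain by a term of any given exhaustive family of elements of `X`, and the
extension may be chosen to contain a given element of `Y` over `ζ`. -/
lemma exists_extension {X Y Z : Ind C} {f : X ⟶ Y} {g : Y ⟶ Z} (hfg : S.ind f g) {c d : C}
    (ζ : (y C).obj c ⟶ Z) (s : d ⟶ c) (t : (y C).obj d ⟶ Y) (ht : t ≫ g = (y C).map s ≫ ζ)
    {K : Type*} (x : K → C) (ξ : ∀ k, (y C).obj (x k) ⟶ X)
    (hξ : ∀ (n : C) (r : (y C).obj n ⟶ X), ∃ (k : K) (a : n ⟶ x k), r = (y C).map a ≫ ξ k) :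
    ∃ (k : K) (D : C) (i : x k ⟶ D) (q : D ⟶ c) (m : (y C).obj D ⟶ Y) (t' : d ⟶ D),
      S i q ∧ (y C).map i ≫ m = ξ k ≫ f ∧ m ≫ g = (y C).map q ≫ ζ ∧ (y C).map t' ≫ m = t := by
  have hE := h.elemExact hfg
  have := h.hasBinaryBiproducts
  obtain ⟨d₁, e, t₁, he, ht₁⟩ := hE.localEpi c ζ
  -- The given `d` and a local lift `d₁` of `ζ` together cover `c`. The kernel `N` of this cover
  -- maps to `X` through some `x k`, and the pushout of `N ⟶ d ⊞ d₁` to `x k` is the extension `D`.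
  obtain ⟨N, n, hn⟩ := h.admissibleEpi_biprodDesc s he
  let T : (y C).obj (d ⊞ d₁) ⟶ Y := (y C).map biprod.fst ≫ t + (y C).map biprod.snd ≫ t₁
  have hT : T ≫ g = (y C).map (biprod.desc s e) ≫ ζ := by
    simp only [T, Preadditive.add_comp, Category.assoc, ht, ht₁, biprod.desc_eq, Functor.map_add,
      Functor.map_comp]
  obtain ⟨r, hr⟩ := hE.exact ((y C).map n ≫ T) (by
    rw [Category.assoc, hT, ← Functor.map_comp_assoc, (h.ker hn).w, Functor.map_zero, zero_comp])
  obtain ⟨k, a, rfl⟩ := hξ N r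
  obtain ⟨D, i, b, q, hP, hiq, hbq⟩ := h.exists_pushout hn a
  -- The square remains a pushout among ind-objects, which allows gluing maps to `Y`.
  have hP' : IsPushout ((y C).map n) ((y C).map a) ((y C).map b) ((y C).map i) :=
    h.ind.isPushout_of_admissible (h.ind_map hn) (h.ind_map hiq)
      (by rw [← Functor.map_comp, hP.w, Functor.map_comp]) (by rw [← Functor.map_comp, hbq])
  let m : (y C).obj D ⟶ Y := hP'.desc T (ξ k ≫ f) (by rw [← hr, Category.assoc])
  have hbm : (y C).map b ≫ m = T := hP'.inl_desc _ _ _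
  have him : (y C).map i ≫ m = ξ k ≫ f := hP'.inr_desc _ _ _
  refine ⟨k, D, i, q, m, biprod.inl ≫ b, hiq, him, hP'.hom_ext ?_ ?_, ?_⟩
  · rw [← Category.assoc, hbm, hT, ← Category.assoc, ← Functor.map_comp, hbq]
  · rw [← Category.assoc, him, Category.assoc, hE.w, comp_zero, ← Category.assoc,
      ← Functor.map_comp, (h.ker hiq).w, Functor.map_zero, zero_comp]
  · rw [Functor.map_comp, Category.assoc, hbm]
    simp [T, ← Functor.map_comp_assoc]

/-- `C` is closed under extensions in `Ind C`. -/
lemma exists_iso_of_ind {a c : C} {Y : Ind C} {f : (y C).obj a ⟶ Y} {g : Y ⟶ (y C).obj c}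
    (hfg : S.ind f g) : ∃ b : C, Nonempty ((y C).obj b ≅ Y) := by
  have := h.hasFiniteBiproducts
  have : HasZeroObject C := hasZeroObject_of_hasFiniteBiproducts C
  obtain ⟨-, D, i, q, m, -, hiq, h₁, h₂, -⟩ := open ZeroObject in
    h.exists_extension hfg (𝟙 _) (0 : 0 ⟶ c) 0 (by simp)
      (fun _ : Unit => a) (fun _ => 𝟙 _) (fun n r => by
        obtain ⟨r, rfl⟩ := (y C).map_surjective r
        exact ⟨(), r, (Category.comp_id _).symm⟩)
  have : IsIso m := h.ind.isIso_middle (a := 𝟙 _) (c := 𝟙 _) (h.ind_map hiq) hfg h₁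
    (by simpa using h₂.symm)
  exact ⟨D, ⟨asIso m⟩⟩

lemma exists_iso_of_pro {a c : C} {P : Pro C} {f : (cst C).obj a ⟶ P} {g : P ⟶ (cst C).obj c}
    (hfg : S.pro f g) : ∃ b : C, Nonempty (P ≅ (cst C).obj b) := by
  obtain ⟨b, ⟨e⟩⟩ := h.op.exists_iso_of_ind (f := g.unop) (g := f.unop) hfg
  exact ⟨b.unop, ⟨e.op⟩⟩

/-- In an admissible sequence `P ⟶ Q ⟶ R` of pro-objects, a map from `P` to an object of `C`
extends to a map from `Q` to an extension by a term of any given exhaustive family of quotients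
of `R`. -/
lemma exists_coextension {P Q R : Pro C} {f : P ⟶ Q} {g : Q ⟶ R} (hfg : S.pro f g) {c : C}
    (ζ : P ⟶ (cst C).obj c) {K : Type*} (x : K → C) (ξ : ∀ k, R ⟶ (cst C).obj (x k))
    (hξ : ∀ (n : C) (r : R ⟶ (cst C).obj n), ∃ (k : K) (a : x k ⟶ n), r = ξ k ≫ (cst C).map a) :
    ∃ (k : K) (D : C) (i : c ⟶ D) (q : D ⟶ x k) (m : Q ⟶ (cst C).obj D),
      S i q ∧ f ≫ m = ζ ≫ (cst C).map i ∧ m ≫ (cst C).map q = g ≫ ξ k := by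
  have := h.op.hasFiniteBiproducts
  have : HasZeroObject Cᵒᵖ := hasZeroObject_of_hasFiniteBiproducts Cᵒᵖ
  obtain ⟨k, D, i, q, m, -, hiq, h₁, h₂, -⟩ := open ZeroObject in
    h.op.exists_extension (f := g.unop) (g := f.unop) hfg (c := Opposite.op c) (d := 0) ζ.unop 0 0
      (by rw [zero_comp, Functor.map_zero]; exact zero_comp.symm) (fun k => Opposite.op (x k)) (fun k => (ξ k).unop) (fun n r => by
        obtain ⟨k, a, ha⟩ := hξ n.unop r.op
        exact ⟨k, a.op, Quiver.Hom.op_inj ha⟩)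
  exact ⟨k, D.unop, q.unop, i.unop, m.op, hiq, Quiver.Hom.unop_inj h₂, Quiver.Hom.unop_inj h₁⟩

end IsExactCore

end Extensions

/-! ### Chains of pro-objects -/

/-- A relation that can be continued in both directions contains a chain indexed by `ℤ`. -/
lemma exists_int_chain {α : Type*} [Nonempty α] (R : α → α → Prop) (h₁ : ∀ a, ∃ b, R a b)
    (h₂ : ∀ b, ∃ a, R a b) : ∃ c : ℤ → α, ∀ n, R (c n) (c (n + 1)) := by
  choose up hup using h₁
  choose down hdown using h₂
  obtain ⟨a⟩ := ‹Nonempty α›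
  let c : ℤ → α := fun n => Int.casesOn n (fun n => up^[n] a) (fun n => down^[n + 1] a)
  refine ⟨c, fun n => ?_⟩
  match n with
  | .ofNat n =>
    change R (up^[n] a) (up^[n + 1] a)
    rw [Function.iterate_succ_apply']
    exact hup _
  | .negSucc 0 => exact hdown a
  | .negSucc (n + 1) =>
    change R (down^[n + 2] a) (down^[n + 1] a)
    rw [Function.iterate_succ_apply']
    exact hdown _

lemma sub_le_of_strictMono {k : ℤ → ℤ} (hk : StrictMono k) {i j : ℤ} (hij : i ≤ j) :
    j - i ≤ k j - k i := by
  have : Monotone fun n => k n - n := monotone_int_of_le_succ fun n => by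
    have := hk (lt_add_one n)
    lia
  have := this hij
  simp only at this
  lia

lemma exists_le_of_strictMono {k : ℤ → ℤ} (hk : StrictMono k) (b i : ℤ) :
    ∃ j, i ≤ j ∧ b ≤ k j :=
  ⟨max i (i + b - k i), le_max_left _ _, by
    have := sub_le_of_strictMono hk (le_max_left i (i + b - k i))
    lia⟩

lemma exists_ge_of_strictMono {k : ℤ → ℤ} (hk : StrictMono k) (b i : ℤ) :
    ∃ j, j ≤ i ∧ k j ≤ b :=
  ⟨min i (i + b - k i), min_le_left _ _, by
    have := sub_le_of_strictMono hk (min_le_left i (i + b - k i))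
    lia⟩

lemma map_homOfLE_self {D : Type*} [Category* D] (P : ℤ ⥤ D) {j : ℤ} (hj : j ≤ j) :
    P.map (homOfLE hj) = 𝟙 _ := P.map_id j

section Chain

variable {A : Type u} [Category.{v} A] [Preadditive A] {E : SequenceClass A}
  (h : IsExactCore A E) (P : ℤ ⥤ Pro A)
include h

/-- The successive quotients of a chain of pro-objects form an admissible diagram. -/
lemma IsExactCore.exists_quotient_diagram
    (hP : ∀ {i j : ℤ} (hij : i ≤ j), ∃ (a : A) (r : P.obj j ⟶ (cst A).obj a),
      E.pro (P.map (homOfLE hij)) r) :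
    ∃ (W : Pairs ⥤ A) (r : ∀ {i j : ℤ} (hij : i ≤ j),
      P.obj j ⟶ (cst A).obj (W.obj (pair i j hij))), admissible E W ∧
      (∀ {i j : ℤ} (hij : i ≤ j), E.pro (P.map (homOfLE hij)) (r hij)) ∧
      ∀ {i j i' j' : ℤ} (hij : i ≤ j) (hij' : i' ≤ j') (hi : i ≤ i') (hj : j ≤ j'),
        r hij ≫ (cst A).map (str W hij hij' hi hj) = P.map (homOfLE hj) ≫ r hij' := by
  choose a r hr using @hP
  have hepi {i j : ℤ} (hij : i ≤ j) : Epi (r hij) := (h.pro.cok (hr hij)).epi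
  have hmap (p q : Pairs) (hpq : p ≤ q) : ∃ s : a p.2 ⟶ a q.2,
      r p.2 ≫ (cst A).map s = P.map (homOfLE hpq.2) ≫ r q.2 := by
    obtain ⟨s, hs⟩ := (h.pro.cok (hr p.2)).desc (P.map (homOfLE hpq.2) ≫ r q.2) (by
      rw [← Category.assoc, ← P.map_comp, homOfLE_comp, ← homOfLE_comp hpq.1 q.2, P.map_comp,
        Category.assoc, (h.pro.cok (hr q.2)).w, comp_zero])
    obtain ⟨s, rfl⟩ := (cst A).map_surjective s
    exact ⟨s, hs⟩
  choose s hs using hmap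
  let W : Pairs ⥤ A :=
    { obj := fun p => a p.2
      map := fun {p q} u => s p q (leOfHom u)
      map_id := fun p => by
        have := hepi p.2
        refine (cst A).map_injective ?_
        rw [← cancel_epi (r p.2), hs, CategoryTheory.Functor.map_id, map_homOfLE_self,
          Category.id_comp, Category.comp_id]
      map_comp := fun {p q q'} u u' => by
        have := hepi p.2
        refine (cst A).map_injective ?_
        rw [← cancel_epi (r p.2), hs, Functor.map_comp, ← Category.assoc, hs, Category.assoc, hs,
          ← Category.assoc, ← P.map_comp, homOfLE_comp] }
  have hW {i j i' j' : ℤ} (hij : i ≤ j) (hij' : i' ≤ j') (hi : i ≤ i') (hj : j ≤ j') :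
      r hij ≫ (cst A).map (str W hij hij' hi hj) = P.map (homOfLE hj) ≫ r hij' :=
    hs (pair i j hij) (pair i' j' hij') ⟨hi, hj⟩
  refine ⟨W, r, fun i j k hij hjk => h.of_pro ?_, hr, hW⟩
  refine h.pro.quotients (f := P.map (homOfLE hij)) (g := P.map (homOfLE hjk)) (r := r _)
    (hr hij) (hr hjk) ?_ (hW _ _ _ _) ?_
  · rw [← P.map_comp, homOfLE_comp]
    exact hr _
  · refine (hW _ _ _ _).trans ?_
    rw [map_homOfLE_self, Category.id_comp]

/-- A separated chain of pro-objects whose quotients belong to `A` comes from an admissible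
diagram. -/
lemma IsExactCore.exists_iso_levObj
    (hP : ∀ {i j : ℤ} (hij : i ≤ j), ∃ (a : A) (r : P.obj j ⟶ (cst A).obj a),
      E.pro (P.map (homOfLE hij)) r)
    (hP' : ∀ (j : ℤ) (a : A) (t : P.obj j ⟶ (cst A).obj a),
      ∃ (i : ℤ) (hij : i ≤ j), P.map (homOfLE hij) ≫ t = 0) :
    ∃ (W : Pairs ⥤ A) (e : ∀ j, P.obj j ≅ levObj W j), admissible E W ∧
      ∀ {i j : ℤ} (hij : i ≤ j), P.map (homOfLE hij) ≫ (e j).hom = (e i).hom ≫ tr W hij := by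
  obtain ⟨W, r, hW, hr, hr'⟩ := h.exists_quotient_diagram P hP
  have he (j : ℤ) : ∃ e : P.obj j ⟶ levObj W j, ∀ (i : ℤ) (hij : i ≤ j), e ≫ prj W hij = r hij :=
    exists_lev_lift (fun i hij => r hij) fun i i' hi hi' hii' => by
      rw [hr', map_homOfLE_self, Category.id_comp]
  choose e he using he
  have hiso (j : ℤ) : IsIso (e j) := by
    refine pro_isIso _ (fun a s t hst => ?_) (fun a t => ?_)
    · rw [← sub_eq_zero, ← Preadditive.comp_sub] at hst
      rw [← sub_eq_zero]
      obtain ⟨i, hi, q, hq⟩ := exists_fac_prj (s - t)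
      have := (h.pro.cok (hr hi)).epi
      rw [hq, ← Category.assoc, he] at hst
      rw [hq, zero_of_epi_comp _ hst, comp_zero]
    -- By separatedness `t` vanishes on an earlier term, hence factors through a quotient.
    · obtain ⟨i, hij, ht⟩ := hP' j a t
      obtain ⟨q, hq⟩ := (h.pro.cok (hr hij)).desc t ht
      exact ⟨prj W hij ≫ q, by rw [← Category.assoc, he, hq]⟩
  refine ⟨W, fun j => asIso (e j), hW, fun {i j} hij => lev_hom_ext fun m hm => ?_⟩
  rw [asIso_hom, asIso_hom, Category.assoc, he, Category.assoc,
    tr_prj W (min_le_right m i) hm (min_le_left m i) hij, ← Category.assoc, he, hr']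

/-- The chain is the filtration of a diagram. The comparison map with `Y` is injective on elements
since the `m j` are monomorphisms, and surjective since they exhaust `Y`. -/
lemma IsExactCore.exists_iso_indProLim
    (hP : ∀ {i j : ℤ} (hij : i ≤ j), ∃ (a : A) (r : P.obj j ⟶ (cst A).obj a),
      E.pro (P.map (homOfLE hij)) r)
    (hP' : ∀ (j : ℤ) (a : A) (t : P.obj j ⟶ (cst A).obj a),
      ∃ (i : ℤ) (hij : i ≤ j), P.map (homOfLE hij) ≫ t = 0)
    {Y : IndPro A} (m : ∀ j, (y (Pro A)).obj (P.obj j) ⟶ Y) (hm : ∀ j, Mono (m j))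
    (hm_map : ∀ {i j : ℤ} (hij : i ≤ j), (y (Pro A)).map (P.map (homOfLE hij)) ≫ m j = m i)
    (hm' : ∀ (Q : Pro A) (t : (y (Pro A)).obj Q ⟶ Y), ∃ (j : ℤ) (s : Q ⟶ P.obj j),
      t = (y (Pro A)).map s ≫ m j) :
    ∃ W : Pairs ⥤ A, admissible E W ∧ Nonempty ((indProLim A).obj W ≅ Y) := by
  obtain ⟨W, e, hW, he⟩ := h.exists_iso_levObj P hP hP'
  let τ (j : ULift.{v} ℤ) : (y (Pro A)).obj ((lev W).obj j) ⟶ Y :=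
    (y (Pro A)).map (e j.down).inv ≫ m j.down
  have hτ {i j : ULift.{v} ℤ} (s : i ⟶ j) : (y (Pro A)).map ((lev W).map s) ≫ τ j = τ i := by
    have hij : i.down ≤ j.down := (leOfHom s : i ≤ j)
    have hs : (lev W).map s ≫ (e j.down).inv = (e i.down).inv ≫ P.map (homOfLE hij) := by
      rw [Iso.comp_inv_eq, Category.assoc, he, Iso.inv_hom_id_assoc]
      rfl
    simp only [τ]
    rw [← Functor.map_comp_assoc, hs, Functor.map_comp_assoc, hm_map]
  have : IsIso (limDesc τ hτ) := by
    refine isIso_limDesc τ hτ (fun Q j a b hab => ⟨j, 𝟙 j, ?_⟩) (fun Q t => ?_)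
    · have := hm j.down
      rw [(y (Pro A)).map_injective ((cancel_mono (τ j)).1 hab)]
    · obtain ⟨j, s, rfl⟩ := hm' Q t
      exact ⟨⟨j⟩, s ≫ (e j).hom, by simp [τ, ← Functor.map_comp_assoc]⟩
  let e' : (Ind.lim (ULift.{v} ℤ)).obj (lev W) ≅ Y := asIso (limDesc τ hτ)
  exact ⟨W, hW, ⟨e'⟩⟩

end Chain

/-! ### Extensions of objects of the Beilinson category -/

section Lattice

variable {A : Type u} [Category.{v} A] [Preadditive A] {E : SequenceClass A}

variable (E) in
/-- A pro-object in the middle term of a sequence `L X ⟶ Y ⟶ L Z`, which is an extension of a term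
of the filtration of `L Z` by a term of the filtration of `L X`. -/
structure Lattice {X Z : Pairs ⥤ A} {Y : IndPro A} (f : (indProLim A).obj X ⟶ Y)
    (g : Y ⟶ (indProLim A).obj Z) where
  /-- the index of the subobject -/
  k : ℤ
  /-- the index of the quotient -/
  l : ℤ
  /-- the pro-object -/
  obj : Pro A
  /-- the inclusion of the subobject -/
  i : levObj X k ⟶ obj
  /-- the projection to the quotient -/
  q : obj ⟶ levObj Z l
  /-- the map to `Y` -/
  m : (y (Pro A)).obj obj ⟶ Y
  exact : E.pro i q
  i_m : (y (Pro A)).map i ≫ m = fil X k ≫ f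
  m_g : m ≫ g = (y (Pro A)).map q ≫ fil Z l

namespace Lattice

variable {X Z : Pairs ⥤ A} {Y : IndPro A} {f : (indProLim A).obj X ⟶ Y}
  {g : Y ⟶ (indProLim A).obj Z}

/-- Strict inclusion of lattices. -/
def Lt (a b : Lattice E f g) : Prop :=
  a.k < b.k ∧ a.l < b.l ∧ ∃ u : a.obj ⟶ b.obj, (y (Pro A)).map u ≫ b.m = a.m

omit [Preadditive A] in
lemma Lt.trans {a b c : Lattice E f g} (hab : Lt a b) (hbc : Lt b c) : Lt a c := by
  obtain ⟨h₁, h₂, u, hu⟩ := hab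
  obtain ⟨h₃, h₄, w, hw⟩ := hbc
  exact ⟨h₁.trans h₃, h₂.trans h₄, u ≫ w, by rw [Functor.map_comp, Category.assoc, hw, hu]⟩

variable (h : IsExactCore A E) (hX : admissible E X) (hZ : admissible E Z)
  (hfg : E.pro.ind f g)
include h hX hZ hfg

/-- The outer components `fil X a.k` and `fil Z a.l` are monomorphisms, hence so is the middle one.
-/
lemma mono_m (a : Lattice E f g) : Mono a.m := by
  have := h.mono_fil hX a.k
  have := h.mono_fil hZ a.l
  exact h.pro.ind.mono_of_mono (h.pro.ind_map a.exact) hfg a.i_m a.m_g.symm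

lemma i_comp {a b : Lattice E f g} (hk : a.k ≤ b.k) {u : a.obj ⟶ b.obj}
    (hu : (y (Pro A)).map u ≫ b.m = a.m) : a.i ≫ u = tr X hk ≫ b.i := by
  have := b.mono_m h hX hZ hfg
  refine (y (Pro A)).map_injective ?_
  rw [← cancel_mono b.m, Functor.map_comp, Functor.map_comp, Category.assoc, Category.assoc, hu,
    i_m, i_m, ← Category.assoc, map_tr_fil]

omit h hX hfg in
lemma comp_q (h : IsExactCore A E) {a b : Lattice E f g} (hl : a.l ≤ b.l) {u : a.obj ⟶ b.obj}
    (hu : (y (Pro A)).map u ≫ b.m = a.m) : a.q ≫ tr Z hl = u ≫ b.q := by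
  have := h.mono_fil hZ b.l
  refine (y (Pro A)).map_injective ?_
  rw [← cancel_mono (fil Z b.l), Functor.map_comp, Functor.map_comp, Category.assoc,
    Category.assoc, map_tr_fil, ← m_g, ← m_g, ← hu, Category.assoc]

/-- The quotient is an extension of an entry of `Z` by an entry of `X`, and `A` is closed under
extensions in `Pro(A)`. -/
lemma exists_quotient {a b : Lattice E f g} (hk : a.k ≤ b.k) (hl : a.l ≤ b.l) {u : a.obj ⟶ b.obj}
    (hu : (y (Pro A)).map u ≫ b.m = a.m) :
    ∃ (c : A) (r : b.obj ⟶ (cst A).obj c), E.pro u r := by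
  obtain ⟨Q, r, s, w, hr, hsw, -, -⟩ := h.pro.exists_middle_quotient a.exact b.exact
    (i_comp h hX hZ hfg hk hu) (comp_q hZ h hl hu) (h.pro_tr_prj hX hk) (h.pro_tr_prj hZ hl)
  obtain ⟨c, ⟨e⟩⟩ := h.exists_iso_of_pro hsw
  exact ⟨c, r ≫ e.hom, h.pro.of_iso ⟨Iso.refl _, Iso.refl _, e, by simp, by simp⟩ hr⟩

omit hX hZ in
lemma nonempty : Nonempty (Lattice E f g) := by
  have := h.pro.hasFiniteBiproducts
  have : HasZeroObject (Pro A) := hasZeroObject_of_hasFiniteBiproducts (Pro A)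
  obtain ⟨k, D, i, q, m, -, hiq, h₁, h₂, -⟩ := open ZeroObject in
    h.pro.exists_extension hfg (fil Z 0) (d := 0) 0 0 (by simp) (levObj X) (fil X)
      (fun n r => exists_fac_fil r)
  exact ⟨⟨k, 0, D, i, q, m, hiq, h₁, h₂⟩⟩

-- The new lattice is an extension of the next term of `Z` chosen to contain `a`. Allowing only
-- terms of `X` of index above `a.k` keeps the family exhaustive and makes the inclusion strict.
omit hX hZ in
lemma exists_gt (a : Lattice E f g) : ∃ b, Lt a b := by
  obtain ⟨k, D, i, q, m, u, hiq, h₁, h₂, hu⟩ := h.pro.exists_extension hfg (fil Z (a.l + 1))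
    (a.q ≫ tr Z (le_add_of_nonneg_right zero_le_one)) a.m
    (by rw [a.m_g, Functor.map_comp, Category.assoc, map_tr_fil])
    (fun k : {k : ℤ // a.k < k} => levObj X k) (fun k => fil X k) (fun n r => by
      obtain ⟨k, s, rfl⟩ := exists_fac_fil r
      refine ⟨⟨max k (a.k + 1), by lia⟩, s ≫ tr X (le_max_left _ _), ?_⟩
      rw [Functor.map_comp, Category.assoc, map_tr_fil])
  exact ⟨⟨k, a.l + 1, D, i, q, m, hiq, h₁, h₂⟩, k.2, lt_add_one _, u, hu⟩

-- The quotient map `X_k ⟶ X_{k-1,k}` extends to a map from `a.obj` to an extension, in `A`, of some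
-- `Z_{n,l}` by `X_{k-1,k}`. The kernel of that map is an extension of `Z_n` by `X_{k-1}`.
omit hfg in
lemma exists_lt (a : Lattice E f g) : ∃ b, Lt b a := by
  have hk : a.k - 1 ≤ a.k := by lia
  obtain ⟨⟨n, hn, hn'⟩, D, i, q, m, hiq, h₁, h₂⟩ := h.exists_coextension a.exact (prj X hk)
    (fun n : {n : ℤ // n < a.l ∧ n ≤ a.l} => Z.obj (pair n.1 a.l n.2.2))
    (fun n => prj Z n.2.2) (fun c r => by
      obtain ⟨n, hn, hn', s, hs⟩ := exists_fac_prj_le r (a.l - 1)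
      exact ⟨⟨n, by lia, hn'⟩, s, hs⟩)
  obtain ⟨M, r, u, w, -, huw, h₃, h₄⟩ := h.pro.exists_middle_kernel a.exact (h.pro_map hiq) h₁
    h₂.symm (h.pro_tr_prj hX hk) (h.pro_tr_prj hZ hn')
  refine ⟨⟨a.k - 1, n, M, u, w, (y (Pro A)).map r ≫ a.m, huw, ?_, ?_⟩, sub_one_lt _, hn, r, rfl⟩
  · rw [← Functor.map_comp_assoc, h₃, Functor.map_comp, Category.assoc, a.i_m, ← Category.assoc,
      map_tr_fil]
  · rw [Category.assoc, a.m_g, ← Functor.map_comp_assoc, h₄, Functor.map_comp, Category.assoc,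
      map_tr_fil]

/-- A lattice contains, up to enlarging it, every element of `Y`. -/
lemma exists_fac (c : ℤ → Lattice E f g) (hc : ∀ {i j : ℤ}, i < j → Lt (c i) (c j)) (Q : Pro A)
    (t : (y (Pro A)).obj Q ⟶ Y) :
    ∃ (j : ℤ) (s : Q ⟶ (c j).obj), t = (y (Pro A)).map s ≫ (c j).m := by
  have hE := h.pro.elemExact hfg
  have hk : StrictMono fun j => (c j).k := fun _ _ hij => (hc hij).1
  have hl : StrictMono fun j => (c j).l := fun _ _ hij => (hc hij).2.1
  obtain ⟨l, z, hz⟩ := exists_fac_fil (t ≫ g)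
  obtain ⟨j, -, hj⟩ := exists_le_of_strictMono hl l 0
  -- After a cover, the image of `t` lifts to the lattice `c j`. The difference from `t` comes from
  -- some `X_k`, and a larger lattice contains both.
  obtain ⟨Q', p, x, hp, hx⟩ := h.pro.exists_cover ⟨_, _, (c j).exact⟩ (z ≫ tr Z hj)
  obtain ⟨r, hr⟩ := hE.exact ((y (Pro A)).map p ≫ t - (y (Pro A)).map x ≫ (c j).m) (by
    rw [Preadditive.sub_comp, Category.assoc, Category.assoc, hz, m_g,
      ← Category.assoc ((y (Pro A)).map x), ← Functor.map_comp, hx, Functor.map_comp,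
      Functor.map_comp, Category.assoc, Category.assoc, map_tr_fil, sub_self])
  obtain ⟨k, r, rfl⟩ := exists_fac_fil r
  obtain ⟨j', hj', hkj⟩ := exists_le_of_strictMono hk k (j + 1)
  obtain ⟨-, -, u, hu⟩ := hc (show j < j' by lia)
  have := (c j').mono_m h hX hZ hfg
  -- The factorization found after the cover descends because `(c j').m` is a monomorphism.
  obtain ⟨s, hs⟩ := h.pro.ind.exists_lift_of_admissibleEpi (e := (y (Pro A)).map p)
    (by obtain ⟨_, _, hp⟩ := hp; exact ⟨_, _, h.pro.ind_map hp⟩) (m := (c j').m) t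
    ((y (Pro A)).map (x ≫ u + r ≫ tr X hkj ≫ (c j').i)) (by
      rw [Functor.map_add, Preadditive.add_comp, Functor.map_comp, Category.assoc, hu,
        Functor.map_comp, Functor.map_comp, Category.assoc, Category.assoc, i_m,
        ← Category.assoc ((y (Pro A)).map (tr X hkj)), map_tr_fil, ← Category.assoc, hr,
        add_sub_cancel])
  obtain ⟨s, rfl⟩ := (y (Pro A)).map_surjective s
  exact ⟨j', s, hs.symm⟩

/-- A map from a lattice to an object of `A` vanishes on a smaller lattice. -/
lemma exists_comp_eq_zero (c : ℤ → Lattice E f g) (hc : ∀ {i j : ℤ}, i < j → Lt (c i) (c j))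
    (j : ℤ) (a : A) (t : (c j).obj ⟶ (cst A).obj a) :
    ∃ (i : ℤ) (_ : i ≤ j), ∀ u : (c i).obj ⟶ (c j).obj,
      (y (Pro A)).map u ≫ (c j).m = (c i).m → u ≫ t = 0 := by
  have hk : StrictMono fun j => (c j).k := fun _ _ hij => (hc hij).1
  have hl : StrictMono fun j => (c j).l := fun _ _ hij => (hc hij).2.1
  -- Shrinking once kills the restriction of `t` to the part from `X`; what remains is a map from a
  -- term of `Z`, which a second shrinking kills.
  obtain ⟨n, hn, s, hs⟩ := exists_fac_prj ((c j).i ≫ t)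
  -- The bound `j - 1` ensures `j' < j`, as `hc` requires.
  obtain ⟨j', hj', hnj⟩ := exists_ge_of_strictMono hk n (j - 1)
  obtain ⟨hk', -, u, hu⟩ := hc (show j' < j by lia)
  obtain ⟨w, hw⟩ := (h.pro.cok (c j').exact).desc (u ≫ t) (by
    rw [← Category.assoc, i_comp h hX hZ hfg hk'.le hu, Category.assoc, hs,
      ← tr_comp X hnj hn, Category.assoc, ← Category.assoc (tr X hn),
      (h.pro.ker (h.pro_tr_prj hX hn)).w, zero_comp, comp_zero])
  obtain ⟨n', hn', s', hs'⟩ := exists_fac_prj w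
  obtain ⟨i, hi, hni⟩ := exists_ge_of_strictMono hl n' (j' - 1)
  obtain ⟨-, hl', u', hu'⟩ := hc (show i < j' by lia)
  refine ⟨i, by lia, fun u'' hu'' => ?_⟩
  have : u'' = u' ≫ u := by
    have := (c j).mono_m h hX hZ hfg
    refine (y (Pro A)).map_injective ?_
    rw [← cancel_mono (c j).m, hu'', Functor.map_comp, Category.assoc, hu, hu']
  rw [this, Category.assoc, ← hw, ← Category.assoc, ← comp_q hZ h hl'.le hu', hs',
    ← tr_comp Z hni hn', Category.assoc, Category.assoc, ← Category.assoc (tr Z hn'),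
    (h.pro.ker (h.pro_tr_prj hZ hn')).w, zero_comp, comp_zero, comp_zero]

end Lattice

/-- The objects attached to admissible diagrams are closed under extensions. -/
theorem IsExactCore.exists_iso_of_extension (h : IsExactCore A E) {X Z : Pairs ⥤ A}
    (hX : admissible E X) (hZ : admissible E Z) {Y : IndPro A} {f : (indProLim A).obj X ⟶ Y}
    {g : Y ⟶ (indProLim A).obj Z} (hfg : E.pro.ind f g) :
    ∃ W : Pairs ⥤ A, admissible E W ∧ Nonempty ((indProLim A).obj W ≅ Y) := by
  have : Nonempty (Lattice E f g) := Lattice.nonempty h hfg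
  obtain ⟨c, hc⟩ := exists_int_chain (Lattice.Lt (E := E) (f := f) (g := g))
    (Lattice.exists_gt h hfg) (Lattice.exists_lt h hX hZ)
  have : IsTrans (Lattice E f g) Lattice.Lt := ⟨fun _ _ _ => Lattice.Lt.trans⟩
  have hc' {i j : ℤ} (hij : i < j) : (c i).Lt (c j) :=
    Int.rel_of_forall_rel_succ_of_lt _ hc hij
  have hm (j : ℤ) : Mono (c j).m := (c j).mono_m h hX hZ hfg
  have hu {i j : ℤ} (hij : i ≤ j) : ∃ u : (c i).obj ⟶ (c j).obj,
      (y (Pro A)).map u ≫ (c j).m = (c i).m := by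
    obtain rfl | hij := hij.eq_or_lt
    · exact ⟨𝟙 _, by simp⟩
    · exact (hc' hij).2.2
  choose u hu using @hu
  -- The lattices are subobjects of `Y`, so the inclusions between them are unique, hence
  -- functorial.
  let P : ℤ ⥤ Pro A :=
    { obj := fun j => (c j).obj
      map := fun s => u (leOfHom s)
      map_id := fun j => (y (Pro A)).map_injective (by
        rw [← cancel_mono (c j).m, hu, CategoryTheory.Functor.map_id, Category.id_comp])
      map_comp := fun {i j k} s t => (y (Pro A)).map_injective (by
        rw [← cancel_mono (c k).m, hu, Functor.map_comp, Category.assoc, hu, hu]) }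
  refine h.exists_iso_indProLim P (fun {i j} hij => ?_) (fun j a t => ?_) (fun j => (c j).m) hm
    (fun hij => hu hij) (Lattice.exists_fac h hX hZ hfg c hc')
  · refine Lattice.exists_quotient h hX hZ hfg ?_ ?_ (hu hij)
    · obtain rfl | hij := hij.eq_or_lt
      · exact le_rfl
      · exact (hc' hij).1.le
    · obtain rfl | hij := hij.eq_or_lt
      · exact le_rfl
      · exact (hc' hij).2.1.le
  · obtain ⟨i, hij, hi⟩ := Lattice.exists_comp_eq_zero h hX hZ hfg c hc' j a t
    exact ⟨i, hij, hi _ (hu hij)⟩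

/-- The essential image of the Beilinson category is closed under extensions. -/
theorem IsExactCore.essImage_of_extension (h : IsExactCore A E)
    (ι : BeilinsonCategory E ⥤ IndPro A)
    (e : toBeilinson E ⋙ ι ≅ (admissible E).ι ⋙ indProLim A) (X Z : BeilinsonCategory E)
    (Y : IndPro A) (f : ι.obj X ⟶ Y) (g : Y ⟶ ι.obj Z) (hfg : E.pro.ind f g) :
    ι.essImage Y := by
  suffices H : ∀ {X Z : AdmDiagram E} (f : ι.obj ((toBeilinson E).obj X) ⟶ Y)
      (g : Y ⟶ ι.obj ((toBeilinson E).obj Z)), E.pro.ind f g → ι.essImage Y from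
    H (X := (Localization.Construction.objEquiv _).symm X)
      (Z := (Localization.Construction.objEquiv _).symm Z) f g hfg
  clear hfg f g X Z
  intro X Z f g hfg
  have hfg' : E.pro.ind (e.inv.app X ≫ f) (g ≫ e.hom.app Z) :=
    h.pro.ind.of_iso ⟨e.app X, Iso.refl _, e.app Z, by simp [← Category.assoc], by simp⟩ hfg
  obtain ⟨W, hW, ⟨e'⟩⟩ := h.exists_iso_of_extension X.property Z.property hfg'
  exact ⟨(toBeilinson E).obj ⟨W, hW⟩, ⟨e.app ⟨W, hW⟩ ≪≫ e'⟩⟩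

end Lattice

end Beilinson

end

/-! ### The main theorem -/

open Beilinson in
theorem mainTheorem1 {A : Type u} [Category.{v} A] [Preadditive A] (E : SequenceClass A)
    (hE : IsExactStructure A E) :
    ∃ (_ : Preadditive (IndPro A)) (_ : Preadditive (BeilinsonCategory E))
      (ι : BeilinsonCategory E ⥤ IndPro A),
      -- `Ind Pro(A)` is an exact category
      IsExactStructure (IndPro A) E.pro.ind ∧
      -- `ι` is the functor `X ↦ “colim”_j “lim”_i X_{i,j}`; it is additive and fully faithful
      Nonempty (toBeilinson E ⋙ ι ≅ (admissible E).ι ⋙ indProLim A) ∧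
      (toBeilinson E).Additive ∧ ι.Additive ∧ ι.Full ∧ ι.Faithful ∧
      -- its essential image is closed under extensions
      (∀ (X Z : BeilinsonCategory E) (Y : IndPro A) (f : ι.obj X ⟶ Y) (g : Y ⟶ ι.obj Z),
        E.pro.ind f g → ι.essImage Y) ∧
      -- the sequences that `ι` sends to admissible ones make the Beilinson category exact
      IsExactStructure (BeilinsonCategory E) (E.pro.ind.preimage ι) := by
  have h := hE.core
  let ι := Localization.Construction.lift _ h.inverts_reindexMaps
  let e : toBeilinson E ⋙ ι ≅ (admissible E).ι ⋙ indProLim A :=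
    eqToIso (Localization.Construction.fac _ h.inverts_reindexMaps)
  have hfull : ι.Full := h.full_of_iso ι e
  have hfaithful : ι.Faithful := h.faithful_of_iso ι e
  -- The additive structure is transported along the fully faithful `ι`, which makes `ι` additive;
  -- the localization functor is then additive because its composite with `ι` is.
  let _ : Preadditive (BeilinsonCategory E) := .ofFullyFaithful (.ofFullyFaithful ι)
  have hadd : ι.Additive := Functor.FullyFaithful.additive_ofFullyFaithful (.ofFullyFaithful ι)
  have hadd' : (toBeilinson E).Additive := additive_toBeilinson ι e
  have := h.hasZeroObject_beilinson
  have hext := h.essImage_of_extension ι e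
  exact ⟨inferInstance, inferInstance, ι, h.pro.ind.exact, ⟨e⟩, hadd', hadd, hfull, hfaithful,
    hext, (h.pro.ind.preimage ι hext).exact⟩
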